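/- \textbf{Setting.} Let $g:\mathbb R\to\mathbb R$ be infinitely differentiable, with $g$ and all its derivatives of polynomial growth, such that $f=e^{-g}$ is a probability density with finite moments of all orders. Let $\kappa\ge 0$, $C_-,C_+>0$, and for every $n$ let $\lambda_{1,n},\dots,\lambda_{n,n}$ be scales with $$C_-\, i^{-\kappa}\le \lambda_{i,n}\le C_+\, i^{-\kappa}\qquad(1\le i\le n).$$ Let $\tilde\pi_n$ be the probability law on $\mathbb R^n$ with Lebesgue density $\prod_{i=1}^n \lambda_{i,n}^{-1} f(x_i/\lambda_{i,n})$, and let $\pi_n$ be a probability law with $d\pi_n/d\tilde\pi_n=e^{-\phi_n}$, $\phi_n$ measurable. Let $\sigma_n>0$, $\sigma_n^2=l^2n^{-\rho}$ with $l,\rho>0$. Consider the Metropolis–Hastings chain with target $\pi_n$ and proposal, with $Z\sim N(0,I_n)$, $$\text{RWM: } y=x+\sigma_nZ,\qquad \text{SLA: } y=x+\tfrac{\sigma_n^2}{2}\nabla\log\tilde\pi_n(x)+\sigma_nZ .$$ Let $q_n(x,\cdot)$ be the proposal density, let $a_n(x,y)=1\wedge\frac{\pi_n(y)q_n(y,x)}{\pi_n(x)q_n(x,y)}$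 (and $0$ where the denominator vanishes) be the acceptance probability, and let $x'$ be the state after one step from $x$ ($x'=y$ with probability $a_n(x,y)$, otherwise $x'=x$). Expectations are taken with $x\sim\pi_n$, and $S_n=E[(x'_{i^*}-x_{i^*})^2]$ for an arbitrary fixed coordinate $i^*$. Put $I=1$ for RWM and $I=1/3$ for SLA. With $X\sim f$ let $$K^{\rm RWM}=E[g'(X)^2],\qquad K^{\rm SLA}=\tfrac1{48}E[3g''(X)^3+5g'''(X)^2],$$ and, with $\Phi$ the standard normal distribution function, $$a^{\rm RWM}(l)=2\Phi\Big(-\tfrac l2\sqrt{K^{\rm RWM}/\tau^{\rm RWM}}\Big),\qquad a^{\rm SLA}(l)=2\Phi\Big(-\tfrac{l^3}2\sqrt{K^{\rm SLA}/\tau^{\rm SLA}}\Big),$$ where $$\frac1{\tau^{\rm RWM}}=\lim_{n\to\infty}n^{-(2\kappa+1)}\sum_{i=1}^n\lambda_{i,n}^{-2},\qquad \frac1{\tau^{\rm SLA}}=\lim_{n\to\infty}n^{-(6\kappa+1)}\sum_{i=1}^n\lambda_{i,n}^{-6};$$ the assertions below in which $a(l)$ (of the algorithm considered) occurs are made provided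 that the corresponding limit exists. Write $|x|_s=(\sum_{i=1}^n i^{2s}x_i^2)^{1/2}$. The conditions on $\phi_n$ below need only hold for some $\tilde\pi_n$-version of $\phi_n$. \textbf{Claim.} $K^{\rm RWM},K^{\rm SLA}>0$, and for both algorithms, as $n\to\infty$: 1. If $\phi_n\equiv0$ for all $n$: (i) if $\rho=2\kappa+I$, then $E[a_n(x,y)]\to a(l)$; (ii) if $\rho>2\kappa+I$, then $E[a_n(x,y)]\to1$; (iii) if $2\kappa<\rho<2\kappa+I$, then $n^pE[a_n(x,y)]\to0$ for every $p\ge0$. 2. If there is $M>0$ with $|\phi_n|\le M$ on $\mathbb R^n$ for all large $n$: (i) if $\rho\ge2\kappa+I$, then $\liminf_n E[a_n(x,y)]>0$; (ii) if $2\kappa<\rho<2\kappa+I$, then $n^pE[a_n(x,y)]\to0$ for every $p\ge0$. Suppose now that there is $M\in\mathbb R$ with $\phi_n\ge M$ on $\mathbb R^n$ for all large $n$, and that there are a locally bounded $\delta:[0,\infty)^2\to[0,\infty)$, constants $C,p_0>0$ and $s,s',s''<\kappa-\frac12$ such that, for all large $n$ and all $x,y\in\mathbb R^n$, $$|\phi_n(y)-\phi_n(x)|\le\delta(|x|_s,|y|_s)\,|y-x|_{s'},\qquad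 |\phi_n(x)|\le C(1+|x|_{s''}^{p_0}).$$ 3. Then (i), (ii) and (iii) of part 1 hold. 4. Moreover $(x'_{i^*}-x_{i^*})^2$ is integrable for all large $n$, and: (i) if $\rho=2\kappa+I$, then $S_n=l^2a(l)\,n^{-2\kappa-I}+o(n^{-2\kappa-I})$; (ii) if $\rho>2\kappa+I$, then $S_n=l^2n^{-\rho}+o(n^{-\rho})$; (iii) if $2\kappa<\rho<2\kappa+I$, then $S_n=O(n^{-p})$ for every $p\ge0$. -/

import Mathlib

open MeasureTheory ProbabilityTheory Filter Asymptotics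
open scoped Topology ContDiff

namespace LocalMH

noncomputable section

/-- The two Metropolis-Hastings algorithms: random-walk Metropolis and the simplified Langevin
algorithm. -/
inductive Algorithm where
  | rwm : Algorithm
  | sla : Algorithm

/-- The index `I`: `1` for RWM and `1/3` for SLA. -/
def Algorithm.index : Algorithm → ℝ
  | .rwm => 1
  | .sla => 1 / 3

/-- Standing regularity assumption on `g` and the probability density `f = exp (-g)`: the function
`g` is smooth, all its derivatives (including `g` itself) have polynomial growth, and `f` has
finite moments of all orders. -/
structure Regular (g : ℝ → ℝ) : Prop where
  smooth : ContDiff ℝ ∞ g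
  growth : ∀ k : ℕ, ∃ (C : ℝ) (m : ℕ), ∀ x : ℝ, |iteratedDeriv k g x| ≤ C * (1 + |x| ^ m)
  moments : ∀ k : ℕ, Integrable (fun x : ℝ => |x| ^ k * Real.exp (-g x))
  density : ∫ x : ℝ, Real.exp (-g x) = 1

variable {n : ℕ}

/-- The Lebesgue density `∏ i, (1 / λ i) f (x i / λ i)` of the reference product law, with
`f = exp (-g)`. -/
def refDensity (g : ℝ → ℝ) (lam : Fin n → ℝ) (x : Fin n → ℝ) : ℝ :=
  ∏ i, 1 / lam i * Real.exp (-g (x i / lam i))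

/-- The reference product law. -/
def refMeasure (g : ℝ → ℝ) (lam : Fin n → ℝ) : Measure (Fin n → ℝ) :=
  volume.withDensity fun x => ENNReal.ofReal (refDensity g lam x)

/-- The target law: density `exp (-φ)` with respect to the reference law. -/
def target (g : ℝ → ℝ) (lam : Fin n → ℝ) (φ : (Fin n → ℝ) → ℝ) : Measure (Fin n → ℝ) :=
  (refMeasure g lam).withDensity fun x => ENNReal.ofReal (Real.exp (-φ x))

/-- The Lebesgue density of the target law. -/
def targetDensity (g : ℝ → ℝ) (lam : Fin n → ℝ) (φ : (Fin n → ℝ) → ℝ) (x : Fin n → ℝ) : ℝ :=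
  Real.exp (-φ x) * refDensity g lam x

/-- The mean of the proposal started at `x`: `x` for RWM, and `x + (σ² / 2) ∇ log π̃ (x)` for SLA,
where `π̃` is the density of the reference law. -/
def proposalMean (alg : Algorithm) (g : ℝ → ℝ) (lam : Fin n → ℝ) (σ : ℝ) (x : Fin n → ℝ) :
    Fin n → ℝ :=
  match alg with
  | .rwm => x
  | .sla => fun i =>
      x i + σ ^ 2 / 2 * fderiv ℝ (fun w => Real.log (refDensity g lam w)) x (Pi.single i 1)

/-- The proposal `y` obtained from the current state `x` and the standard Gaussian vector `z`. -/
def proposal (alg : Algorithm) (g : ℝ → ℝ) (lam : Fin n → ℝ) (σ : ℝ) (x z : Fin n → ℝ) :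
    Fin n → ℝ :=
  fun i => proposalMean alg g lam σ x i + σ * z i

/-- The Lebesgue density `q (x, y)` in `y` of the proposal started at `x`, that is, of the
Gaussian law with mean `proposalMean x` and covariance `σ²` times the identity. -/
def proposalDensity (alg : Algorithm) (g : ℝ → ℝ) (lam : Fin n → ℝ) (σ : ℝ)
    (x y : Fin n → ℝ) : ℝ :=
  ∏ i, gaussianPDFReal (proposalMean alg g lam σ x i) ⟨σ ^ 2, sq_nonneg σ⟩ (y i)

open Classical in
/-- The Metropolis-Hastings acceptance probability `a (x, y)`. -/
def accept (alg : Algorithm) (g : ℝ → ℝ) (lam : Fin n → ℝ) (φ : (Fin n → ℝ) → ℝ) (σ : ℝ)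
    (x y : Fin n → ℝ) : ℝ :=
  if 0 < targetDensity g lam φ x * proposalDensity alg g lam σ x y then
    min 1 ((targetDensity g lam φ y * proposalDensity alg g lam σ y x) /
      (targetDensity g lam φ x * proposalDensity alg g lam σ x y))
  else 0

/-- The standard Gaussian law on `ℝⁿ`. -/
def stdGauss (n : ℕ) : Measure (Fin n → ℝ) := Measure.pi fun _ => gaussianReal 0 1

/-- The average acceptance probability in stationarity: the expectation of `a (x, y)`, where `x`
has the target law and `y` is the proposal from `x`. -/
def meanAccept (alg : Algorithm) (g : ℝ → ℝ) (lam : Fin n → ℝ) (φ : (Fin n → ℝ) → ℝ)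
    (σ : ℝ) : ℝ :=
  ∫ v, accept alg g lam φ σ v.1 (proposal alg g lam σ v.1 v.2)
    ∂((target g lam φ).prod (stdGauss n))

open Classical in
/-- One step of the chain: move from `x` to the proposal if the uniform variable `u` does not
exceed the acceptance probability, and stay at `x` otherwise. -/
def nextState (alg : Algorithm) (g : ℝ → ℝ) (lam : Fin n → ℝ) (φ : (Fin n → ℝ) → ℝ) (σ : ℝ)
    (x z : Fin n → ℝ) (u : ℝ) : Fin n → ℝ :=
  if u ≤ accept alg g lam φ σ x (proposal alg g lam σ x z) then proposal alg g lam σ x z else x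

/-- The joint law of the current state (stationary), the Gaussian noise in the proposal and the
uniform variable on `[0, 1]` that decides on acceptance; the three are independent. -/
def stepLaw (g : ℝ → ℝ) (lam : Fin n → ℝ) (φ : (Fin n → ℝ) → ℝ) :
    Measure ((Fin n → ℝ) × (Fin n → ℝ) × ℝ) :=
  (target g lam φ).prod ((stdGauss n).prod (volume.restrict (Set.Icc 0 1)))

/-- The squared jump of coordinate `i` in one step of the chain. Coordinates are numbered from `0`;
the value is `0` if there is no such coordinate, that is, if `n ≤ i`. -/
def sqJump (alg : Algorithm) (g : ℝ → ℝ) (lam : Fin n → ℝ) (φ : (Fin n → ℝ) → ℝ) (σ : ℝ)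
    (i : ℕ) (v : (Fin n → ℝ) × (Fin n → ℝ) × ℝ) : ℝ :=
  if h : i < n then
    (nextState alg g lam φ σ v.1 v.2.1 v.2.2 ⟨i, h⟩ - v.1 ⟨i, h⟩) ^ 2
  else 0

/-- The mean squared-jump-distance of coordinate `i`, in stationarity. -/
def meanSqJump (alg : Algorithm) (g : ℝ → ℝ) (lam : Fin n → ℝ) (φ : (Fin n → ℝ) → ℝ) (σ : ℝ)
    (i : ℕ) : ℝ :=
  ∫ v, sqJump alg g lam φ σ i v ∂(stepLaw g lam φ)

/-- The norm `|x|_s = (∑ i^(2s) x_i²)^(1/2)`, the sum running over `i = 1, …, n`. -/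
def sNorm (s : ℝ) (x : Fin n → ℝ) : ℝ :=
  Real.sqrt (∑ i : Fin n, ((i : ℕ) + 1 : ℝ) ^ (2 * s) * x i ^ 2)

/-- The functions `φ n` are eventually bounded by a common constant. -/
def UnifBounded (φ : (n : ℕ) → (Fin n → ℝ) → ℝ) : Prop :=
  ∃ M : ℝ, 0 < M ∧ ∀ᶠ n in atTop, ∀ x, |φ n x| ≤ M

/-- The functions `φ n` are eventually bounded from below by a common constant. -/
def UnifBoundedBelow (φ : (n : ℕ) → (Fin n → ℝ) → ℝ) : Prop :=
  ∃ M : ℝ, ∀ᶠ n in atTop, ∀ x, M ≤ φ n x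

/-- The local Lipschitz and growth condition on `φ n`, with all constants, all exponents and the
locally bounded function `δ` on `[0, ∞) × [0, ∞)` independent of `n`. -/
def LocalLipGrowth (κ : ℝ) (φ : (n : ℕ) → (Fin n → ℝ) → ℝ) : Prop :=
  ∃ (δ : ℝ → ℝ → ℝ) (C p s s' s'' : ℝ),
    (∀ a b : ℝ, 0 ≤ a → 0 ≤ b → 0 ≤ δ a b) ∧
    (∀ R : ℝ, ∃ B : ℝ, ∀ a ∈ Set.Icc 0 R, ∀ b ∈ Set.Icc 0 R, δ a b ≤ B) ∧
    0 < C ∧ 0 < p ∧ s < κ - 1 / 2 ∧ s' < κ - 1 / 2 ∧ s'' < κ - 1 / 2 ∧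
    ∀ᶠ n in atTop,
      (∀ x y, |φ n y - φ n x| ≤ δ (sNorm s x) (sNorm s y) * sNorm s' (y - x)) ∧
      (∀ x, |φ n x| ≤ C * (1 + sNorm s'' x ^ p))

/-- The constant `K` of each algorithm, where `X` has density `f = exp (-g)`:
`E[g'(X)²]` for RWM and `E[3 g''(X)³ + 5 g'''(X)²] / 48` for SLA. -/
def Algorithm.K (alg : Algorithm) (g : ℝ → ℝ) : ℝ :=
  match alg with
  | .rwm => ∫ x : ℝ, deriv g x ^ 2 * Real.exp (-g x)
  | .sla => (∫ x : ℝ,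
      (3 * iteratedDeriv 2 g x ^ 3 + 5 * iteratedDeriv 3 g x ^ 2) * Real.exp (-g x)) / 48

/-- The limiting acceptance probability: `2 Φ(-(l / 2) √(K / τ))` for RWM and
`2 Φ(-(l³ / 2) √(K / τ))` for SLA, where `Φ` is the standard normal distribution function. -/
def Algorithm.limitAccept (alg : Algorithm) (g : ℝ → ℝ) (τ l : ℝ) : ℝ :=
  match alg with
  | .rwm => 2 * cdf (gaussianReal 0 1) (-(l / 2) * Real.sqrt (Algorithm.rwm.K g / τ))
  | .sla => 2 * cdf (gaussianReal 0 1) (-(l ^ 3 / 2) * Real.sqrt (Algorithm.sla.K g / τ))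

/-- The normalized sum of inverse powers of the scales: `n^(-(2κ+1)) ∑ λ_i⁻²` for RWM and
`n^(-(6κ+1)) ∑ λ_i⁻⁶` for SLA. -/
def Algorithm.scaleSum (alg : Algorithm) (κ : ℝ) (lam : Fin n → ℝ) : ℝ :=
  match alg with
  | .rwm => (n : ℝ) ^ (-(2 * κ + 1)) * ∑ i, (lam i ^ 2)⁻¹
  | .sla => (n : ℝ) ^ (-(6 * κ + 1)) * ∑ i, (lam i ^ 6)⁻¹

end

end LocalMH

open LocalMH

/-! After division by the scales, the pairs (x_i/λ_i, z_i) are i.i.d. with law `pairMeasure g` under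
the reference law and the noise. The log acceptance ratio becomes R + φ(x) - φ(y), where R is a sum
of independent terms r_i, each a function of one pair and of the relative step h_i = σ/λ_i. A Taylor
expansion gives r_i of exact order h_i^m with m = `alg.order`: m = 1 for RWM, and m = 3 for SLA,
where the Langevin drift turns the ratio into the error of a trapezoidal rule. The leading
coefficient has second moment K (`integral_leading_sq`).

Reversibility replaces any further expansion. Exchanging state and proposal shows that the law of
-r_i is the law of r_i tilted by e^r (`map_logRatio_neg`). Hence E r_i = E[r_i (1 - e^{r_i})/(1 +
e^{r_i})] (`integral_logRatio_eq`), so the mean is of second order, asymptotically -K h_i^{2m}/2,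
which is minus half the variance. Likewise E e^{r_i/2} = E[1/cosh(r_i/2)] ≤ exp(-c h_i^{2m}) for
small h_i.

The sum of the h_i^{2m} is comparable to n^{m(2κ+I-ρ)}, where mI = 1. If it converges to S,
characteristic functions give R → N(-s²/2, s²) with s² = KS (`tendsto_integral_totalRatio`), and for
this law the mean of min(1, e^R) is 2Φ(-s/2). If it tends to 0, so does E|R|, and acceptance tends
to 1. If it grows like a power of n, then E min(1, e^R) ≤ E e^{R/2} ≤ exp(-c Σ h_i^{2m}) decays
faster than any power of n.

A bounded φ changes these expectations by constant factors only, and the decay needs only a lower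
bound on φ. Under the local Lipschitz condition, E[e^{-φ(x)} a V] with V = 1 or V = z_i² is compared
with E min(1, e^R) (`abs_integral_weighted_sub_le`). One step hardly changes φ. Because Σ
j^{2(s'-κ)} converges, φ(x) depends, up to a small error, on a fixed number N of coordinates, chosen
to include i. These N coordinates contribute negligibly to R, and the rest of R is independent of
them; finally E[e^{-φ(x)} V] = 1. The choice V = z_i² yields the mean squared jump, because the
squared jump proposed is σ² z_i² to leading order. -/

namespace LocalMH

noncomputable section

/-! ### One coordinate of the algorithms, in units of the scale -/

/-- The order in the step size at which the log acceptance ratio is of leading order. -/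
def Algorithm.order : Algorithm → ℕ
  | .rwm => 1
  | .sla => 3

/-- The proposal in one coordinate, with all lengths measured in units of the scale. -/
def Algorithm.step (alg : Algorithm) (g : ℝ → ℝ) (h x z : ℝ) : ℝ :=
  match alg with
  | .rwm => x + h * z
  | .sla => x + h * (z - h / 2 * deriv g x)

/-- The contribution of one coordinate to the log acceptance ratio. -/
def Algorithm.logRatio (alg : Algorithm) (g : ℝ → ℝ) (h x z : ℝ) : ℝ :=
  match alg with
  | .rwm => g x - g (Algorithm.rwm.step g h x z)
  | .sla => g x - g (Algorithm.sla.step g h x z) +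
      (Algorithm.sla.step g h x z - x) * (deriv g x + deriv g (Algorithm.sla.step g h x z)) / 2 +
      h ^ 2 / 8 * (deriv g x ^ 2 - deriv g (Algorithm.sla.step g h x z) ^ 2)

/-- The leading coefficient of the log acceptance ratio. -/
def Algorithm.leading (alg : Algorithm) (g : ℝ → ℝ) (x z : ℝ) : ℝ :=
  match alg with
  | .rwm => -(deriv g x * z)
  | .sla => iteratedDeriv 3 g x * z ^ 3 / 12 - deriv g x * iteratedDeriv 2 g x * z / 4

theorem Algorithm.order_pos (alg : Algorithm) : 0 < alg.order := by cases alg <;> simp [order]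

/-! ### Taylor estimates -/

/-- The mean value inequality on [-|u|, |u|]. The factor 1/(k+1) that integration would give is
dropped. Iterating this lemma turns a bound on a high derivative into a Taylor estimate. -/
theorem abs_le_pow_succ_of_hasDerivAt {F F' : ℝ → ℝ} {B d : ℝ} {k : ℕ}
    (hF : ∀ u, HasDerivAt F (F' u) u) (h0 : F 0 = 0)
    (hB : ∀ u, |u| ≤ d → |F' u| ≤ B * |u| ^ k) {u : ℝ} (hu : |u| ≤ d) :
    |F u| ≤ B * |u| ^ (k + 1) := by
  have hB0 : 0 ≤ B * |u| ^ k := (abs_nonneg _).trans (hB u hu)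
  by_cases hu0 : u = 0
  · subst hu0; simp [h0]
  -- The sign of B is not assumed; it is read off from the bound at u, which is informative only for
  -- u ≠ 0.
  have hBn : 0 ≤ B := by
    have : 0 < |u| ^ k := by positivity
    exact nonneg_of_mul_nonneg_left hB0 this
  have := (convex_Icc (-|u|) |u|).norm_image_sub_le_of_norm_hasDerivWithin_le
    (f := F) (f' := F') (C := B * |u| ^ k) (x := 0) (y := u)
    (fun x _ => (hF x).hasDerivWithinAt) (fun x hx => by
      have hx' : |x| ≤ |u| := abs_le.2 hx
      refine (hB x (hx'.trans hu)).trans ?_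
      gcongr) (by simp) (by constructor <;> [exact neg_abs_le u; exact le_abs_self u])
  simpa [h0, pow_succ, mul_assoc] using this

theorem Regular.hasDerivAt_iteratedDeriv {g : ℝ → ℝ} (hg : Regular g) (k : ℕ) (x : ℝ) :
    HasDerivAt (iteratedDeriv k g) (iteratedDeriv (k + 1) g x) x := by
  rw [iteratedDeriv_succ]
  exact ((hg.smooth.differentiable_iteratedDeriv k
    (by exact_mod_cast ENat.natCast_lt_top k)) x).hasDerivAt

theorem Regular.hasDerivAt {g : ℝ → ℝ} (hg : Regular g) (x : ℝ) :
    HasDerivAt g (deriv g x) x := by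
  simpa [iteratedDeriv_one] using hg.hasDerivAt_iteratedDeriv 0 x

theorem Regular.hasDerivAt_deriv {g : ℝ → ℝ} (hg : Regular g) (x : ℝ) :
    HasDerivAt (deriv g) (iteratedDeriv 2 g x) x := by
  simpa [iteratedDeriv_one] using hg.hasDerivAt_iteratedDeriv 1 x

theorem Regular.continuous_iteratedDeriv {g : ℝ → ℝ} (hg : Regular g) (k : ℕ) :
    Continuous (iteratedDeriv k g) :=
  hg.smooth.continuous_iteratedDeriv k (by exact_mod_cast le_top)

theorem Regular.continuous {g : ℝ → ℝ} (hg : Regular g) : Continuous g := hg.smooth.continuous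

theorem Regular.continuous_deriv {g : ℝ → ℝ} (hg : Regular g) : Continuous (deriv g) := by
  simpa [iteratedDeriv_one] using hg.continuous_iteratedDeriv 1

/-- The error of the trapezoidal rule. -/
def trapezoidError (g : ℝ → ℝ) (x u : ℝ) : ℝ :=
  g x - g (x + u) + u * (deriv g x + deriv g (x + u)) / 2

/-- The error vanishes at 0 together with its first derivative, and the second derivative is u
g'''(x+u)/2, which also vanishes at 0. This is why the error is of third order. -/
theorem Regular.hasDerivAt_trapezoidError {g : ℝ → ℝ} (hg : Regular g) (x u : ℝ) :
    HasDerivAt (trapezoidError g x)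
      ((deriv g x - deriv g (x + u)) / 2 + u * iteratedDeriv 2 g (x + u) / 2) u := by
  have h1 : HasDerivAt (fun u => g (x + u)) (deriv g (x + u)) u :=
    (hg.hasDerivAt (x + u)).comp_const_add x u
  have h2 : HasDerivAt (fun u => deriv g (x + u)) (iteratedDeriv 2 g (x + u)) u :=
    (hg.hasDerivAt_deriv (x + u)).comp_const_add x u
  convert! ((h1.const_sub (g x)).add (((hasDerivAt_id u).mul (h2.const_add (deriv g x))).div_const 2))
    using 1
  simp; ring

theorem Regular.hasDerivAt_trapezoidError_deriv {g : ℝ → ℝ} (hg : Regular g) (x u : ℝ) :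
    HasDerivAt (fun u => (deriv g x - deriv g (x + u)) / 2 + u * iteratedDeriv 2 g (x + u) / 2)
      (u * iteratedDeriv 3 g (x + u) / 2) u := by
  have h2 : HasDerivAt (fun u => deriv g (x + u)) (iteratedDeriv 2 g (x + u)) u :=
    (hg.hasDerivAt_deriv (x + u)).comp_const_add x u
  have h3 : HasDerivAt (fun u => iteratedDeriv 2 g (x + u)) (iteratedDeriv 3 g (x + u)) u :=
    (hg.hasDerivAt_iteratedDeriv 2 (x + u)).comp_const_add x u
  convert! ((h2.const_sub (deriv g x)).div_const 2).add (((hasDerivAt_id u).mul h3).div_const 2)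
    using 1
  simp; ring

theorem Regular.abs_trapezoidError_le {g : ℝ → ℝ} (hg : Regular g) {x d B : ℝ}
    (hB : ∀ u, |u| ≤ d → |iteratedDeriv 3 g (x + u)| ≤ B) {u : ℝ} (hu : |u| ≤ d) :
    |trapezoidError g x u| ≤ B / 2 * |u| ^ 3 := by
  refine abs_le_pow_succ_of_hasDerivAt (k := 2) (hg.hasDerivAt_trapezoidError x)
    (by simp [trapezoidError]) (fun v hv => ?_) hu
  refine abs_le_pow_succ_of_hasDerivAt (F := fun u => (deriv g x - deriv g (x + u)) / 2 +
    u * iteratedDeriv 2 g (x + u) / 2) (k := 1) (hg.hasDerivAt_trapezoidError_deriv x)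
    (by simp) (fun w hw => ?_) hv
  rw [abs_div, abs_mul, abs_two, pow_one]
  have := mul_le_mul_of_nonneg_left (hB w hw) (abs_nonneg w)
  linarith

/-- The same double integration after subtracting the Taylor polynomial at each level: g''' u/2,
then g''' u²/4, then g''' u³/12, where g''' is taken at x. What is left of the second derivative is
u (g'''(x+u) - g'''(x))/2, controlled by the fourth derivative. -/
theorem Regular.abs_trapezoidError_sub_le {g : ℝ → ℝ} (hg : Regular g) {x d B : ℝ}
    (hB : ∀ u, |u| ≤ d → |iteratedDeriv 4 g (x + u)| ≤ B) {u : ℝ} (hu : |u| ≤ d) :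
    |trapezoidError g x u - iteratedDeriv 3 g x * u ^ 3 / 12| ≤ B / 2 * |u| ^ 4 := by
  have hp (k : ℕ) (c v : ℝ) : HasDerivAt (fun u : ℝ => c * u ^ (k + 1) / ((k : ℝ) + 1))
      (c * v ^ k) v := by
    have hk : (k : ℝ) + 1 ≠ 0 := by positivity
    convert! ((hasDerivAt_pow (k + 1) v).const_mul c).div_const ((k : ℝ) + 1) using 1
    push_cast
    field_simp
  have e2 : ∀ v, HasDerivAt (fun u : ℝ => iteratedDeriv 3 g x / 4 * u ^ 3 / ((2 : ℕ) + 1))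
      (iteratedDeriv 3 g x / 4 * v ^ 2) v := fun v => hp 2 _ v
  have e1 : ∀ v, HasDerivAt (fun u : ℝ => iteratedDeriv 3 g x / 2 * u ^ 2 / ((1 : ℕ) + 1))
      (iteratedDeriv 3 g x / 2 * v ^ 1) v := fun v => hp 1 _ v
  have main := abs_le_pow_succ_of_hasDerivAt (k := 3) (B := B / 2) (d := d) (u := u)
    (F := fun u => trapezoidError g x u - iteratedDeriv 3 g x / 4 * u ^ 3 / ((2 : ℕ) + 1))
    (fun v => (hg.hasDerivAt_trapezoidError x v).sub (e2 v)) (by simp [trapezoidError])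
    (fun v hv => ?_) hu
  · convert main using 3
    push_cast; ring
  have := abs_le_pow_succ_of_hasDerivAt (k := 2) (B := B / 2) (d := d) (u := v)
    (F := fun u => (deriv g x - deriv g (x + u)) / 2 + u * iteratedDeriv 2 g (x + u) / 2 -
      iteratedDeriv 3 g x / 2 * u ^ 2 / ((1 : ℕ) + 1))
    (fun w => (hg.hasDerivAt_trapezoidError_deriv x w).sub (e1 w)) (by simp)
    (fun w hw => ?_) hv
  · convert this using 3
    push_cast; ring
  have h3 := abs_le_pow_succ_of_hasDerivAt (k := 0) (B := B) (d := d) (u := w)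
    (F := fun u => iteratedDeriv 3 g (x + u) - iteratedDeriv 3 g x)
    (fun w => ((hg.hasDerivAt_iteratedDeriv 3 (x + w)).comp_const_add x w).sub_const _) (by simp)
    (fun w hw => by simpa using hB w hw) hw
  have : w * iteratedDeriv 3 g (x + w) / 2 - iteratedDeriv 3 g x / 2 * w ^ 1 =
      w * (iteratedDeriv 3 g (x + w) - iteratedDeriv 3 g x) / 2 := by ring
  rw [this, abs_div, abs_mul, abs_two]
  rw [zero_add, pow_one] at h3
  have := mul_le_mul_of_nonneg_left h3 (abs_nonneg w)
  linarith

/-! ### Polynomial growth -/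

theorem Regular.exists_abs_iteratedDeriv_le {g : ℝ → ℝ} (hg : Regular g) (k : ℕ) :
    ∃ (C : ℝ) (m : ℕ), 0 ≤ C ∧ ∀ x : ℝ, |iteratedDeriv k g x| ≤ C * (1 + |x|) ^ m := by
  obtain ⟨C, m, h⟩ := hg.growth k
  refine ⟨|C| * 2, m, by positivity, fun x => (h x).trans ?_⟩
  have h1 : (1 : ℝ) ≤ (1 + |x|) ^ m := one_le_pow₀ (by linarith [abs_nonneg x])
  have h2 : |x| ^ m ≤ (1 + |x|) ^ m := by gcongr; linarith
  calc C * (1 + |x| ^ m) ≤ |C| * (1 + |x| ^ m) := by gcongr; exact le_abs_self C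
    _ ≤ |C| * (2 * (1 + |x|) ^ m) := by gcongr; linarith
    _ = _ := by ring

/-- `F` is bounded by a multiple of a power of `B`. -/
def PolyDom {ι : Type*} (B F : ι → ℝ) : Prop :=
  ∃ (C : ℝ) (k : ℕ), 0 ≤ C ∧ ∀ i, |F i| ≤ C * B i ^ k

namespace PolyDom

variable {ι : Type*} {B F G : ι → ℝ}

theorem const (c : ℝ) : PolyDom B (fun _ => c) := ⟨|c|, 0, abs_nonneg _, fun _ => by simp⟩

theorem mul (hB : ∀ i, 1 ≤ B i) (hF : PolyDom B F) (hG : PolyDom B G) :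
    PolyDom B (fun i => F i * G i) := by
  obtain ⟨C, k, hC, hb⟩ := hF
  obtain ⟨C', k', hC', hb'⟩ := hG
  refine ⟨C * C', k + k', by positivity, fun i => ?_⟩
  rw [abs_mul]
  have : 0 ≤ B i := zero_le_one.trans (hB i)
  calc |F i| * |G i| ≤ (C * B i ^ k) * (C' * B i ^ k') :=
        mul_le_mul (hb i) (hb' i) (abs_nonneg _) (by positivity)
    _ = _ := by ring

theorem add (hB : ∀ i, 1 ≤ B i) (hF : PolyDom B F) (hG : PolyDom B G) :
    PolyDom B (fun i => F i + G i) := by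
  obtain ⟨C, k, hC, hb⟩ := hF
  obtain ⟨C', k', hC', hb'⟩ := hG
  refine ⟨C + C', k + k', by positivity, fun i => (abs_add_le _ _).trans ?_⟩
  have h0 : 0 ≤ B i := zero_le_one.trans (hB i)
  have h1 : B i ^ k ≤ B i ^ (k + k') := pow_le_pow_right₀ (hB i) (by omega)
  have h2 : B i ^ k' ≤ B i ^ (k + k') := pow_le_pow_right₀ (hB i) (by omega)
  have := mul_le_mul_of_nonneg_left h1 hC
  have := mul_le_mul_of_nonneg_left h2 hC'
  linarith [hb i, hb' i]

theorem pow (hB : ∀ i, 1 ≤ B i) (hF : PolyDom B F) (m : ℕ) : PolyDom B (fun i => F i ^ m) := by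
  induction m with
  | zero => simpa using const 1
  | succ m ih => simpa [pow_succ] using ih.mul hB hF

theorem abs (hF : PolyDom B F) : PolyDom B (fun i => |F i|) := by
  obtain ⟨C, k, hC, hb⟩ := hF
  exact ⟨C, k, hC, fun i => by simpa using hb i⟩

end PolyDom

/-- The weight against which polynomial growth on `[0, 1] × ℝ × ℝ` is measured. -/
def growthWeight (q : ℝ × ℝ) : ℝ := (1 + |q.1|) * (1 + |q.2|)

theorem one_le_growthWeight (q : ℝ × ℝ) : 1 ≤ growthWeight q := by
  unfold growthWeight
  nlinarith [abs_nonneg q.1, abs_nonneg q.2, mul_nonneg (abs_nonneg q.1) (abs_nonneg q.2)]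

theorem abs_fst_le_growthWeight (q : ℝ × ℝ) : |q.1| ≤ growthWeight q := by
  unfold growthWeight
  nlinarith [abs_nonneg q.1, abs_nonneg q.2, mul_nonneg (abs_nonneg q.1) (abs_nonneg q.2)]

theorem abs_snd_le_growthWeight (q : ℝ × ℝ) : |q.2| ≤ growthWeight q := by
  unfold growthWeight
  nlinarith [abs_nonneg q.1, abs_nonneg q.2, mul_nonneg (abs_nonneg q.1) (abs_nonneg q.2)]

theorem polyDom_fst : PolyDom growthWeight (fun q => q.1) :=
  ⟨1, 1, zero_le_one, fun q => by simpa using abs_fst_le_growthWeight q⟩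

theorem polyDom_snd : PolyDom growthWeight (fun q => q.2) :=
  ⟨1, 1, zero_le_one, fun q => by simpa using abs_snd_le_growthWeight q⟩

/-- A polynomial bound on the derivatives of `g` in a neighbourhood of each point. -/
theorem Regular.exists_bound_near {g : ℝ → ℝ} (hg : Regular g) (k : ℕ) {E : ℝ × ℝ → ℝ}
    (hE : PolyDom growthWeight E) :
    ∃ A : ℝ × ℝ → ℝ, PolyDom growthWeight A ∧ (∀ q, 0 ≤ A q) ∧
      ∀ q u, |u| ≤ |E q| → |iteratedDeriv k g (q.1 + u)| ≤ A q := by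
  obtain ⟨C, m, hC, hb⟩ := hg.exists_abs_iteratedDeriv_le k
  refine ⟨fun q => C * (1 + (|q.1| + |E q|)) ^ m, ?_, fun q => by positivity, fun q u hu => ?_⟩
  · have hB := one_le_growthWeight
    exact (PolyDom.const C).mul hB
      (((PolyDom.const 1).add hB (polyDom_fst.abs.add hB hE.abs)).pow hB m)
  · refine (hb _).trans ?_
    have h1 : |q.1 + u| ≤ |q.1| + |E q| := (abs_add_le q.1 u).trans (by linarith)
    exact mul_le_mul_of_nonneg_left (by gcongr) hC

/-- The log acceptance ratio of one coordinate is of the order `h ^ m`, up to factors of polynomial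
growth. -/
theorem Regular.exists_abs_logRatio_le {g : ℝ → ℝ} (hg : Regular g) (alg : Algorithm) :
    ∃ A : ℝ × ℝ → ℝ, PolyDom growthWeight A ∧ (∀ q, 0 ≤ A q) ∧
      ∀ h q, 0 ≤ h → h ≤ 1 → |alg.logRatio g h q.1 q.2| ≤ h ^ alg.order * A q := by
  have hB := one_le_growthWeight
  cases alg with
  | rwm =>
    obtain ⟨A, hA, hA0, hb⟩ := hg.exists_bound_near 1 polyDom_snd
    refine ⟨fun q => A q * |q.2|, hA.mul hB polyDom_snd.abs,
      fun q => mul_nonneg (hA0 q) (abs_nonneg _), fun h q h0 h1 => ?_⟩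
    have hd : |h * q.2| ≤ |q.2| := by
      rw [abs_mul, abs_of_nonneg h0]
      exact mul_le_of_le_one_left (abs_nonneg _) h1
    have := abs_le_pow_succ_of_hasDerivAt (k := 0) (B := A q) (d := |q.2|) (u := h * q.2)
      (F := fun u => g (q.1 + u) - g q.1)
      (fun w => ((hg.hasDerivAt (q.1 + w)).comp_const_add q.1 w).sub_const _) (by simp)
      (fun w hw => by simpa [iteratedDeriv_one] using hb q w hw) hd
    simp only [Algorithm.logRatio, Algorithm.step, Algorithm.order]
    rw [abs_sub_comm]
    refine this.trans (le_of_eq ?_)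
    simp [abs_mul, abs_of_nonneg h0]
    ring
  | sla =>
    -- A neighbourhood of radius 0: `A1` bounds |g'| at the point itself, and then |z| + `A1` bounds
    -- the rescaled displacement e for all h ≤ 1.
    obtain ⟨A1, hA1, hA10, hb1⟩ := hg.exists_bound_near 1 (PolyDom.const 0)
    have hE : PolyDom growthWeight (fun q => |q.2| + A1 q) := polyDom_snd.abs.add hB hA1
    have hE0 : ∀ q : ℝ × ℝ, 0 ≤ |q.2| + A1 q := fun q => add_nonneg (abs_nonneg _) (hA10 q)
    obtain ⟨A2, hA2, hA20, hb2⟩ := hg.exists_bound_near 1 hE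
    obtain ⟨A3, hA3, hA30, hb3⟩ := hg.exists_bound_near 2 hE
    obtain ⟨A4, hA4, hA40, hb4⟩ := hg.exists_bound_near 3 hE
    refine ⟨fun q => (|q.2| + A1 q) ^ 3 * A4 q + A2 q * (A3 q * (|q.2| + A1 q)),
      ((hE.pow hB 3).mul hB hA4).add hB (hA2.mul hB (hA3.mul hB hE)),
      fun q => add_nonneg (mul_nonneg (pow_nonneg (hE0 q) _) (hA40 q))
        (mul_nonneg (hA20 q) (mul_nonneg (hA30 q) (hE0 q))), fun h q h0 h1 => ?_⟩
    set e := q.2 - h / 2 * deriv g q.1 with he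
    have hg1 : |deriv g q.1| ≤ A1 q := by simpa [iteratedDeriv_one] using hb1 q 0 (by simp)
    have hee : |e| ≤ |q.2| + A1 q := by
      refine (abs_sub _ _).trans ?_
      rw [abs_mul, abs_of_nonneg (by positivity : 0 ≤ h / 2)]
      nlinarith [abs_nonneg (deriv g q.1)]
    have hd : |h * e| ≤ abs (|q.2| + A1 q) := by
      rw [abs_mul, abs_of_nonneg h0, abs_of_nonneg (hE0 q)]
      exact (mul_le_of_le_one_left (abs_nonneg _) h1).trans hee
    have hT := hg.abs_trapezoidError_le (x := q.1) (fun u hu => hb4 q u hu) hd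
    have hD := abs_le_pow_succ_of_hasDerivAt (k := 0) (B := A3 q) (u := h * e)
      (F := fun u => deriv g (q.1 + u) - deriv g q.1)
      (fun w => ((hg.hasDerivAt_deriv (q.1 + w)).comp_const_add q.1 w).sub_const _) (by simp)
      (fun w hw => by simpa using hb3 q w hw) hd
    have hy : |deriv g (q.1 + h * e)| ≤ A2 q := by simpa [iteratedDeriv_one] using hb2 q _ hd
    have hx : |deriv g q.1| ≤ A2 q := by
      simpa [iteratedDeriv_one] using hb2 q 0 (by simp)
    -- The difference of squares carries an explicit h² and factors through g'(y) - g'(x), which is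
    -- O(h). So both terms are of third order.
    have key : Algorithm.sla.logRatio g h q.1 q.2 = trapezoidError g q.1 (h * e) -
        h ^ 2 / 8 * ((deriv g q.1 + deriv g (q.1 + h * e)) *
          (deriv g (q.1 + h * e) - deriv g q.1)) := by
      simp only [Algorithm.logRatio, Algorithm.step, trapezoidError, ← he]
      ring
    have hs : |deriv g q.1 + deriv g (q.1 + h * e)| ≤ 2 * A2 q :=
      (abs_add_le _ _).trans (by linarith)
    have habs : |h * e| ≤ h * (|q.2| + A1 q) := by
      rw [abs_mul, abs_of_nonneg h0]; gcongr
    have hT' : |trapezoidError g q.1 (h * e)| ≤ h ^ 3 * ((|q.2| + A1 q) ^ 3 * A4 q) := by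
      refine hT.trans ?_
      have : |h * e| ^ 3 ≤ (h * (|q.2| + A1 q)) ^ 3 := by gcongr
      have h4 := hA40 q
      have h5 : 0 ≤ A4 q * (h * (|q.2| + A1 q)) ^ 3 :=
        mul_nonneg h4 (pow_nonneg (mul_nonneg h0 (hE0 q)) _)
      have := mul_le_mul_of_nonneg_left this (half_pos (zero_lt_one)).le (a := (1 / 2 : ℝ))
      calc A4 q / 2 * |h * e| ^ 3 ≤ A4 q / 2 * (h * (|q.2| + A1 q)) ^ 3 := by gcongr
        _ ≤ A4 q * (h * (|q.2| + A1 q)) ^ 3 := by linarith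
        _ = _ := by ring
    have hD' : |deriv g (q.1 + h * e) - deriv g q.1| ≤ h * (A3 q * (|q.2| + A1 q)) := by
      refine hD.trans ?_
      rw [zero_add, pow_one]
      calc A3 q * |h * e| ≤ A3 q * (h * (|q.2| + A1 q)) :=
            mul_le_mul_of_nonneg_left habs (hA30 q)
        _ = _ := by ring
    rw [key]
    refine (abs_sub _ _).trans ?_
    rw [abs_mul, abs_mul, abs_of_nonneg (by positivity : 0 ≤ h ^ 2 / 8)]
    have hm := mul_le_mul hs hD' (abs_nonneg _) (mul_nonneg zero_le_two (hA20 q))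
    have hm' := mul_le_mul_of_nonneg_left hm (by positivity : 0 ≤ h ^ 2 / 8)
    have hpos : 0 ≤ h ^ 3 * (A2 q * (A3 q * (|q.2| + A1 q))) :=
      mul_nonneg (by positivity) (mul_nonneg (hA20 q) (mul_nonneg (hA30 q) (hE0 q)))
    simp only [Algorithm.order]
    nlinarith

/-- For RWM this is the derivative of g along z. For SLA the trapezoidal error contributes g'''
z³/12, and the difference of squares contributes -(2g')(g'' z)/8. -/
theorem Regular.tendsto_logRatio_div {g : ℝ → ℝ} (hg : Regular g) (alg : Algorithm) (x z : ℝ) :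
    Tendsto (fun h => alg.logRatio g h x z / h ^ alg.order) (𝓝[>] 0) (𝓝 (alg.leading g x z)) := by
  have hmono : 𝓝[>] (0 : ℝ) ≤ 𝓝[≠] 0 := nhdsGT_le_nhdsNE 0
  cases alg with
  | rwm =>
    have h1 : HasDerivAt (fun h => g (x + h * z)) (deriv g x * z) 0 := by
      have h2 : HasDerivAt (fun h : ℝ => x + h * z) z 0 := by
        simpa using ((hasDerivAt_id (0 : ℝ)).mul_const z).const_add x
      have h3 := hg.hasDerivAt x
      exact HasDerivAt.comp (h₂ := g) (0 : ℝ) (by simpa using h3) h2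
    have h4 := (h1.tendsto_slope_zero.mono_left hmono).neg
    refine h4.congr fun h => ?_
    simp [Algorithm.logRatio, Algorithm.step, Algorithm.order]
    ring
  | sla =>
    have he : Tendsto (fun h : ℝ => z - h / 2 * deriv g x) (𝓝[>] 0) (𝓝 z) := by
      have : Continuous fun h : ℝ => z - h / 2 * deriv g x := by fun_prop
      simpa using this.continuousWithinAt (s := Set.Ioi 0) (x := 0) |>.tendsto
    have hid : Tendsto (fun h : ℝ => h) (𝓝[>] 0) (𝓝 0) := tendsto_id.mono_left nhdsWithin_le_nhds
    have hd : HasDerivAt (fun h : ℝ => x + h * (z - h / 2 * deriv g x)) z 0 := by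
      have := ((hasDerivAt_id (0 : ℝ)).mul
        ((((hasDerivAt_id (0 : ℝ)).div_const 2).mul_const (deriv g x)).const_sub z)).const_add x
      simpa using this
    have hD : Tendsto (fun h : ℝ =>
        (deriv g (x + h * (z - h / 2 * deriv g x)) - deriv g x) / h) (𝓝[>] 0)
        (𝓝 (iteratedDeriv 2 g x * z)) := by
      have h3 := hg.hasDerivAt_deriv x
      have h1 := HasDerivAt.comp (h₂ := deriv g) (0 : ℝ) (by simpa using h3) hd
      refine (h1.tendsto_slope_zero.mono_left hmono).congr fun h => ?_
      simp [Function.comp]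
      ring
    have hS : Tendsto (fun h : ℝ => deriv g (x + h * (z - h / 2 * deriv g x))) (𝓝[>] 0)
        (𝓝 (deriv g x)) := by
      have : Continuous fun h : ℝ => deriv g (x + h * (z - h / 2 * deriv g x)) :=
        hg.continuous_deriv.comp (by fun_prop)
      simpa using this.continuousWithinAt (s := Set.Ioi 0) (x := 0) |>.tendsto
    obtain ⟨A, hA⟩ : ∃ A, ∀ u, |u| ≤ 1 → |iteratedDeriv 4 g (x + u)| ≤ A := by
      obtain ⟨A, hA⟩ := (isCompact_Icc (a := (-1 : ℝ)) (b := 1)).exists_bound_of_continuousOn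
        ((hg.continuous_iteratedDeriv 4).comp (continuous_const.add continuous_id
          : Continuous fun u : ℝ => x + u)).continuousOn
      exact ⟨A, fun u hu => by simpa using hA u (abs_le.1 hu)⟩
    have hT : Tendsto (fun h : ℝ => trapezoidError g x (h * (z - h / 2 * deriv g x)) / h ^ 3)
        (𝓝[>] 0) (𝓝 (iteratedDeriv 3 g x * z ^ 3 / 12)) := by
      have hlim : Tendsto (fun h : ℝ => iteratedDeriv 3 g x * (z - h / 2 * deriv g x) ^ 3 / 12)
          (𝓝[>] 0) (𝓝 (iteratedDeriv 3 g x * z ^ 3 / 12)) :=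
        ((he.pow 3).const_mul _).div_const 12
      have hz : Tendsto (fun h : ℝ => A / 2 * (h * (z - h / 2 * deriv g x) ^ 4)) (𝓝[>] 0)
          (𝓝 0) := by
        simpa using (hid.mul (he.pow 4)).const_mul (A / 2)
      have hsm : ∀ᶠ h in 𝓝[>] (0 : ℝ), |h * (z - h / 2 * deriv g x)| ≤ 1 := by
        have : Tendsto (fun h : ℝ => |h * (z - h / 2 * deriv g x)|) (𝓝[>] 0) (𝓝 0) := by
          simpa using (hid.mul he).abs
        exact (this.eventually (gt_mem_nhds zero_lt_one)).mono fun _ h => le_of_lt h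
      have hdiff := squeeze_zero_norm' (f := fun h : ℝ =>
        trapezoidError g x (h * (z - h / 2 * deriv g x)) / h ^ 3 -
          iteratedDeriv 3 g x * (z - h / 2 * deriv g x) ^ 3 / 12) (t₀ := 𝓝[>] 0) ?_ hz
      · simpa using hdiff.add hlim
      filter_upwards [hsm, self_mem_nhdsWithin] with h hh hpos
      have hpos : 0 < h := hpos
      have := hg.abs_trapezoidError_sub_le hA hh
      rw [Real.norm_eq_abs]
      have e1 : trapezoidError g x (h * (z - h / 2 * deriv g x)) / h ^ 3 -
          iteratedDeriv 3 g x * (z - h / 2 * deriv g x) ^ 3 / 12 =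
          (trapezoidError g x (h * (z - h / 2 * deriv g x)) -
            iteratedDeriv 3 g x * (h * (z - h / 2 * deriv g x)) ^ 3 / 12) / h ^ 3 := by
        field_simp
      rw [e1, abs_div, abs_of_pos (pow_pos hpos 3), div_le_iff₀ (pow_pos hpos 3)]
      refine this.trans (le_of_eq ?_)
      rw [Even.pow_abs (by decide)]
      ring
    have := hT.sub (((hS.const_add (deriv g x)).mul hD).div_const 8)
    refine (this.congr' ?_).trans (le_of_eq ?_)
    · filter_upwards [self_mem_nhdsWithin] with h hpos
      have hpos : 0 < h := hpos
      simp only [Algorithm.logRatio, Algorithm.step, trapezoidError, Algorithm.order]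
      field_simp
      ring
    · simp only [Algorithm.leading]
      congr 1
      ring

/-! ### The law of one coordinate of the state and the noise -/

/-- The law with density `exp (-g)`. -/
def baseMeasure (g : ℝ → ℝ) : Measure ℝ :=
  volume.withDensity fun x => ENNReal.ofReal (Real.exp (-g x))

/-- The joint law of one rescaled coordinate of the state and of the noise. -/
def pairMeasure (g : ℝ → ℝ) : Measure (ℝ × ℝ) := (baseMeasure g).prod (gaussianReal 0 1)

theorem Regular.integrable_exp_neg {g : ℝ → ℝ} (hg : Regular g) :
    Integrable fun x => Real.exp (-g x) := by simpa using hg.moments 0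

theorem Regular.isProbabilityMeasure_baseMeasure {g : ℝ → ℝ} (hg : Regular g) :
    IsProbabilityMeasure (baseMeasure g) := by
  constructor
  rw [baseMeasure, withDensity_apply _ MeasurableSet.univ, setLIntegral_univ,
    ← ofReal_integral_eq_lintegral_ofReal hg.integrable_exp_neg
      (ae_of_all _ fun x => (Real.exp_pos _).le), hg.density, ENNReal.ofReal_one]

theorem Regular.isProbabilityMeasure_pairMeasure {g : ℝ → ℝ} (hg : Regular g) :
    IsProbabilityMeasure (pairMeasure g) := by
  have := hg.isProbabilityMeasure_baseMeasure
  unfold pairMeasure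
  infer_instance

theorem integrable_baseMeasure_iff {g : ℝ → ℝ} (hg : Regular g) {F : ℝ → ℝ} :
    Integrable F (baseMeasure g) ↔ Integrable fun x => F x * Real.exp (-g x) := by
  have hm : Measurable fun x => Real.exp (-g x) := hg.continuous.measurable.neg.exp
  rw [baseMeasure, integrable_withDensity_iff hm.ennreal_ofReal (by simp)]
  simp [ENNReal.toReal_ofReal (Real.exp_pos _).le]

theorem integral_baseMeasure {g : ℝ → ℝ} (hg : Regular g) (F : ℝ → ℝ) :
    ∫ x, F x ∂(baseMeasure g) = ∫ x, F x * Real.exp (-g x) := by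
  have hm : Measurable fun x => Real.exp (-g x) := hg.continuous.measurable.neg.exp
  rw [baseMeasure, integral_withDensity_eq_integral_toReal_smul hm.ennreal_ofReal (by simp)]
  simp [ENNReal.toReal_ofReal (Real.exp_pos _).le, mul_comm]

theorem integrable_one_add_abs_pow {μ : Measure ℝ} [IsFiniteMeasure μ]
    (h : ∀ k : ℕ, Integrable (fun x : ℝ => |x| ^ k) μ) (k : ℕ) :
    Integrable (fun x : ℝ => (1 + |x|) ^ k) μ := by
  have : (fun x : ℝ => (1 + |x|) ^ k) =
      fun x => ∑ m ∈ Finset.range (k + 1), |x| ^ (k - m) * (k.choose m : ℝ) := by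
    ext x
    rw [add_pow]
    simp
  rw [this]
  exact integrable_finsetSum _ fun m _ => (h _).mul_const _

theorem integrable_abs_pow_gaussianReal (k : ℕ) :
    Integrable (fun x : ℝ => |x| ^ k) (gaussianReal 0 1) := by
  have := (memLp_id_gaussianReal (μ := 0) (v := 1) (k : NNReal)).integrable_norm_pow'
  simpa using this

theorem Regular.integrable_growthWeight_pow {g : ℝ → ℝ} (hg : Regular g) (k : ℕ) :
    Integrable (fun q => growthWeight q ^ k) (pairMeasure g) := by
  have := hg.isProbabilityMeasure_baseMeasure
  simp only [growthWeight, mul_pow]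
  exact (integrable_one_add_abs_pow (fun k => (integrable_baseMeasure_iff hg).2 (hg.moments k))
    k).mul_prod (integrable_one_add_abs_pow integrable_abs_pow_gaussianReal k)

theorem Regular.integrable_of_polyDom {g : ℝ → ℝ} (hg : Regular g) {F : ℝ × ℝ → ℝ}
    (hF : PolyDom growthWeight F) (hm : Measurable F) : Integrable F (pairMeasure g) := by
  obtain ⟨C, k, hC, hb⟩ := hF
  exact ((hg.integrable_growthWeight_pow k).const_mul C).mono' hm.aestronglyMeasurable
    (ae_of_all _ hb)

theorem Regular.measurable_step {g : ℝ → ℝ} (hg : Regular g) (alg : Algorithm) (h : ℝ) :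
    Measurable fun q : ℝ × ℝ => alg.step g h q.1 q.2 := by
  have := hg.continuous_deriv
  cases alg <;> simp only [Algorithm.step] <;> fun_prop

theorem Regular.measurable_logRatio {g : ℝ → ℝ} (hg : Regular g) (alg : Algorithm) (h : ℝ) :
    Measurable fun q : ℝ × ℝ => alg.logRatio g h q.1 q.2 := by
  have := hg.continuous_deriv
  have := hg.continuous
  cases alg <;> simp only [Algorithm.logRatio, Algorithm.step] <;> fun_prop

/-! ### Reversibility -/

/-- The log acceptance ratio of one coordinate as a function of the state and the proposal. -/
def Algorithm.pairRatio (alg : Algorithm) (g : ℝ → ℝ) (h x y : ℝ) : ℝ :=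
  match alg with
  | .rwm => g x - g y
  | .sla => g x - g y + (y - x) * (deriv g x + deriv g y) / 2 +
      h ^ 2 / 8 * (deriv g x ^ 2 - deriv g y ^ 2)

theorem Algorithm.logRatio_eq_pairRatio (alg : Algorithm) (g : ℝ → ℝ) (h x z : ℝ) :
    alg.logRatio g h x z = alg.pairRatio g h x (alg.step g h x z) := by
  cases alg <;> rfl

theorem Algorithm.pairRatio_swap (alg : Algorithm) (g : ℝ → ℝ) (h x y : ℝ) :
    alg.pairRatio g h y x = -alg.pairRatio g h x y := by
  cases alg <;> simp only [pairRatio] <;> ring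

theorem Algorithm.step_eq (alg : Algorithm) (g : ℝ → ℝ) (h x z : ℝ) :
    alg.step g h x z = alg.step g h x 0 + h * z := by
  cases alg <;> simp only [step] <;> ring

/-- The joint density of a coordinate of the state and of the proposal. -/
def Algorithm.pairDensity (alg : Algorithm) (g : ℝ → ℝ) (h x y : ℝ) : ℝ :=
  Real.exp (-g x) * gaussianPDFReal (alg.step g h x 0) (NNReal.mk (h ^ 2) (sq_nonneg h)) y

theorem gaussianPDFReal_sq (m h y : ℝ) : gaussianPDFReal m (NNReal.mk (h ^ 2) (sq_nonneg h)) y =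
    (√(2 * Real.pi * h ^ 2))⁻¹ * Real.exp (-(y - m) ^ 2 / (2 * h ^ 2)) := rfl

/-- Detailed balance in one coordinate. Both proposals have variance h², so their normalizing
constants cancel. For SLA the difference of the two Gaussian exponents is exactly the trapezoidal
term (y-x)(g'(x)+g'(y))/2 plus h²(g'(x)²-g'(y)²)/8. -/
theorem Algorithm.pairDensity_mul_exp (alg : Algorithm) (g : ℝ → ℝ) {h : ℝ} (hh : h ≠ 0)
    (x y : ℝ) :
    alg.pairDensity g h x y * Real.exp (alg.pairRatio g h x y) = alg.pairDensity g h y x := by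
  simp only [pairDensity, gaussianPDFReal_sq]
  have key : -g x + -(y - alg.step g h x 0) ^ 2 / (2 * h ^ 2) + alg.pairRatio g h x y =
      -g y + -(x - alg.step g h y 0) ^ 2 / (2 * h ^ 2) := by
    cases alg <;> simp only [step, pairRatio] <;> field_simp <;> ring
  calc _ = (√(2 * Real.pi * h ^ 2))⁻¹ * Real.exp (-g x +
        -(y - alg.step g h x 0) ^ 2 / (2 * h ^ 2) + alg.pairRatio g h x y) := by
        rw [Real.exp_add, Real.exp_add]; ring
    _ = _ := by rw [key, Real.exp_add]; ring

theorem Algorithm.pairDensity_nonneg (alg : Algorithm) (g : ℝ → ℝ) (h x y : ℝ) :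
    0 ≤ alg.pairDensity g h x y :=
  mul_nonneg (Real.exp_pos _).le (gaussianPDFReal_nonneg _ _ _)

theorem Regular.lintegral_step {g : ℝ → ℝ} (hg : Regular g) (alg : Algorithm) {h : ℝ}
    (hh : h ≠ 0) {H : ℝ × ℝ → ENNReal} (hH : Measurable H) :
    ∫⁻ q, H (q.1, alg.step g h q.1 q.2) ∂(pairMeasure g) =
      ∫⁻ x, ∫⁻ y, ENNReal.ofReal (alg.pairDensity g h x y) * H (x, y) := by
  have hm : Measurable fun x => Real.exp (-g x) := hg.continuous.measurable.neg.exp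
  have hst := hg.measurable_step alg h
  have hHs : Measurable fun q : ℝ × ℝ => H (q.1, alg.step g h q.1 q.2) :=
    hH.comp (measurable_fst.prodMk hst)
  rw [pairMeasure, lintegral_prod _ hHs.aemeasurable,
    baseMeasure, lintegral_withDensity_eq_lintegral_mul _ hm.ennreal_ofReal
    (Measurable.lintegral_prod_right' hHs)]
  refine lintegral_congr fun x => ?_
  have hmap : (gaussianReal 0 1).map (fun z => alg.step g h x z) =
      gaussianReal (alg.step g h x 0) (NNReal.mk (h ^ 2) (sq_nonneg h)) := by
    have e : (fun z => alg.step g h x z) = (fun z => alg.step g h x 0 + z) ∘ (fun z => h * z) := by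
      ext z; exact alg.step_eq g h x z
    rw [e, ← Measure.map_map (by fun_prop) (by fun_prop), gaussianReal_map_const_mul,
      gaussianReal_map_const_add]
    simp
  have hv : (NNReal.mk (h ^ 2) (sq_nonneg h)) ≠ 0 := by
    intro h0
    exact hh (by simpa using congrArg NNReal.toReal h0)
  have hHx : Measurable fun y => H (x, y) := hH.comp measurable_prodMk_left
  have : ∫⁻ z, H (x, alg.step g h x z) ∂(gaussianReal 0 1) =
      ∫⁻ y, H (x, y) ∂(gaussianReal (alg.step g h x 0) (NNReal.mk (h ^ 2) (sq_nonneg h))) := by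
    have hx : Measurable fun z => alg.step g h x z := hst.comp measurable_prodMk_left
    rw [← hmap, lintegral_map hHx hx]
  simp only [Pi.mul_apply, this]
  rw [gaussianReal_of_var_ne_zero _ hv, lintegral_withDensity_eq_lintegral_mul _
    (measurable_gaussianPDF _ _) hHx, ← lintegral_const_mul _
    ((measurable_gaussianPDF _ _).mul hHx)]
  refine lintegral_congr fun y => ?_
  simp only [Pi.mul_apply, Algorithm.pairDensity, gaussianPDF]
  rw [ENNReal.ofReal_mul (Real.exp_pos _).le, mul_assoc]

/-- Written over (x, y) with the joint density, the weight e^r turns the density at (x, y) into the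
density at (y, x). Exchanging the names of x and y then changes the sign of the ratio. -/
theorem Regular.lintegral_logRatio_flip {g : ℝ → ℝ} (hg : Regular g) (alg : Algorithm) {h : ℝ}
    (hh : h ≠ 0) {G : ℝ → ENNReal} (hG : Measurable G) :
    ∫⁻ q, ENNReal.ofReal (Real.exp (alg.logRatio g h q.1 q.2)) * G (alg.logRatio g h q.1 q.2)
        ∂(pairMeasure g) =
      ∫⁻ q, G (-alg.logRatio g h q.1 q.2) ∂(pairMeasure g) := by
  have hpm : Measurable fun p : ℝ × ℝ => alg.pairRatio g h p.1 p.2 := by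
    have := hg.continuous_deriv
    have := hg.continuous
    cases alg <;> simp only [Algorithm.pairRatio] <;> fun_prop
  have hdm : Measurable fun p : ℝ × ℝ => alg.pairDensity g h p.1 p.2 := by
    have := hg.continuous_deriv
    have := hg.continuous
    cases alg <;> simp only [Algorithm.pairDensity, Algorithm.step, gaussianPDFReal] <;> fun_prop
  simp only [alg.logRatio_eq_pairRatio]
  rw [hg.lintegral_step alg hh (H := fun p => ENNReal.ofReal (Real.exp (alg.pairRatio g h p.1 p.2))
      * G (alg.pairRatio g h p.1 p.2)) (hpm.exp.ennreal_ofReal.mul (hG.comp hpm)),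
    hg.lintegral_step alg hh (H := fun p => G (-alg.pairRatio g h p.1 p.2)) (hG.comp hpm.neg),
    lintegral_lintegral_swap]
  · refine lintegral_congr fun y => lintegral_congr fun x => ?_
    simp only
    rw [← mul_assoc, ← ENNReal.ofReal_mul (alg.pairDensity_nonneg g h x y), alg.pairDensity_mul_exp g hh, ← alg.pairRatio_swap]
  · exact (hdm.ennreal_ofReal.mul
      (hpm.exp.ennreal_ofReal.mul (hG.comp hpm))).aemeasurable

theorem Regular.map_logRatio_neg {g : ℝ → ℝ} (hg : Regular g) (alg : Algorithm) {h : ℝ}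
    (hh : h ≠ 0) :
    (pairMeasure g).map (fun q => -alg.logRatio g h q.1 q.2) =
      ((pairMeasure g).map fun q => alg.logRatio g h q.1 q.2).withDensity
        fun r => ENNReal.ofReal (Real.exp r) := by
  have hm := hg.measurable_logRatio alg h
  have hn : Measurable fun q : ℝ × ℝ => -alg.logRatio g h q.1 q.2 := hm.neg
  have he : Measurable fun r : ℝ => ENNReal.ofReal (Real.exp r) := by fun_prop
  refine Measure.ext_of_lintegral _ fun G hG => ?_
  rw [lintegral_map hG hn, lintegral_withDensity_eq_lintegral_mul _ he hG,
    lintegral_map (he.mul hG) hm]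
  exact (hg.lintegral_logRatio_flip alg hh hG).symm

/-- The reversibility of the algorithm under the product law, in terms of the law of the log
acceptance ratio. -/
theorem Regular.integral_exp_mul_logRatio {g : ℝ → ℝ} (hg : Regular g) (alg : Algorithm) {h : ℝ}
    (hh : h ≠ 0) {G : ℝ → ℝ} (hG : Measurable G) :
    ∫ q, Real.exp (alg.logRatio g h q.1 q.2) * G (alg.logRatio g h q.1 q.2) ∂(pairMeasure g) =
      ∫ q, G (-alg.logRatio g h q.1 q.2) ∂(pairMeasure g) := by
  have hm := hg.measurable_logRatio alg h
  have hn : Measurable fun q : ℝ × ℝ => -alg.logRatio g h q.1 q.2 := hm.neg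
  have he : Measurable fun r : ℝ => ENNReal.ofReal (Real.exp r) := by fun_prop
  rw [← integral_map (f := G) hn.aemeasurable hG.aestronglyMeasurable,
    hg.map_logRatio_neg alg hh, integral_withDensity_eq_integral_toReal_smul he (by simp),
    integral_map (f := fun r => (ENNReal.ofReal (Real.exp r)).toReal • G r) hm.aemeasurable
      (he.ennreal_toReal.smul hG).aestronglyMeasurable]
  simp [ENNReal.toReal_ofReal (Real.exp_pos _).le]

theorem Regular.integrable_exp_mul_logRatio {g : ℝ → ℝ} (hg : Regular g) (alg : Algorithm) {h : ℝ}
    (hh : h ≠ 0) {G : ℝ → ℝ} (hG : Measurable G) :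
    Integrable (fun q => Real.exp (alg.logRatio g h q.1 q.2) * G (alg.logRatio g h q.1 q.2))
        (pairMeasure g) ↔
      Integrable (fun q => G (-alg.logRatio g h q.1 q.2)) (pairMeasure g) := by
  have hm := hg.measurable_logRatio alg h
  have hn : Measurable fun q : ℝ × ℝ => -alg.logRatio g h q.1 q.2 := hm.neg
  have he : Measurable fun r : ℝ => ENNReal.ofReal (Real.exp r) := by fun_prop
  have h1 := integrable_map_measure (f := fun q : ℝ × ℝ => -alg.logRatio g h q.1 q.2)
    (μ := pairMeasure g) (g := G) hG.aestronglyMeasurable hn.aemeasurable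
  rw [hg.map_logRatio_neg alg hh, integrable_withDensity_iff he (by simp),
    integrable_map_measure (g := fun r => G r * (ENNReal.ofReal (Real.exp r)).toReal)
    (hG.mul he.ennreal_toReal).aestronglyMeasurable hm.aemeasurable] at h1
  refine Iff.trans ?_ h1
  simp [Function.comp_def, ENNReal.toReal_ofReal (Real.exp_pos _).le, mul_comm]

/-! ### Gaussian moments -/

theorem integrable_pow_gaussianReal (k : ℕ) :
    Integrable (fun x : ℝ => x ^ k) (gaussianReal 0 1) :=
  (integrable_abs_pow_gaussianReal k).mono' (by fun_prop) (ae_of_all _ fun x => by simp)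

theorem hasDerivAt_gaussianPDFReal (z : ℝ) :
    HasDerivAt (gaussianPDFReal 0 1) (-z * gaussianPDFReal 0 1 z) z := by
  have h : HasDerivAt (fun z : ℝ => -(z - 0) ^ 2 / (2 * ((1 : NNReal) : ℝ))) (-z) z := by
    convert! (((hasDerivAt_id z).sub_const 0).pow 2).neg.div_const (2 * ((1 : NNReal) : ℝ)) using 1
    simp
    ring
  have := (h.exp).const_mul (√(2 * Real.pi * ((1 : NNReal) : ℝ)))⁻¹
  rw [gaussianPDFReal_def]
  convert! this using 1
  ring

/-- Integration by parts: the derivative of z^(k+1) times the Gaussian density integrates to 0. -/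
theorem integral_pow_add_two_gaussianReal (k : ℕ) :
    ∫ z, z ^ (k + 2) ∂(gaussianReal 0 1) = (k + 1) * ∫ z, z ^ k ∂(gaussianReal 0 1) := by
  have hi (k : ℕ) : Integrable fun z : ℝ => z ^ k * gaussianPDFReal 0 1 z := by
    have := integrable_pow_gaussianReal k
    rw [gaussianReal_of_var_ne_zero _ one_ne_zero, integrable_withDensity_iff
      (measurable_gaussianPDF _ _) (ae_of_all _ fun _ => gaussianPDF_lt_top)] at this
    simpa only [toReal_gaussianPDF] using this
  have hint (k : ℕ) : ∫ z, z ^ k ∂(gaussianReal 0 1) = ∫ z : ℝ, z ^ k * gaussianPDFReal 0 1 z := by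
    rw [integral_gaussianReal_eq_integral_smul one_ne_zero]
    simp [mul_comm]
  have hd (z : ℝ) : HasDerivAt (fun z : ℝ => z ^ (k + 1) * gaussianPDFReal 0 1 z)
      (((k : ℝ) + 1) * (z ^ k * gaussianPDFReal 0 1 z) - z ^ (k + 2) * gaussianPDFReal 0 1 z) z := by
    convert! (hasDerivAt_pow (k + 1) z).mul (hasDerivAt_gaussianPDFReal z) using 1
    push_cast
    ring
  have := integral_eq_zero_of_hasDerivAt_of_integrable hd
    (((hi k).const_mul _).sub (hi (k + 2))) (hi (k + 1))
  rw [integral_sub ((hi k).const_mul _) (hi (k + 2)), integral_const_mul] at this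
  rw [hint, hint]
  linarith

theorem integral_sq_gaussianReal : ∫ z, z ^ 2 ∂(gaussianReal 0 1) = 1 := by
  simpa using integral_pow_add_two_gaussianReal 0

theorem integral_pow_four_gaussianReal : ∫ z, z ^ 4 ∂(gaussianReal 0 1) = 3 := by
  have := integral_pow_add_two_gaussianReal 2
  norm_num [integral_sq_gaussianReal] at this
  exact this

theorem integral_pow_six_gaussianReal : ∫ z, z ^ 6 ∂(gaussianReal 0 1) = 15 := by
  have := integral_pow_add_two_gaussianReal 4
  norm_num [integral_pow_four_gaussianReal] at this
  exact this

/-! ### The constant `K` -/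

theorem one_le_one_add_abs (x : ℝ) : 1 ≤ 1 + |x| := by linarith [abs_nonneg x]

theorem Regular.polyDom_iteratedDeriv {g : ℝ → ℝ} (hg : Regular g) (k : ℕ) :
    PolyDom (fun x => 1 + |x|) (iteratedDeriv k g) := by
  obtain ⟨C, m, hC, hb⟩ := hg.exists_abs_iteratedDeriv_le k
  exact ⟨C, m, hC, hb⟩

theorem Regular.polyDom_deriv {g : ℝ → ℝ} (hg : Regular g) :
    PolyDom (fun x => 1 + |x|) (deriv g) := by
  simpa [iteratedDeriv_one] using hg.polyDom_iteratedDeriv 1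

theorem Regular.integrable_mul_exp_neg {g : ℝ → ℝ} (hg : Regular g) {F : ℝ → ℝ}
    (hF : PolyDom (fun x => 1 + |x|) F) (hc : Continuous F) :
    Integrable fun x => F x * Real.exp (-g x) := by
  obtain ⟨C, k, hC, hb⟩ := hF
  rw [← integrable_baseMeasure_iff hg]
  have := hg.isProbabilityMeasure_baseMeasure
  exact ((integrable_one_add_abs_pow (fun k => (integrable_baseMeasure_iff hg).2 (hg.moments k))
    k).const_mul C).mono' hc.aestronglyMeasurable (ae_of_all _ hb)

/-- Integration by parts against `exp (-g)`. -/
theorem Regular.integral_deriv_mul {g : ℝ → ℝ} (hg : Regular g) {F F' : ℝ → ℝ}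
    (hF : ∀ x, HasDerivAt F (F' x) x) (hp : PolyDom (fun x => 1 + |x|) F)
    (hp' : PolyDom (fun x => 1 + |x|) F') (hc : Continuous F') :
    ∫ x, deriv g x * F x * Real.exp (-g x) = ∫ x, F' x * Real.exp (-g x) := by
  have hFc : Continuous F := continuous_iff_continuousAt.2 fun x => (hF x).continuousAt
  have h1 := hg.integrable_mul_exp_neg hp hFc
  have h2 := hg.integrable_mul_exp_neg hp' hc
  have h3 := hg.integrable_mul_exp_neg (F := fun x => deriv g x * F x)
    (hg.polyDom_deriv.mul one_le_one_add_abs hp) (hg.continuous_deriv.mul hFc)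
  have hd (x : ℝ) : HasDerivAt (fun x => F x * Real.exp (-g x))
      (F' x * Real.exp (-g x) - deriv g x * F x * Real.exp (-g x)) x := by
    convert! (hF x).mul (hg.hasDerivAt x).fun_neg.exp using 1
    ring
  have := integral_eq_zero_of_hasDerivAt_of_integrable hd (h2.sub h3) h1
  rw [integral_sub h2 h3] at this
  linarith

/-- Integrating g' · (g' g''²) by parts gives E[(g'g'')²] = E[g''³] + 2E[g'g''g''']. Eliminating the
cubic term leaves a quadratic form in g'g'' and g''', the shape in which the second moment of the
leading coefficient arises and in which positivity can be seen. -/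
theorem Regular.K_sla_eq {g : ℝ → ℝ} (hg : Regular g) :
    Algorithm.sla.K g = (∫ x, (deriv g x * iteratedDeriv 2 g x) ^ 2 * Real.exp (-g x)) / 16 -
      (∫ x, deriv g x * iteratedDeriv 2 g x * iteratedDeriv 3 g x * Real.exp (-g x)) / 8 +
      5 / 48 * ∫ x, iteratedDeriv 3 g x ^ 2 * Real.exp (-g x) := by
  have hB := one_le_one_add_abs
  have c1 := hg.continuous_deriv
  have c2 := hg.continuous_iteratedDeriv 2
  have c3 := hg.continuous_iteratedDeriv 3
  have p1 := hg.polyDom_deriv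
  have p2 := hg.polyDom_iteratedDeriv 2
  have p3 := hg.polyDom_iteratedDeriv 3
  have i1 := hg.integrable_mul_exp_neg (p3.pow hB 2) (c3.pow 2)
  have i2 := hg.integrable_mul_exp_neg ((p1.mul hB p2).mul hB p3) ((c1.mul c2).mul c3)
  have i3 := hg.integrable_mul_exp_neg ((p1.mul hB p2).pow hB 2) ((c1.mul c2).pow 2)
  have i4 := hg.integrable_mul_exp_neg (p2.pow hB 3) (c2.pow 3)
  have hparts := hg.integral_deriv_mul (F := fun x => deriv g x * iteratedDeriv 2 g x ^ 2)
    (F' := fun x => iteratedDeriv 2 g x ^ 3 +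
      2 * (deriv g x * iteratedDeriv 2 g x * iteratedDeriv 3 g x)) (fun x => by
      convert! (hg.hasDerivAt_deriv x).mul ((hg.hasDerivAt_iteratedDeriv 2 x).pow 2) using 1
      norm_num
      ring)
    (p1.mul hB (p2.pow hB 2)) ((p2.pow hB 3).add hB
      ((PolyDom.const 2).mul hB ((p1.mul hB p2).mul hB p3)))
    ((c2.pow 3).add (continuous_const.mul ((c1.mul c2).mul c3)))
  have hparts' : ∫ x, (deriv g x * iteratedDeriv 2 g x) ^ 2 * Real.exp (-g x) =
      ∫ x, iteratedDeriv 2 g x ^ 3 * Real.exp (-g x) +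
        2 * (deriv g x * iteratedDeriv 2 g x * iteratedDeriv 3 g x * Real.exp (-g x)) := by
    calc _ = ∫ x, deriv g x * (deriv g x * iteratedDeriv 2 g x ^ 2) * Real.exp (-g x) := by
          congr 1; ext x; ring
      _ = _ := hparts
      _ = _ := by congr 1; ext x; ring
  rw [integral_add i4 (i2.const_mul 2), integral_const_mul] at hparts'
  have eK : Algorithm.sla.K g = (3 * (∫ x, iteratedDeriv 2 g x ^ 3 * Real.exp (-g x)) +
      5 * ∫ x, iteratedDeriv 3 g x ^ 2 * Real.exp (-g x)) / 48 := by
    simp only [Algorithm.K]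
    rw [← integral_const_mul, ← integral_const_mul,
      ← integral_add (i4.const_mul 3) (i1.const_mul 5)]
    congr 2; ext x; ring
  rw [eK, hparts']
  ring

/-- Expanding the square and using the Gaussian moments 1, 3, 15 of orders 2, 4, 6: the coefficients
become 15/144 = 5/48, 3/24 = 1/8 and 1/16. -/
theorem Regular.integral_leading_sq {g : ℝ → ℝ} (hg : Regular g) (alg : Algorithm) :
    ∫ q, alg.leading g q.1 q.2 ^ 2 ∂(pairMeasure g) = alg.K g := by
  have := hg.isProbabilityMeasure_baseMeasure
  have hB := one_le_one_add_abs
  have c1 := hg.continuous_deriv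
  have c2 := hg.continuous_iteratedDeriv 2
  have c3 := hg.continuous_iteratedDeriv 3
  have p1 := hg.polyDom_deriv
  have p2 := hg.polyDom_iteratedDeriv 2
  have p3 := hg.polyDom_iteratedDeriv 3
  cases alg with
  | rwm =>
    have e : (fun q : ℝ × ℝ => Algorithm.rwm.leading g q.1 q.2 ^ 2) =
        fun q => deriv g q.1 ^ 2 * q.2 ^ 2 := by
      ext q; simp only [Algorithm.leading]; ring
    rw [e, pairMeasure, integral_prod_mul (fun x => deriv g x ^ 2) (fun z => z ^ 2),
      integral_sq_gaussianReal, integral_baseMeasure hg, mul_one]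
    rfl
  | sla =>
    have e : (fun q : ℝ × ℝ => Algorithm.sla.leading g q.1 q.2 ^ 2) = fun q =>
        iteratedDeriv 3 g q.1 ^ 2 * (q.2 ^ 6 / 144) -
          (deriv g q.1 * iteratedDeriv 2 g q.1 * iteratedDeriv 3 g q.1) * (q.2 ^ 4 / 24) +
          (deriv g q.1 * iteratedDeriv 2 g q.1) ^ 2 * (q.2 ^ 2 / 16) := by
      ext q; simp only [Algorithm.leading]; ring
    have i1 := hg.integrable_mul_exp_neg (p3.pow hB 2) (c3.pow 2)
    have i2 := hg.integrable_mul_exp_neg ((p1.mul hB p2).mul hB p3) ((c1.mul c2).mul c3)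
    have i3 := hg.integrable_mul_exp_neg ((p1.mul hB p2).pow hB 2) ((c1.mul c2).pow 2)
    have q (k : ℕ) (c : ℝ) := (integrable_pow_gaussianReal k).div_const c
    have j1 := ((integrable_baseMeasure_iff hg).2 i1).mul_prod (q 6 144)
    have j2 := ((integrable_baseMeasure_iff hg).2 i2).mul_prod (q 4 24)
    have j3 := ((integrable_baseMeasure_iff hg).2 i3).mul_prod (q 2 16)
    rw [e, pairMeasure, integral_add ?_ j3, integral_sub j1 j2,
      integral_prod_mul (fun x => iteratedDeriv 3 g x ^ 2) (fun z => z ^ 6 / 144),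
      integral_prod_mul (fun x => deriv g x * iteratedDeriv 2 g x * iteratedDeriv 3 g x)
        (fun z => z ^ 4 / 24),
      integral_prod_mul (fun x => (deriv g x * iteratedDeriv 2 g x) ^ 2) (fun z => z ^ 2 / 16),
      integral_div, integral_div, integral_div, integral_sq_gaussianReal,
      integral_pow_four_gaussianReal, integral_pow_six_gaussianReal,
      integral_baseMeasure hg, integral_baseMeasure hg, integral_baseMeasure hg, hg.K_sla_eq]
    · ring
    · exact j1.sub j2

theorem Regular.eq_zero_of_integral_eq_zero {g : ℝ → ℝ} (hg : Regular g) {F : ℝ → ℝ}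
    (hc : Continuous F) (hn : ∀ x, 0 ≤ F x) (hi : Integrable fun x => F x * Real.exp (-g x))
    (h0 : ∫ x, F x * Real.exp (-g x) = 0) (x : ℝ) : F x = 0 := by
  have hae := (integral_eq_zero_iff_of_nonneg
    (fun x => mul_nonneg (hn x) (Real.exp_pos _).le) hi).1 h0
  have hcont : Continuous fun x => F x * Real.exp (-g x) :=
    hc.mul (Real.continuous_exp.comp hg.continuous.neg)
  have hz := (hcont.ae_eq_iff_eq volume (continuous_const (y := (0 : ℝ)))).1 hae
  have h1 : F x * Real.exp (-g x) = 0 := congrFun hz x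
  exact (mul_eq_zero.1 h1).resolve_right (Real.exp_pos _).ne'

theorem Regular.K_rwm_pos {g : ℝ → ℝ} (hg : Regular g) : 0 < Algorithm.rwm.K g := by
  have i1 := hg.integrable_mul_exp_neg (hg.polyDom_deriv.pow one_le_one_add_abs 2)
    (hg.continuous_deriv.pow 2)
  have hn : ∀ x, 0 ≤ deriv g x ^ 2 := fun x => sq_nonneg _
  refine lt_of_le_of_ne (integral_nonneg fun x => mul_nonneg (hn x) (Real.exp_pos _).le)
    fun h0 => ?_
  have hd : ∀ x, deriv g x = 0 := fun x => by
    simpa using hg.eq_zero_of_integral_eq_zero (hg.continuous_deriv.pow 2) hn i1 h0.symm x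
  have hc := is_const_of_deriv_eq_zero (hg.smooth.differentiable (by simp)) hd
  have := hg.density
  simp only [fun x => hc x 0, integral_const, smul_eq_mul] at this
  -- A constant has Bochner integral 0 over ℝ, since the infinite total mass is sent to the real
  -- number 0; this contradicts total mass 1.
  simp [Measure.real] at this

theorem Regular.K_pos {g : ℝ → ℝ} (hg : Regular g) (alg : Algorithm) : 0 < alg.K g := by
  cases alg with
  | rwm => exact hg.K_rwm_pos
  | sla =>
    have hB := one_le_one_add_abs
    have c1 := hg.continuous_deriv
    have c2 := hg.continuous_iteratedDeriv 2
    have c3 := hg.continuous_iteratedDeriv 3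
    have p1 := hg.polyDom_deriv
    have p2 := hg.polyDom_iteratedDeriv 2
    have p3 := hg.polyDom_iteratedDeriv 3
    have i1 := hg.integrable_mul_exp_neg (p3.pow hB 2) (c3.pow 2)
    have i2 := hg.integrable_mul_exp_neg ((p1.mul hB p2).mul hB p3) ((c1.mul c2).mul c3)
    have i3 := hg.integrable_mul_exp_neg ((p1.mul hB p2).pow hB 2) ((c1.mul c2).pow 2)
    -- Completing the square in the quadratic form for K, with 5/48 = 1/16 + 1/24.
    have hn : ∀ x, 0 ≤ (deriv g x * iteratedDeriv 2 g x - iteratedDeriv 3 g x) ^ 2 / 16 +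
        iteratedDeriv 3 g x ^ 2 / 24 := fun x => by positivity
    have e : ∀ x, ((deriv g x * iteratedDeriv 2 g x - iteratedDeriv 3 g x) ^ 2 / 16 +
        iteratedDeriv 3 g x ^ 2 / 24) * Real.exp (-g x) =
        1 / 16 * ((deriv g x * iteratedDeriv 2 g x) ^ 2 * Real.exp (-g x)) -
        1 / 8 * (deriv g x * iteratedDeriv 2 g x * iteratedDeriv 3 g x * Real.exp (-g x)) +
        5 / 48 * (iteratedDeriv 3 g x ^ 2 * Real.exp (-g x)) := fun x => by ring
    have hi : Integrable fun x => ((deriv g x * iteratedDeriv 2 g x - iteratedDeriv 3 g x) ^ 2 / 16 +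
        iteratedDeriv 3 g x ^ 2 / 24) * Real.exp (-g x) := by
      simp only [e]
      exact ((i3.const_mul _).sub (i2.const_mul _)).add (i1.const_mul _)
    have hK : Algorithm.sla.K g = ∫ x, ((deriv g x * iteratedDeriv 2 g x -
        iteratedDeriv 3 g x) ^ 2 / 16 + iteratedDeriv 3 g x ^ 2 / 24) * Real.exp (-g x) := by
      simp only [e]
      rw [integral_add ?_ (i1.const_mul _),
        integral_sub (i3.const_mul _) (i2.const_mul _), integral_const_mul, integral_const_mul,
        integral_const_mul, hg.K_sla_eq]
      · ring
      · exact (i3.const_mul _).sub (i2.const_mul _)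
    rw [hK]
    refine lt_of_le_of_ne (integral_nonneg fun x => mul_nonneg (hn x) (Real.exp_pos _).le)
      fun h0 => ?_
    have hz := hg.eq_zero_of_integral_eq_zero (F := fun x => (deriv g x * iteratedDeriv 2 g x -
      iteratedDeriv 3 g x) ^ 2 / 16 + iteratedDeriv 3 g x ^ 2 / 24) (by fun_prop) hn hi h0.symm
    have h3 : ∀ x, iteratedDeriv 3 g x = 0 := fun x => by
      have := hz x
      nlinarith [sq_nonneg (deriv g x * iteratedDeriv 2 g x - iteratedDeriv 3 g x),
        sq_nonneg (iteratedDeriv 3 g x)]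
    have h12 : ∀ x, deriv g x * iteratedDeriv 2 g x = 0 := fun x => by
      have := hz x
      rw [h3 x] at this
      simpa using this
    have hconst : ∀ x, iteratedDeriv 2 g x = iteratedDeriv 2 g 0 := fun x =>
      is_const_of_deriv_eq_zero (fun y => (hg.hasDerivAt_iteratedDeriv 2 y).differentiableAt)
        (fun y => by rw [(hg.hasDerivAt_iteratedDeriv 2 y).deriv, h3]) x 0
    -- Since g'' is a constant and g' g'' = 0, a nonzero constant would force g' = 0 everywhere,
    -- hence g'' = 0 after all.
    have h2 : ∀ x, iteratedDeriv 2 g x = 0 := by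
      by_contra! hne
      obtain ⟨x, hx⟩ := hne
      have h1 : deriv g = fun _ => 0 := funext fun y => by
        refine (mul_eq_zero.1 (h12 y)).resolve_right ?_
        rw [hconst y, ← hconst x]
        exact hx
      have := (hg.hasDerivAt_deriv x).deriv
      rw [h1] at this
      simp at this
      exact hx this.symm
    -- Integration by parts gives E[g'²] = E[g''], which would be 0, against the positivity of the
    -- RWM constant.
    have := hg.integral_deriv_mul (F := deriv g) hg.hasDerivAt_deriv p1 p2 c2
    have hpos := hg.K_rwm_pos
    simp only [Algorithm.K, sq] at hpos
    rw [this] at hpos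
    simp [h2] at hpos

/-! ### Moments of the log acceptance ratio of one coordinate -/

theorem Regular.exists_abs_logRatio_le_pow {g : ℝ → ℝ} (hg : Regular g) (alg : Algorithm) :
    ∃ (C : ℝ) (k : ℕ), 0 ≤ C ∧ ∀ h q, 0 ≤ h → h ≤ 1 →
      |alg.logRatio g h q.1 q.2| ≤ h ^ alg.order * (C * growthWeight q ^ k) := by
  obtain ⟨A, ⟨C, k, hC, hA⟩, hA0, hb⟩ := hg.exists_abs_logRatio_le alg
  refine ⟨C, k, hC, fun h q h0 h1 => (hb h q h0 h1).trans ?_⟩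
  exact mul_le_mul_of_nonneg_left ((le_abs_self _).trans (hA q)) (by positivity)

theorem Regular.integrable_logRatio_pow {g : ℝ → ℝ} (hg : Regular g) (alg : Algorithm) {h : ℝ}
    (h0 : 0 ≤ h) (h1 : h ≤ 1) (j : ℕ) :
    Integrable (fun q => alg.logRatio g h q.1 q.2 ^ j) (pairMeasure g) := by
  obtain ⟨C, k, hC, hb⟩ := hg.exists_abs_logRatio_le_pow alg
  have hp : PolyDom growthWeight fun q => alg.logRatio g h q.1 q.2 :=
    ⟨h ^ alg.order * C, k, by positivity, fun q => (hb h q h0 h1).trans_eq (by ring)⟩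
  exact hg.integrable_of_polyDom (hp.pow one_le_growthWeight j)
    ((hg.measurable_logRatio alg h).pow_const j)

theorem Regular.integrable_logRatio {g : ℝ → ℝ} (hg : Regular g) (alg : Algorithm) {h : ℝ}
    (h0 : 0 ≤ h) (h1 : h ≤ 1) :
    Integrable (fun q => alg.logRatio g h q.1 q.2) (pairMeasure g) := by
  simpa using hg.integrable_logRatio_pow alg h0 h1 1

/-- Expectations of functions of the log acceptance ratio that vanish to second order at `0`. -/
theorem Regular.tendsto_integral_logRatio {g : ℝ → ℝ} (hg : Regular g) (alg : Algorithm)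
    {E : Type*} [NormedAddCommGroup E] [NormedSpace ℝ E] [CompleteSpace E]
    {u : ℝ → E} (hu : StronglyMeasurable u) {B : ℝ} (hB : ∀ r, ‖u r‖ ≤ B * r ^ 2) {a : E}
    (ha : Tendsto (fun r => (r ^ 2)⁻¹ • u r) (𝓝[≠] 0) (𝓝 a)) :
    Tendsto (fun h => (h ^ (2 * alg.order))⁻¹ •
      ∫ q, u (alg.logRatio g h q.1 q.2) ∂(pairMeasure g)) (𝓝[>] 0) (𝓝 (alg.K g • a)) := by
  obtain ⟨C, k, hC, hb⟩ := hg.exists_abs_logRatio_le_pow alg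
  have hu0 : u 0 = 0 := by simpa using hB 0
  have hBn : 0 ≤ B := by simpa using (norm_nonneg _).trans (hB 1)
  have hsmall : ∀ᶠ h in 𝓝[>] (0 : ℝ), 0 < h ∧ h ≤ 1 := by
    filter_upwards [Ioc_mem_nhdsGT (zero_lt_one (α := ℝ))] with h hh using hh
  have hid : Tendsto (fun h : ℝ => h) (𝓝[>] 0) (𝓝 0) := tendsto_id.mono_left nhdsWithin_le_nhds
  have hlim : ∀ q : ℝ × ℝ, Tendsto (fun h => (h ^ (2 * alg.order))⁻¹ •
      u (alg.logRatio g h q.1 q.2)) (𝓝[>] 0) (𝓝 (alg.leading g q.1 q.2 ^ 2 • a)) := by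
    intro q
    have hr := hg.tendsto_logRatio_div alg q.1 q.2
    have hr0 : Tendsto (fun h => alg.logRatio g h q.1 q.2) (𝓝[>] 0) (𝓝 0) := by
      have := hr.mul (hid.pow alg.order)
      rw [zero_pow alg.order_pos.ne', mul_zero] at this
      refine this.congr' ?_
      filter_upwards [hsmall] with h hh
      have := hh.1.ne'
      field_simp
    -- The hypothesis on u concerns r ≠ 0, but the log ratio may vanish along the way. Filling in
    -- the value a at 0 makes the quotient continuous there, and the points with r = 0 are harmless
    -- because u 0 = 0.
    have hv : Tendsto (fun r : ℝ => if r = 0 then a else (r ^ 2)⁻¹ • u r) (𝓝 0) (𝓝 a) := by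
      rw [← continuousAt_update_same] at ha
      have := ha.tendsto
      simp only [Function.update_self] at this
      refine this.congr fun r => ?_
      simp [Function.update_apply]
    refine ((hr.pow 2).smul (hv.comp hr0)).congr' ?_
    filter_upwards [hsmall] with h hh
    simp only [Function.comp]
    split_ifs with hz
    · simp [hz, hu0]
    · rw [smul_smul]
      congr 1
      field_simp
      ring
  have hdom : ∀ᶠ h in 𝓝[>] (0 : ℝ), ∀ᵐ q ∂(pairMeasure g), ‖(h ^ (2 * alg.order))⁻¹ •
      u (alg.logRatio g h q.1 q.2)‖ ≤ B * (C ^ 2 * growthWeight q ^ (2 * k)) := by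
    filter_upwards [hsmall] with h hh
    refine ae_of_all _ fun q => ?_
    have hp : 0 < h ^ (2 * alg.order) := pow_pos hh.1 _
    rw [norm_smul, norm_inv, Real.norm_of_nonneg hp.le, inv_mul_le_iff₀ hp]
    refine (hB _).trans ?_
    have h2 : alg.logRatio g h q.1 q.2 ^ 2 ≤ (h ^ alg.order * (C * growthWeight q ^ k)) ^ 2 := by
      rw [← sq_abs]
      have := hb h q hh.1.le hh.2
      gcongr
    calc _ ≤ B * (h ^ alg.order * (C * growthWeight q ^ k)) ^ 2 := by gcongr
      _ = _ := by ring
  have key := tendsto_integral_filter_of_dominated_convergence (μ := pairMeasure g)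
    (F := fun h q => (h ^ (2 * alg.order))⁻¹ • u (alg.logRatio g h q.1 q.2))
    (fun q => B * (C ^ 2 * growthWeight q ^ (2 * k)))
    (Eventually.of_forall fun h => ((hu.comp_measurable
      (hg.measurable_logRatio alg h)).const_smul _).aestronglyMeasurable) hdom
    (((hg.integrable_growthWeight_pow _).const_mul _).const_mul _) (ae_of_all _ hlim)
  simp only [integral_smul] at key
  rwa [integral_smul_const, hg.integral_leading_sq] at key

theorem Regular.exists_integral_logRatio_sq_le {g : ℝ → ℝ} (hg : Regular g) (alg : Algorithm) :
    ∃ B : ℝ, 0 ≤ B ∧ ∀ h, 0 ≤ h → h ≤ 1 →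
      ∫ q, alg.logRatio g h q.1 q.2 ^ 2 ∂(pairMeasure g) ≤ B * h ^ (2 * alg.order) := by
  obtain ⟨C, k, hC, hb⟩ := hg.exists_abs_logRatio_le_pow alg
  have hi := hg.integrable_growthWeight_pow (2 * k)
  refine ⟨C ^ 2 * ∫ q, growthWeight q ^ (2 * k) ∂(pairMeasure g), ?_, fun h h0 h1 => ?_⟩
  · refine mul_nonneg (sq_nonneg _) (integral_nonneg fun q => ?_)
    exact pow_nonneg (zero_le_one.trans (one_le_growthWeight q)) _
  · calc _ ≤ ∫ q, h ^ (2 * alg.order) * (C ^ 2 * growthWeight q ^ (2 * k)) ∂(pairMeasure g) := by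
          refine integral_mono (hg.integrable_logRatio_pow alg h0 h1 2)
            ((hi.const_mul _).const_mul _) fun q => ?_
          have := hb h q h0 h1
          calc alg.logRatio g h q.1 q.2 ^ 2 = |alg.logRatio g h q.1 q.2| ^ 2 := (sq_abs _).symm
            _ ≤ (h ^ alg.order * (C * growthWeight q ^ k)) ^ 2 := by gcongr
            _ = _ := by ring
      _ = _ := by rw [integral_const_mul, integral_const_mul]; ring

/-! ### Mean and Hellinger affinity of one coordinate through reversibility -/

theorem abs_one_sub_exp_div_le (r : ℝ) : |(1 - Real.exp r) / (1 + Real.exp r)| ≤ |r| := by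
  have hp := Real.exp_pos r
  rw [abs_div, abs_of_pos (by positivity : 0 < 1 + Real.exp r), div_le_iff₀ (by positivity)]
  rcases le_total 0 r with hr | hr
  · have h1 : 1 - Real.exp r ≤ 0 := by linarith [Real.one_le_exp hr]
    rw [abs_of_nonpos h1, abs_of_nonneg hr]
    have h2 := Real.add_one_le_exp (-r)
    have h3 : Real.exp r * Real.exp (-r) = 1 := by rw [← Real.exp_add]; simp
    nlinarith
  · have h1 : 0 ≤ 1 - Real.exp r := by linarith [Real.exp_le_one_iff.2 hr]
    rw [abs_of_nonneg h1, abs_of_nonpos hr]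
    have h2 := Real.add_one_le_exp r
    nlinarith

theorem measurable_mul_one_sub_exp_div :
    Measurable fun r : ℝ => r * ((1 - Real.exp r) / (1 + Real.exp r)) := by fun_prop

/-- For G(r) = r/(1+e^r) one has G(-r) = -e^r G(r), so reversibility forces E[e^r G(r)] to equal its
own negative and hence to vanish. Subtracting twice this zero from E[r] replaces r by -r tanh(r/2).
The mean thereby becomes the expectation of a function of second order, and no expansion of r beyond
its leading term is needed. -/
theorem Regular.integral_logRatio_eq {g : ℝ → ℝ} (hg : Regular g) (alg : Algorithm) {h : ℝ}
    (h0 : 0 < h) (h1 : h ≤ 1) :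
    ∫ q, alg.logRatio g h q.1 q.2 ∂(pairMeasure g) =
      ∫ q, alg.logRatio g h q.1 q.2 * ((1 - Real.exp (alg.logRatio g h q.1 q.2)) /
        (1 + Real.exp (alg.logRatio g h q.1 q.2))) ∂(pairMeasure g) := by
  have hi := hg.integrable_logRatio alg h0.le h1
  have hm := hg.measurable_logRatio alg h
  have hG : Measurable fun r : ℝ => r / (1 + Real.exp r) := by fun_prop
  have key := hg.integral_exp_mul_logRatio alg h0.ne' hG
  set R : ℝ × ℝ → ℝ := fun q => alg.logRatio g h q.1 q.2 with hR
  have e1 (r : ℝ) : -r / (1 + Real.exp (-r)) = -(Real.exp r * (r / (1 + Real.exp r))) := by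
    rw [Real.exp_neg]
    have := Real.exp_pos r
    field_simp
    ring
  have hint : Integrable (fun q => Real.exp (R q) * (R q / (1 + Real.exp (R q))))
      (pairMeasure g) := by
    refine hi.mono (by fun_prop) (ae_of_all _ fun q => ?_)
    have := Real.exp_pos (R q)
    rw [norm_mul, norm_div, Real.norm_of_nonneg this.le,
      Real.norm_of_nonneg (by positivity : 0 ≤ 1 + Real.exp (R q)), ← mul_div_assoc,
      div_le_iff₀ (by positivity)]
    change Real.exp (R q) * ‖R q‖ ≤ ‖R q‖ * _
    nlinarith [norm_nonneg (R q)]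
  have hzero : ∫ q, Real.exp (R q) * (R q / (1 + Real.exp (R q))) ∂(pairMeasure g) = 0 := by
    have : ∫ q, Real.exp (R q) * (R q / (1 + Real.exp (R q))) ∂(pairMeasure g) =
        -∫ q, Real.exp (R q) * (R q / (1 + Real.exp (R q))) ∂(pairMeasure g) := by
      rw [← integral_neg]
      refine key.trans (integral_congr_ae (ae_of_all _ fun q => ?_))
      exact e1 (R q)
    linarith
  calc ∫ q, R q ∂(pairMeasure g) = ∫ q, R q - 2 * (Real.exp (R q) *
        (R q / (1 + Real.exp (R q)))) ∂(pairMeasure g) := by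
        rw [integral_sub hi (hint.const_mul 2), integral_const_mul, hzero]; simp
    _ = _ := by
        refine integral_congr_ae (ae_of_all _ fun q => ?_)
        have := Real.exp_pos (R q)
        simp only
        field_simp
        ring

theorem Regular.abs_integral_logRatio_le {g : ℝ → ℝ} (hg : Regular g) (alg : Algorithm) {h : ℝ}
    (h0 : 0 < h) (h1 : h ≤ 1) :
    |∫ q, alg.logRatio g h q.1 q.2 ∂(pairMeasure g)| ≤
      ∫ q, alg.logRatio g h q.1 q.2 ^ 2 ∂(pairMeasure g) := by
  rw [hg.integral_logRatio_eq alg h0 h1]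
  rw [← Real.norm_eq_abs]
  refine norm_integral_le_of_norm_le (hg.integrable_logRatio_pow alg h0.le h1 2)
    (ae_of_all _ fun q => ?_)
  rw [Real.norm_eq_abs, abs_mul, ← sq_abs, sq]
  exact mul_le_mul_of_nonneg_left (abs_one_sub_exp_div_le _) (abs_nonneg _)

theorem one_add_sq_le_cosh (x : ℝ) : 1 + x ^ 2 / 4 ≤ Real.cosh x := by
  wlog hx : 0 ≤ x generalizing x
  · simpa using this (-x) (by linarith)
  · have h1 := Real.quadratic_le_exp_of_nonneg hx
    have h2 := Real.add_one_le_exp (-x)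
    rw [Real.cosh_eq]
    linarith

/-- The Hellinger affinity between the joint law of state and proposal and its reversal. -/
theorem Regular.integral_exp_half_logRatio_le {g : ℝ → ℝ} (hg : Regular g) (alg : Algorithm)
    {h : ℝ} (h0 : 0 < h) :
    ∫ q, Real.exp (alg.logRatio g h q.1 q.2 / 2) ∂(pairMeasure g) ≤
      1 - ∫ q, alg.logRatio g h q.1 q.2 ^ 2 / (16 + alg.logRatio g h q.1 q.2 ^ 2)
        ∂(pairMeasure g) := by
  have := hg.isProbabilityMeasure_pairMeasure
  have hm := hg.measurable_logRatio alg h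
  have hG : Measurable fun r : ℝ => (2 * Real.cosh (r / 2))⁻¹ := by fun_prop
  have key := hg.integral_exp_mul_logRatio alg h0.ne' hG
  have kint := hg.integrable_exp_mul_logRatio alg h0.ne' hG
  set R : ℝ × ℝ → ℝ := fun q => alg.logRatio g h q.1 q.2 with hR
  have hGb (r : ℝ) : ‖(2 * Real.cosh (r / 2))⁻¹‖ ≤ 1 := by
    have h1 := Real.one_le_cosh (r / 2)
    rw [norm_inv, Real.norm_of_nonneg (by positivity)]
    exact inv_le_one_of_one_le₀ (by linarith)
  have hi : Integrable (fun q => (2 * Real.cosh (R q / 2))⁻¹) (pairMeasure g) :=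
    Integrable.of_bound (by fun_prop) 1 (ae_of_all _ fun q => hGb _)
  have hin : Integrable (fun q => (2 * Real.cosh (-R q / 2))⁻¹) (pairMeasure g) := by
    simpa [neg_div] using hi
  have hie : Integrable (fun q => Real.exp (R q) * (2 * Real.cosh (R q / 2))⁻¹) (pairMeasure g) :=
    kint.2 hin
  -- Since e^{r/2} = (e^r + 1)/(2 cosh(r/2)) and 1/cosh is even, reversibility gives both summands
  -- the same mean. So the affinity is E[1/cosh(r/2)], and cosh(r/2) ≥ 1 + r²/16 finishes.
  have e1 (r : ℝ) : Real.exp (r / 2) =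
      Real.exp r * (2 * Real.cosh (r / 2))⁻¹ + (2 * Real.cosh (r / 2))⁻¹ := by
    have hc := Real.cosh_pos (r / 2)
    have h2 : Real.exp r = Real.exp (r / 2) * Real.exp (r / 2) := by
      rw [← Real.exp_add]; ring_nf
    have h3 : Real.exp (r / 2) * Real.exp (-(r / 2)) = 1 := by rw [← Real.exp_add]; simp
    field_simp
    rw [Real.cosh_eq, h2]
    linear_combination h3
  have hq : Integrable (fun q => R q ^ 2 / (16 + R q ^ 2)) (pairMeasure g) := by
    refine Integrable.of_bound (Measurable.aestronglyMeasurable (by fun_prop)) 1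
      (ae_of_all _ fun q => ?_)
    rw [Real.norm_of_nonneg (by positivity), div_le_one (by positivity)]
    linarith
  calc ∫ q, Real.exp (R q / 2) ∂(pairMeasure g)
      = ∫ q, Real.exp (R q) * (2 * Real.cosh (R q / 2))⁻¹ ∂(pairMeasure g) +
        ∫ q, (2 * Real.cosh (R q / 2))⁻¹ ∂(pairMeasure g) := by
        rw [← integral_add hie hi]
        exact integral_congr_ae (ae_of_all _ fun q => e1 (R q))
    _ = ∫ q, 2 * (2 * Real.cosh (R q / 2))⁻¹ ∂(pairMeasure g) := by
        rw [integral_const_mul, two_mul]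
        congr 1
        refine key.trans (integral_congr_ae (ae_of_all _ fun q => ?_))
        simp [neg_div, hR]
    _ ≤ ∫ q, (1 - R q ^ 2 / (16 + R q ^ 2)) ∂(pairMeasure g) := by
        refine integral_mono (hi.const_mul 2) ((integrable_const 1).sub hq) fun q => ?_
        have h1 := one_add_sq_le_cosh (R q / 2)
        have hc := Real.cosh_pos (R q / 2)
        simp only
        have e2 : 1 - R q ^ 2 / (16 + R q ^ 2) = (1 + (R q / 2) ^ 2 / 4)⁻¹ := by
          field_simp; ring
        rw [e2, mul_inv, ← mul_assoc, mul_inv_cancel₀ two_ne_zero, one_mul]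
        exact inv_anti₀ (by positivity) h1
    _ = _ := by rw [integral_sub (integrable_const 1) hq]; simp [hR]

/-- The defect E[r²/(16+r²)] divided by h^(2m) tends to K/16, so it exceeds K/32 for small h; then 1
- x ≤ e^{-x}. -/
theorem Regular.eventually_integral_exp_half_le {g : ℝ → ℝ} (hg : Regular g) (alg : Algorithm) :
    ∃ c > 0, ∃ δ > 0, ∀ h, 0 < h → h < δ →
      ∫ q, Real.exp (alg.logRatio g h q.1 q.2 / 2) ∂(pairMeasure g) ≤
        Real.exp (-(c * h ^ (2 * alg.order))) := by
  have hK := hg.K_pos alg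
  have hlim := hg.tendsto_integral_logRatio alg (u := fun r => r ^ 2 / (16 + r ^ 2))
    (Measurable.stronglyMeasurable (by fun_prop)) (B := 1) (fun r => by
      rw [Real.norm_of_nonneg (by positivity), one_mul]
      exact div_le_self (sq_nonneg _) (by nlinarith [sq_nonneg r])) (a := 1 / 16) (by
      have hc : Tendsto (fun r : ℝ => 1 / (16 + r ^ 2)) (𝓝[≠] 0) (𝓝 (1 / 16)) := by
        have : Continuous fun r : ℝ => 1 / (16 + r ^ 2) :=
          continuous_const.div (by fun_prop) fun r => by positivity
        simpa using (this.tendsto 0).mono_left nhdsWithin_le_nhds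
      refine hc.congr' ?_
      filter_upwards [self_mem_nhdsWithin] with r hr
      have : r ≠ 0 := hr
      simp only [smul_eq_mul]
      field_simp)
  have hev := hlim.eventually (lt_mem_nhds (show alg.K g / 32 < alg.K g • (1 / 16 : ℝ) by
    rw [smul_eq_mul]; linarith))
  obtain ⟨δ, hδ, hb⟩ := mem_nhdsGT_iff_exists_Ioo_subset.1 hev
  refine ⟨alg.K g / 32, by positivity, δ, hδ, fun h h0 h1 => ?_⟩
  have h2 : alg.K g / 32 < _ := hb ⟨h0, h1⟩
  rw [smul_eq_mul, lt_inv_mul_iff₀ (pow_pos h0 _)] at h2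
  have h3 := hg.integral_exp_half_logRatio_le alg h0
  have h4 := Real.add_one_le_exp (-(alg.K g / 32 * h ^ (2 * alg.order)))
  linarith

/-! ### Expansion of the characteristic function of one coordinate -/

theorem norm_cexp_sub_one_sub_le (x : ℝ) :
    ‖Complex.exp (x * Complex.I) - 1 - x * Complex.I‖ ≤ 3 * x ^ 2 := by
  have hn : ‖(x : ℂ) * Complex.I‖ = |x| := by simp
  rcases le_total |x| 1 with h | h
  · have := Complex.norm_exp_sub_one_sub_id_le (x := x * Complex.I) (by rwa [hn])
    rw [hn, sq_abs] at this
    nlinarith [sq_nonneg x]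
  · have h1 := norm_sub_le (Complex.exp (x * Complex.I) - 1) (x * Complex.I)
    have h2 := norm_sub_le (Complex.exp (x * Complex.I)) 1
    rw [Complex.norm_exp_ofReal_mul_I, norm_one] at h2
    rw [hn] at h1
    have h3 : |x| ^ 2 = x ^ 2 := sq_abs x
    nlinarith

theorem tendsto_cexp_sub_one_sub_div (t : ℝ) :
    Tendsto (fun r : ℝ => (r ^ 2)⁻¹ • (Complex.exp (((t * r : ℝ) : ℂ) * Complex.I) - 1 -
      ((t * r : ℝ) : ℂ) * Complex.I)) (𝓝[≠] 0) (𝓝 (-(t : ℂ) ^ 2 / 2)) := by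
  have hw : Tendsto (fun r : ℝ => ((t * r : ℝ) : ℂ) * Complex.I) (𝓝[≠] 0) (𝓝 0) := by
    have : Continuous fun r : ℝ => ((t * r : ℝ) : ℂ) * Complex.I := by fun_prop
    simpa using (this.tendsto 0).mono_left nhdsWithin_le_nhds
  have ho := (Complex.exp_sub_sum_range_succ_isLittleO_pow 2).comp_tendsto hw
  have hO : (fun r : ℝ => (((t * r : ℝ) : ℂ) * Complex.I) ^ 2) =O[𝓝[≠] 0]
      fun r : ℝ => r ^ 2 := by
    refine IsBigO.of_bound (t ^ 2) (Eventually.of_forall fun r => ?_)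
    simp [mul_pow]
  have h0 := (ho.trans_isBigO hO).tendsto_inv_smul_nhds_zero
  have := h0.add_const (-(t : ℂ) ^ 2 / 2)
  rw [zero_add] at this
  refine this.congr' ?_
  filter_upwards [self_mem_nhdsWithin] with r hr
  have hr' : (r : ℂ) ≠ 0 := by exact_mod_cast hr
  simp only [Finset.sum_range_succ, Finset.sum_range_zero, Function.comp, Complex.real_smul]
  push_cast
  simp only [Nat.factorial]
  field_simp
  push_cast
  ring_nf
  simp only [Complex.I_sq]
  ring

theorem tendsto_mul_one_sub_exp_div :
    Tendsto (fun r : ℝ => (r ^ 2)⁻¹ * (r * ((1 - Real.exp r) / (1 + Real.exp r)))) (𝓝[≠] 0)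
      (𝓝 (-1 / 2)) := by
  have h1 := (Real.hasDerivAt_exp 0).tendsto_slope_zero
  have h2 : Tendsto (fun r : ℝ => -1 / (1 + Real.exp r)) (𝓝[≠] 0) (𝓝 (-1 / 2)) := by
    have : Continuous fun r : ℝ => -1 / (1 + Real.exp r) :=
      continuous_const.div (by fun_prop) fun r => by positivity
    have h := (this.tendsto 0).mono_left (nhdsWithin_le_nhds (s := {0}ᶜ))
    norm_num at h ⊢
    exact h
  have := h1.mul h2
  simp only [zero_add, Real.exp_zero, one_mul] at this
  refine this.congr' ?_
  filter_upwards [self_mem_nhdsWithin] with r hr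
  have hr : r ≠ 0 := hr
  have := Real.exp_pos r
  simp only [smul_eq_mul]
  field_simp
  ring

/-- Second order expansion of the characteristic function of the log acceptance ratio of one
coordinate. -/
theorem Regular.tendsto_charFun_logRatio {g : ℝ → ℝ} (hg : Regular g) (alg : Algorithm) (t : ℝ) :
    Tendsto (fun h => (h ^ (2 * alg.order))⁻¹ •
      (∫ q, Complex.exp (((t * alg.logRatio g h q.1 q.2 : ℝ) : ℂ) * Complex.I) ∂(pairMeasure g) -
        1)) (𝓝[>] 0) (𝓝 (alg.K g • (-((t : ℂ) ^ 2 + t * Complex.I) / 2))) := by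
  have := hg.isProbabilityMeasure_pairMeasure
  set v : ℝ → ℝ := fun r => r * ((1 - Real.exp r) / (1 + Real.exp r)) with hv
  have hvm : Measurable v := measurable_mul_one_sub_exp_div
  have hvb (r : ℝ) : |v r| ≤ r ^ 2 := by
    rw [hv, abs_mul, ← sq_abs, sq]
    exact mul_le_mul_of_nonneg_left (abs_one_sub_exp_div_le _) (abs_nonneg _)
  -- The linear term i t r is not of second order, so it is exchanged for i t v(r), which has the
  -- same mean and satisfies |v(r)| ≤ r². Since v(r)/r² → -1/2, the limit is -t²/2 - it/2.
  have key := hg.tendsto_integral_logRatio alg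
    (u := fun r => (Complex.exp (((t * r : ℝ) : ℂ) * Complex.I) - 1 -
      ((t * r : ℝ) : ℂ) * Complex.I) + (t * Complex.I) * ((v r : ℝ) : ℂ))
    (Measurable.stronglyMeasurable (by fun_prop)) (B := 3 * t ^ 2 + |t|) (fun r => by
      refine (norm_add_le _ _).trans ?_
      have h1 := norm_cexp_sub_one_sub_le (t * r)
      have h2 : ‖(t * Complex.I) * ((v r : ℝ) : ℂ)‖ = |t| * |v r| := by simp
      have h3 := mul_le_mul_of_nonneg_left (hvb r) (abs_nonneg t)
      rw [h2]
      nlinarith) (a := -((t : ℂ) ^ 2 + t * Complex.I) / 2) (by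
      have h1 := tendsto_cexp_sub_one_sub_div t
      have h2 := (Complex.continuous_ofReal.tendsto _).comp tendsto_mul_one_sub_exp_div
      have h3 := h1.add (h2.const_mul (t * Complex.I))
      refine (h3.congr fun r => ?_).trans (le_of_eq ?_)
      · simp only [Function.comp, smul_add, hv, Complex.real_smul]
        push_cast
        ring
      · congr 1
        push_cast
        ring)
  refine key.congr' ?_
  filter_upwards [Ioc_mem_nhdsGT (zero_lt_one (α := ℝ))] with h hh
  congr 1
  have hm := hg.measurable_logRatio alg h
  have hi := hg.integrable_logRatio alg hh.1.le hh.2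
  have hic : Integrable (fun q => Complex.exp (((t * alg.logRatio g h q.1 q.2 : ℝ) : ℂ) *
      Complex.I)) (pairMeasure g) := by
    refine Integrable.of_bound (Measurable.aestronglyMeasurable (by fun_prop)) 1
      (ae_of_all _ fun q => ?_)
    rw [Complex.norm_exp_ofReal_mul_I]
  have hii : Integrable (fun q => ((t * alg.logRatio g h q.1 q.2 : ℝ) : ℂ) * Complex.I)
      (pairMeasure g) := (hi.const_mul t).ofReal.mul_const _
  have hiv : Integrable (fun q => v (alg.logRatio g h q.1 q.2)) (pairMeasure g) :=
    (hg.integrable_logRatio_pow alg hh.1.le hh.2 2).mono' (hvm.comp hm).aestronglyMeasurable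
      (ae_of_all _ fun q => hvb _)
  have hivc : Integrable (fun q => (t * Complex.I) * ((v (alg.logRatio g h q.1 q.2) : ℝ) : ℂ))
      (pairMeasure g) := hiv.ofReal.const_mul _
  have hmean : ∫ q, ((t * alg.logRatio g h q.1 q.2 : ℝ) : ℂ) * Complex.I ∂(pairMeasure g) =
      ∫ q, (t * Complex.I) * ((v (alg.logRatio g h q.1 q.2) : ℝ) : ℂ) ∂(pairMeasure g) := by
    rw [integral_mul_const, integral_const_mul, integral_complex_ofReal, integral_complex_ofReal,
      integral_const_mul, hg.integral_logRatio_eq alg hh.1 hh.2]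
    push_cast
    ring
  have hsplit := integral_add ((hic.sub (integrable_const (1 : ℂ))).sub hii) hivc
  have hsplit2 := integral_sub (hic.sub (integrable_const (1 : ℂ))) hii
  have hsplit3 := integral_sub hic (integrable_const (1 : ℂ))
  simp only [Pi.sub_apply] at hsplit hsplit2 hsplit3
  rw [hsplit, hsplit2, hsplit3, hmean]
  simp

/-! ### The product law -/

/-- The joint law of the rescaled state and the noise under the reference product law. -/
def productLaw (g : ℝ → ℝ) (n : ℕ) : Measure (Fin n → ℝ × ℝ) := Measure.pi fun _ => pairMeasure g

theorem Regular.isProbabilityMeasure_productLaw {g : ℝ → ℝ} (hg : Regular g) (n : ℕ) :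
    IsProbabilityMeasure (productLaw g n) := by
  have := hg.isProbabilityMeasure_pairMeasure
  unfold productLaw
  infer_instance

theorem Regular.measurePreserving_eval {g : ℝ → ℝ} (hg : Regular g) {n : ℕ} (i : Fin n) :
    MeasurePreserving (fun ξ : Fin n → ℝ × ℝ => ξ i) (productLaw g n) (pairMeasure g) := by
  have := hg.isProbabilityMeasure_pairMeasure
  exact MeasureTheory.measurePreserving_eval (fun _ : Fin n => pairMeasure g) i

theorem Regular.integral_eval {g : ℝ → ℝ} (hg : Regular g) {n : ℕ} (i : Fin n) {F : ℝ × ℝ → ℝ}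
    (hF : Measurable F) : ∫ ξ, F (ξ i) ∂(productLaw g n) = ∫ q, F q ∂(pairMeasure g) := by
  rw [← (hg.measurePreserving_eval i).map_eq, integral_map
    (hg.measurePreserving_eval i).measurable.aemeasurable hF.aestronglyMeasurable]

theorem Regular.integrable_eval {g : ℝ → ℝ} (hg : Regular g) {n : ℕ} (i : Fin n) {F : ℝ × ℝ → ℝ}
    (hi : Integrable F (pairMeasure g)) : Integrable (fun ξ => F (ξ i)) (productLaw g n) :=
  (hg.measurePreserving_eval i).integrable_comp_of_integrable hi

/-- The part of the log acceptance ratio that is due to the coordinates in `s`. -/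
def Algorithm.partialRatio (alg : Algorithm) (g : ℝ → ℝ) {n : ℕ} (h : Fin n → ℝ)
    (s : Finset (Fin n)) (ξ : Fin n → ℝ × ℝ) : ℝ :=
  ∑ i ∈ s, alg.logRatio g (h i) (ξ i).1 (ξ i).2

/-- The log acceptance ratio under the reference product law. -/
def Algorithm.totalRatio (alg : Algorithm) (g : ℝ → ℝ) {n : ℕ} (h : Fin n → ℝ)
    (ξ : Fin n → ℝ × ℝ) : ℝ :=
  ∑ i, alg.logRatio g (h i) (ξ i).1 (ξ i).2

theorem Regular.measurable_partialRatio {g : ℝ → ℝ} (hg : Regular g) (alg : Algorithm) {n : ℕ}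
    (h : Fin n → ℝ) (s : Finset (Fin n)) : Measurable (alg.partialRatio g h s) :=
  Finset.measurable_fun_sum _ fun i _ => (hg.measurable_logRatio alg (h i)).comp
    (measurable_pi_apply i)

theorem Regular.measurable_totalRatio {g : ℝ → ℝ} (hg : Regular g) (alg : Algorithm) {n : ℕ}
    (h : Fin n → ℝ) : Measurable (alg.totalRatio g h) :=
  hg.measurable_partialRatio alg h Finset.univ

/-- By independence the expectation is the product of the affinities of the coordinates, so the
exponents add up. -/
theorem Regular.integral_exp_half_totalRatio_le {g : ℝ → ℝ} (hg : Regular g) (alg : Algorithm) :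
    ∃ c > 0, ∃ δ > 0, ∀ (n : ℕ) (h : Fin n → ℝ), (∀ i, 0 < h i) → (∀ i, h i < δ) →
      ∫ ξ, Real.exp (alg.totalRatio g h ξ / 2) ∂(productLaw g n) ≤
        Real.exp (-(c * ∑ i, h i ^ (2 * alg.order))) := by
  have := hg.isProbabilityMeasure_pairMeasure
  obtain ⟨c, hc, δ, hδ, hb⟩ := hg.eventually_integral_exp_half_le alg
  refine ⟨c, hc, δ, hδ, fun n h h0 h1 => ?_⟩
  have e : ∀ ξ, Real.exp (alg.totalRatio g h ξ / 2) =
      ∏ i, Real.exp (alg.logRatio g (h i) (ξ i).1 (ξ i).2 / 2) := fun ξ => by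
    rw [← Real.exp_sum, Algorithm.totalRatio, Finset.sum_div]
  simp only [e]
  rw [productLaw, integral_fintype_prod_eq_prod
    (f := fun i (q : ℝ × ℝ) => Real.exp (alg.logRatio g (h i) q.1 q.2 / 2)), Finset.mul_sum,
    ← Finset.sum_neg_distrib, Real.exp_sum]
  exact Finset.prod_le_prod (fun i _ => integral_nonneg fun q => (Real.exp_pos _).le)
    fun i _ => hb (h i) (h0 i) (h1 i)

/-- The bound e^{r/2} ≤ e^r + 1 suffices, because e^r is integrable by reversibility with G = 1. -/
theorem Regular.integrable_exp_half_logRatio {g : ℝ → ℝ} (hg : Regular g) (alg : Algorithm)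
    {h : ℝ} (h0 : h ≠ 0) :
    Integrable (fun q => Real.exp (alg.logRatio g h q.1 q.2 / 2)) (pairMeasure g) := by
  have := hg.isProbabilityMeasure_pairMeasure
  have hm := hg.measurable_logRatio alg h
  have h1 : Integrable (fun q => Real.exp (alg.logRatio g h q.1 q.2)) (pairMeasure g) := by
    simpa using (hg.integrable_exp_mul_logRatio alg h0 (G := fun _ => 1) (by fun_prop)).2
      (integrable_const 1)
  refine (h1.add (integrable_const 1)).mono' (by fun_prop) (ae_of_all _ fun q => ?_)
  rw [Real.norm_of_nonneg (Real.exp_pos _).le, Pi.add_apply]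
  rcases le_total 0 (alg.logRatio g h q.1 q.2) with hr | hr
  · have := Real.exp_le_exp.2 (show alg.logRatio g h q.1 q.2 / 2 ≤ alg.logRatio g h q.1 q.2 by
      linarith)
    linarith
  · have := Real.exp_le_one_iff.2 (show alg.logRatio g h q.1 q.2 / 2 ≤ 0 by linarith)
    linarith [Real.exp_pos (alg.logRatio g h q.1 q.2)]

theorem Regular.integrable_exp_half_totalRatio {g : ℝ → ℝ} (hg : Regular g) (alg : Algorithm)
    {n : ℕ} {h : Fin n → ℝ} (h0 : ∀ i, h i ≠ 0) :
    Integrable (fun ξ => Real.exp (alg.totalRatio g h ξ / 2)) (productLaw g n) := by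
  have := hg.isProbabilityMeasure_pairMeasure
  have e : ∀ ξ, Real.exp (alg.totalRatio g h ξ / 2) =
      ∏ i, Real.exp (alg.logRatio g (h i) (ξ i).1 (ξ i).2 / 2) := fun ξ => by
    rw [← Real.exp_sum, Algorithm.totalRatio, Finset.sum_div]
  simp only [e]
  exact Integrable.fintype_prod
    (f := fun i (q : ℝ × ℝ) => Real.exp (alg.logRatio g (h i) q.1 q.2 / 2))
    fun i => hg.integrable_exp_half_logRatio alg (h0 i)

theorem Regular.memLp_logRatio {g : ℝ → ℝ} (hg : Regular g) (alg : Algorithm) {h : ℝ}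
    (h0 : 0 ≤ h) (h1 : h ≤ 1) :
    MemLp (fun q : ℝ × ℝ => alg.logRatio g h q.1 q.2) 2 (pairMeasure g) :=
  (memLp_two_iff_integrable_sq (hg.measurable_logRatio alg h).aestronglyMeasurable).2
    (hg.integrable_logRatio_pow alg h0 h1 2)

theorem Regular.memLp_totalRatio {g : ℝ → ℝ} (hg : Regular g) (alg : Algorithm) {n : ℕ}
    {h : Fin n → ℝ} (h0 : ∀ i, 0 ≤ h i) (h1 : ∀ i, h i ≤ 1) :
    MemLp (alg.totalRatio g h) 2 (productLaw g n) :=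
  memLp_finsetSum _ fun i _ =>
    (hg.memLp_logRatio alg (h0 i) (h1 i)).comp_measurePreserving (hg.measurePreserving_eval i)

/-- Variance plus squared mean. Variances add by independence, and reversibility bounds each mean by
the corresponding second moment, so the sum of means causes no loss of order. -/
theorem Regular.integral_totalRatio_sq_le {g : ℝ → ℝ} (hg : Regular g) (alg : Algorithm) {n : ℕ}
    {h : Fin n → ℝ} (h0 : ∀ i, 0 < h i) (h1 : ∀ i, h i ≤ 1) :
    ∫ ξ, alg.totalRatio g h ξ ^ 2 ∂(productLaw g n) ≤
      (∑ i, ∫ q, alg.logRatio g (h i) q.1 q.2 ^ 2 ∂(pairMeasure g)) +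
        (∑ i, ∫ q, alg.logRatio g (h i) q.1 q.2 ^ 2 ∂(pairMeasure g)) ^ 2 := by
  have := hg.isProbabilityMeasure_pairMeasure
  have := hg.isProbabilityMeasure_productLaw n
  have hL (i) := hg.memLp_logRatio alg (h0 i).le (h1 i)
  have hT := hg.memLp_totalRatio alg (fun i => (h0 i).le) h1
  have hvar : Var[alg.totalRatio g h; productLaw g n] =
      ∑ i, Var[fun q : ℝ × ℝ => alg.logRatio g (h i) q.1 q.2; pairMeasure g] := by
    have := variance_sum_pi (X := fun i (q : ℝ × ℝ) => alg.logRatio g (h i) q.1 q.2) hL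
    rw [← this, productLaw]
    congr 1
    ext ξ
    simp [Algorithm.totalRatio]
  have hmean : ∫ ξ, alg.totalRatio g h ξ ∂(productLaw g n) =
      ∑ i, ∫ q, alg.logRatio g (h i) q.1 q.2 ∂(pairMeasure g) := by
    simp only [Algorithm.totalRatio]
    rw [integral_finsetSum _ fun i _ => hg.integrable_eval i
      (hg.integrable_logRatio alg (h0 i).le (h1 i))]
    exact Finset.sum_congr rfl fun i _ => hg.integral_eval i (hg.measurable_logRatio alg (h i))
  have h2 := variance_eq_sub hT
  simp only [Pi.pow_apply] at h2
  have h3 : ∑ i, Var[fun q : ℝ × ℝ => alg.logRatio g (h i) q.1 q.2; pairMeasure g] ≤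
      ∑ i, ∫ q, alg.logRatio g (h i) q.1 q.2 ^ 2 ∂(pairMeasure g) :=
    Finset.sum_le_sum fun i _ => variance_le_expectation_sq (hL i).aestronglyMeasurable
  have h4 : |∑ i, ∫ q, alg.logRatio g (h i) q.1 q.2 ∂(pairMeasure g)| ≤
      ∑ i, ∫ q, alg.logRatio g (h i) q.1 q.2 ^ 2 ∂(pairMeasure g) :=
    (Finset.abs_sum_le_sum_abs _ _).trans
      (Finset.sum_le_sum fun i _ => hg.abs_integral_logRatio_le alg (h0 i) (h1 i))
  have h5 := sq_le_sq' (by linarith [(abs_le.1 h4).1]) (abs_le.1 h4).2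
  rw [hmean, hvar] at h2
  linarith

/-- A uniform bound on the second moment of the log acceptance ratio. -/
theorem Regular.exists_integral_totalRatio_sq_le {g : ℝ → ℝ} (hg : Regular g) (alg : Algorithm) :
    ∃ B : ℝ, 0 ≤ B ∧ ∀ (n : ℕ) (h : Fin n → ℝ), (∀ i, 0 < h i) → (∀ i, h i ≤ 1) →
      ∫ ξ, alg.totalRatio g h ξ ^ 2 ∂(productLaw g n) ≤
        B * (∑ i, h i ^ (2 * alg.order)) + (B * ∑ i, h i ^ (2 * alg.order)) ^ 2 := by
  obtain ⟨B, hB, hb⟩ := hg.exists_integral_logRatio_sq_le alg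
  refine ⟨B, hB, fun n h h0 h1 => (hg.integral_totalRatio_sq_le alg h0 h1).trans ?_⟩
  have : ∑ i, ∫ q, alg.logRatio g (h i) q.1 q.2 ^ 2 ∂(pairMeasure g) ≤
      B * ∑ i, h i ^ (2 * alg.order) := by
    rw [Finset.mul_sum]
    exact Finset.sum_le_sum fun i _ => hb (h i) (h0 i).le (h1 i)
  have hn : 0 ≤ ∑ i, ∫ q, alg.logRatio g (h i) q.1 q.2 ^ 2 ∂(pairMeasure g) :=
    Finset.sum_nonneg fun i _ => integral_nonneg fun q => sq_nonneg _
  gcongr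

theorem integral_abs_le_sqrt {Ω : Type*} [MeasurableSpace Ω] {P : Measure Ω}
    [IsProbabilityMeasure P] {X : Ω → ℝ} (hX : MemLp X 2 P) :
    ∫ ξ, |X ξ| ∂P ≤ √(∫ ξ, X ξ ^ 2 ∂P) := by
  have h := variance_eq_sub hX.abs
  have h2 := variance_nonneg |X| P
  apply Real.le_sqrt_of_sq_le
  simp only [Pi.pow_apply, Pi.abs_apply, sq_abs] at h
  linarith

/-- Used for a block of coordinates whose size stays fixed as n grows: its share of the log ratio
then tends to 0 in mean with the largest relative step H. -/
theorem Regular.exists_integral_abs_partialRatio_le {g : ℝ → ℝ} (hg : Regular g)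
    (alg : Algorithm) :
    ∃ B : ℝ, 0 ≤ B ∧ ∀ (n : ℕ) (h : Fin n → ℝ) (H : ℝ) (s : Finset (Fin n)), (∀ i, 0 < h i) →
      (∀ i, h i ≤ H) → H ≤ 1 →
      Integrable (alg.partialRatio g h s) (productLaw g n) ∧
      ∫ ξ, |alg.partialRatio g h s ξ| ∂(productLaw g n) ≤ s.card * (B * H ^ alg.order) := by
  have := hg.isProbabilityMeasure_pairMeasure
  obtain ⟨B, hB, hb⟩ := hg.exists_integral_logRatio_sq_le alg
  refine ⟨√B, Real.sqrt_nonneg _, fun n h H s h0 h1 hH => ?_⟩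
  have hi (i) := hg.integrable_eval i (hg.integrable_logRatio alg (h0 i).le ((h1 i).trans hH))
  refine ⟨integrable_finsetSum _ fun i _ => hi i, ?_⟩
  calc ∫ ξ, |alg.partialRatio g h s ξ| ∂(productLaw g n)
      ≤ ∫ ξ, ∑ i ∈ s, |alg.logRatio g (h i) (ξ i).1 (ξ i).2| ∂(productLaw g n) := by
        refine integral_mono (integrable_finsetSum _ fun i _ => hi i).abs
          (integrable_finsetSum _ fun i _ => (hi i).abs) fun ξ => ?_
        exact Finset.abs_sum_le_sum_abs _ _
    _ = ∑ i ∈ s, ∫ q, |alg.logRatio g (h i) q.1 q.2| ∂(pairMeasure g) := by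
        rw [integral_finsetSum _ fun i _ => (hi i).abs]
        refine Finset.sum_congr rfl fun i _ => ?_
        exact hg.integral_eval i (F := fun q => |alg.logRatio g (h i) q.1 q.2|)
          (hg.measurable_logRatio alg (h i)).abs
    _ ≤ ∑ i ∈ s, √B * H ^ alg.order := by
        refine Finset.sum_le_sum fun i _ => ?_
        refine (integral_abs_le_sqrt (hg.memLp_logRatio alg (h0 i).le ((h1 i).trans hH))).trans ?_
        refine (Real.sqrt_le_sqrt (hb (h i) (h0 i).le ((h1 i).trans hH))).trans ?_
        rw [Real.sqrt_mul hB, pow_mul', Real.sqrt_sq (pow_nonneg (h0 i).le _)]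
        have := (h0 i).le
        have := h1 i
        gcongr
    _ = _ := by simp

/-! ### The central limit theorem for the log acceptance ratio -/

/-- Telescoping: factors are exchanged one at a time, and all others lie in the unit disc. -/
theorem norm_prod_sub_prod_le {ι : Type*} (s : Finset ι) {a b : ι → ℂ}
    (ha : ∀ i ∈ s, ‖a i‖ ≤ 1) (hb : ∀ i ∈ s, ‖b i‖ ≤ 1) :
    ‖∏ i ∈ s, a i - ∏ i ∈ s, b i‖ ≤ ∑ i ∈ s, ‖a i - b i‖ := by
  classical
  induction s using Finset.induction_on with
  | empty => simp
  | insert j s hj ih =>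
    rw [Finset.prod_insert hj, Finset.prod_insert hj, Finset.sum_insert hj]
    have ih := ih (fun i hi => ha i (Finset.mem_insert_of_mem hi))
      (fun i hi => hb i (Finset.mem_insert_of_mem hi))
    have h1 : ‖∏ i ∈ s, a i‖ ≤ 1 := by
      rw [norm_prod]
      exact Finset.prod_le_one (fun _ _ => norm_nonneg _)
        fun i hi => ha i (Finset.mem_insert_of_mem hi)
    have h2 := hb j (Finset.mem_insert_self j s)
    have e : a j * ∏ i ∈ s, a i - b j * ∏ i ∈ s, b i =
        (a j - b j) * ∏ i ∈ s, a i + b j * (∏ i ∈ s, a i - ∏ i ∈ s, b i) := by ring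
    rw [e]
    refine (norm_add_le _ _).trans ?_
    rw [norm_mul, norm_mul]
    have h3 := mul_le_mul_of_nonneg_left h1 (norm_nonneg (a j - b j))
    have h4 := mul_le_mul_of_nonneg_right h2 (norm_nonneg (∏ i ∈ s, a i - ∏ i ∈ s, b i))
    linarith

/-- If `c` has a first order expansion `1 + h ^ k * w` at `0`, then products of values of `c` along
an infinitesimal array converge to exponentials. -/
theorem tendsto_prod_of_expansion {c : ℝ → ℂ} {k : ℕ} (hk : 0 < k) {w : ℂ} (hw : w.re ≤ 0)
    (hc1 : ∀ h, ‖c h‖ ≤ 1)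
    (hc : Tendsto (fun h : ℝ => (h ^ k)⁻¹ • (c h - 1)) (𝓝[>] 0) (𝓝 w))
    {h : (n : ℕ) → Fin n → ℝ} {H : ℕ → ℝ} (hH : Tendsto H atTop (𝓝 0))
    (h0 : ∀ᶠ n in atTop, ∀ i, 0 < h n i ∧ h n i ≤ H n) {S : ℝ}
    (hS : Tendsto (fun n => ∑ i, h n i ^ k) atTop (𝓝 S)) :
    Tendsto (fun n => ∏ i, c (h n i)) atTop (𝓝 (Complex.exp (S * w))) := by
  -- The exponential e^{h^k w} has the same first order expansion as c, so the two differ by o(h^k),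
  -- uniformly along the array, and the products can be compared factor by factor.
  have he : Tendsto (fun h : ℝ => (h ^ k)⁻¹ • (Complex.exp ((h ^ k : ℝ) * w) - 1)) (𝓝[>] 0)
      (𝓝 w) := by
    have hd : HasDerivAt (fun x : ℝ => Complex.exp ((x : ℂ) * w)) w 0 := by
      have h1 : HasDerivAt (fun x : ℝ => (x : ℂ) * w) w 0 := by
        simpa using (Complex.ofRealCLM.hasDerivAt (x := (0 : ℝ))).mul_const w
      simpa using h1.cexp
    have hp : Tendsto (fun h : ℝ => h ^ k) (𝓝[>] 0) (𝓝[≠] 0) := by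
      refine tendsto_nhdsWithin_iff.2 ⟨?_, ?_⟩
      · have : Tendsto (fun h : ℝ => h ^ k) (𝓝 0) (𝓝 (0 ^ k)) := (continuous_pow k).tendsto 0
        rw [zero_pow hk.ne'] at this
        exact this.mono_left nhdsWithin_le_nhds
      · filter_upwards [self_mem_nhdsWithin] with h hh
        exact (pow_pos hh k).ne'
    refine (hd.tendsto_slope_zero.comp hp).congr fun h => ?_
    simp [Function.comp]
  have hdiff : Tendsto (fun h : ℝ => (h ^ k)⁻¹ • (c h - Complex.exp ((h ^ k : ℝ) * w)))
      (𝓝[>] 0) (𝓝 0) := by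
    have := hc.sub he
    rw [sub_self] at this
    refine this.congr fun h => ?_
    rw [← smul_sub]
    congr 1
    ring
  have hexp : Tendsto (fun n => ∏ i, Complex.exp ((h n i ^ k : ℝ) * w)) atTop
      (𝓝 (Complex.exp (S * w))) := by
    have h1 : Tendsto (fun n => Complex.exp (((∑ i, h n i ^ k : ℝ) : ℂ) * w)) atTop
        (𝓝 (Complex.exp (S * w))) :=
      (Complex.continuous_exp.tendsto _).comp
        (((Complex.continuous_ofReal.tendsto _).comp hS).mul_const w)
    refine h1.congr fun n => ?_
    rw [← Complex.exp_sum, ← Finset.sum_mul]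
    push_cast
    rfl
  have hzero : Tendsto (fun n => ∏ i, c (h n i) - ∏ i, Complex.exp ((h n i ^ k : ℝ) * w)) atTop
      (𝓝 0) := by
    rw [Metric.tendsto_nhds]
    intro ε hε
    have hSp : 0 < |S| + 1 := by positivity
    -- The sums of h^k are eventually below |S| + 1, so an error of ε/(2(|S|+1)) · h^k per factor
    -- adds up to at most ε/2.
    have hε' : 0 < ε / (2 * (|S| + 1)) := by positivity
    have hev := (Metric.tendsto_nhds.1 hdiff) _ hε'
    obtain ⟨δ, hδ, hδb⟩ := mem_nhdsGT_iff_exists_Ioo_subset.1 hev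
    have hSev : ∀ᶠ n in atTop, ∑ i, h n i ^ k < |S| + 1 :=
      hS.eventually (gt_mem_nhds (by linarith [le_abs_self S]))
    filter_upwards [h0, hSev, hH.eventually (gt_mem_nhds hδ)] with n hn hSn hHn
    rw [dist_zero_right]
    have hterm : ∀ i, ‖c (h n i) - Complex.exp ((h n i ^ k : ℝ) * w)‖ ≤
        ε / (2 * (|S| + 1)) * h n i ^ k := fun i => by
      have hm : dist _ _ < ε / (2 * (|S| + 1)) := hδb ⟨(hn i).1, (hn i).2.trans_lt hHn⟩
      have hp := pow_pos (hn i).1 k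
      rw [dist_zero_right, norm_smul, norm_inv, Real.norm_of_nonneg hp.le,
        inv_mul_lt_iff₀ hp] at hm
      linarith
    refine (norm_prod_sub_prod_le _ (fun i _ => hc1 _) fun i _ => ?_).trans_lt ?_
    · rw [Complex.norm_exp, Complex.re_ofReal_mul]
      exact Real.exp_le_one_iff.2 (mul_nonpos_of_nonneg_of_nonpos (pow_pos (hn i).1 k).le hw)
    · calc _ ≤ ∑ i, ε / (2 * (|S| + 1)) * h n i ^ k := Finset.sum_le_sum fun i _ => hterm i
        _ = ε / (2 * (|S| + 1)) * ∑ i, h n i ^ k := by rw [Finset.mul_sum]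
        _ ≤ ε / (2 * (|S| + 1)) * (|S| + 1) := by gcongr
        _ = ε / 2 := by field_simp
        _ < ε := by linarith
  simpa using hzero.add hexp

/-- The Metropolis function of the log acceptance ratio. -/
def cutExp (r : ℝ) : ℝ := min 1 (Real.exp r)

/-! ### Elementary bounds for the Metropolis function -/

theorem cutExp_nonneg (r : ℝ) : 0 ≤ cutExp r := le_min zero_le_one (Real.exp_pos r).le

theorem cutExp_le_one (r : ℝ) : cutExp r ≤ 1 := min_le_left _ _

theorem continuous_cutExp : Continuous cutExp := continuous_const.min Real.continuous_exp

theorem one_sub_le_cutExp (r : ℝ) : 1 - |r| ≤ cutExp r := by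
  refine le_min (by linarith [abs_nonneg r]) ?_
  linarith [Real.add_one_le_exp r, neg_abs_le r]

/-- The minimum of 1 and e^r is at most their geometric mean. This links the acceptance probability
to the Hellinger affinity. -/
theorem cutExp_le_exp_half (r : ℝ) : cutExp r ≤ Real.exp (r / 2) := by
  rcases le_total 0 r with h | h
  · exact (cutExp_le_one r).trans (Real.one_le_exp (by linarith))
  · exact (min_le_right _ _).trans (Real.exp_le_exp.2 (by linarith))

theorem cutExp_sub_le (r s : ℝ) (h : s ≤ r) : cutExp r - cutExp s ≤ r - s := by
  have hs := cutExp_nonneg s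
  rcases le_total 0 s with h0 | h0
  · have : cutExp s = 1 := min_eq_left (Real.one_le_exp h0)
    linarith [cutExp_le_one r]
  · have e1 : cutExp s = Real.exp s := min_eq_right (Real.exp_le_one_iff.2 h0)
    have h1 := cutExp_le_one r
    have h2 : cutExp r ≤ Real.exp r := min_le_right _ _
    have h3 : Real.exp s ≤ 1 := Real.exp_le_one_iff.2 h0
    have h4 := Real.add_one_le_exp (s - r)
    have h5 : Real.exp s = Real.exp r * Real.exp (s - r) := by rw [← Real.exp_add]; ring_nf
    have h6 := cutExp_nonneg r
    have h7 : cutExp r * Real.exp (s - r) ≤ Real.exp s := by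
      rw [h5]; exact mul_le_mul_of_nonneg_right h2 (Real.exp_pos _).le
    rw [e1]
    nlinarith

theorem abs_cutExp_sub_le (r s : ℝ) : |cutExp r - cutExp s| ≤ |r - s| := by
  have hmono : Monotone cutExp := fun a b hab => min_le_min_left _ (Real.exp_le_exp.2 hab)
  rcases le_total s r with h | h
  · rw [abs_of_nonneg (sub_nonneg.2 (hmono h)), abs_of_nonneg (sub_nonneg.2 h)]
    exact cutExp_sub_le r s h
  · rw [abs_sub_comm, abs_sub_comm r, abs_of_nonneg (sub_nonneg.2 (hmono h)),
      abs_of_nonneg (sub_nonneg.2 h)]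
    exact cutExp_sub_le s r h

theorem abs_cutExp_sub_le_min (r s : ℝ) : |cutExp r - cutExp s| ≤ min 1 |r - s| := by
  refine le_min ?_ (abs_cutExp_sub_le r s)
  rw [abs_le]
  constructor <;> linarith [cutExp_nonneg r, cutExp_nonneg s, cutExp_le_one r, cutExp_le_one s]

theorem Regular.charFun_totalRatio {g : ℝ → ℝ} (hg : Regular g) (alg : Algorithm) {n : ℕ}
    (h : Fin n → ℝ) (t : ℝ) :
    charFun ((productLaw g n).map (alg.totalRatio g h)) t =
      ∏ i, ∫ q, Complex.exp (((t * alg.logRatio g (h i) q.1 q.2 : ℝ) : ℂ) * Complex.I)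
        ∂(pairMeasure g) := by
  have := hg.isProbabilityMeasure_pairMeasure
  rw [charFun_apply_real, integral_map (hg.measurable_totalRatio alg h).aemeasurable
    (Measurable.aestronglyMeasurable (by fun_prop)), ← integral_fintype_prod_eq_prod
    (f := fun i (q : ℝ × ℝ) => Complex.exp (((t * alg.logRatio g (h i) q.1 q.2 : ℝ) : ℂ) *
      Complex.I))]
  refine integral_congr_ae (ae_of_all _ fun ξ => ?_)
  simp only
  rw [← Complex.exp_sum, ← Finset.sum_mul, Algorithm.totalRatio]
  push_cast
  rw [Finset.mul_sum]

/-- The central limit theorem for the log acceptance ratio. -/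
theorem Regular.tendsto_integral_totalRatio {g : ℝ → ℝ} (hg : Regular g) (alg : Algorithm)
    {h : (n : ℕ) → Fin n → ℝ} {H : ℕ → ℝ} (hH : Tendsto H atTop (𝓝 0))
    (h0 : ∀ᶠ n in atTop, ∀ i, 0 < h n i ∧ h n i ≤ H n) {S s : ℝ}
    (hS : Tendsto (fun n => ∑ i, h n i ^ (2 * alg.order)) atTop (𝓝 S)) (hs : alg.K g * S = s ^ 2) :
    Tendsto (fun n => ∫ ξ, cutExp (alg.totalRatio g (h n) ξ) ∂(productLaw g n)) atTop
      (𝓝 (∫ x, cutExp x ∂(gaussianReal (-(s ^ 2 / 2)) (NNReal.mk (s ^ 2) (sq_nonneg s))))) := by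
  have := hg.isProbabilityMeasure_pairMeasure
  have hP := hg.isProbabilityMeasure_productLaw
  have hm (n) := (hg.measurable_totalRatio alg (h n)).aemeasurable (μ := productLaw g n)
  let ν : ℕ → ProbabilityMeasure ℝ := fun n =>
    ⟨(productLaw g n).map (alg.totalRatio g (h n)), Measure.isProbabilityMeasure_map (hm n)⟩
  let ν₀ : ProbabilityMeasure ℝ :=
    ⟨gaussianReal (-(s ^ 2 / 2)) (NNReal.mk (s ^ 2) (sq_nonneg s)), inferInstance⟩
  have hchar : ∀ t : ℝ, Tendsto (fun n => charFun (ν n : Measure ℝ) t) atTop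
      (𝓝 (charFun (ν₀ : Measure ℝ) t)) := fun t => by
    -- The exponent w has real part -K t²/2 ≤ 0, as required to keep the comparison factors in the
    -- unit disc.
    have hlim := tendsto_prod_of_expansion (c := fun h => ∫ q, Complex.exp
      (((t * alg.logRatio g h q.1 q.2 : ℝ) : ℂ) * Complex.I) ∂(pairMeasure g))
      (k := 2 * alg.order) (by have := alg.order_pos; omega)
      (w := alg.K g • (-((t : ℂ) ^ 2 + t * Complex.I) / 2)) (by
        have hK := hg.K_pos alg
        rw [Complex.real_smul, Complex.re_ofReal_mul]
        refine mul_nonpos_of_nonneg_of_nonpos hK.le ?_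
        have : (-((t : ℂ) ^ 2 + t * Complex.I) / 2).re = -(t ^ 2) / 2 := by
          rw [show (-((t : ℂ) ^ 2 + t * Complex.I) / 2) =
            ((-(t ^ 2) / 2 : ℝ) : ℂ) + ((-t / 2 : ℝ) : ℂ) * Complex.I by push_cast; ring]
          simp [-Complex.ofReal_div, -Complex.ofReal_neg, -Complex.ofReal_pow]
        rw [this]
        nlinarith [sq_nonneg t])
      (fun h => by
        refine (norm_integral_le_of_norm_le_const (C := 1) (ae_of_all _ fun q => ?_)).trans ?_
        · rw [Complex.norm_exp_ofReal_mul_I]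
        · simp)
      (hg.tendsto_charFun_logRatio alg t) hH h0 hS
    have e1 : (fun n => charFun (ν n : Measure ℝ) t) = fun n => ∏ i, ∫ q, Complex.exp
        (((t * alg.logRatio g (h n i) q.1 q.2 : ℝ) : ℂ) * Complex.I) ∂(pairMeasure g) :=
      funext fun n => hg.charFun_totalRatio alg (h n) t
    -- The relation between mean and variance comes out of w: S w = -(s²/2)(t² + it) is the exponent
    -- of a normal law with variance s² and mean -s²/2.
    have e2 : charFun (ν₀ : Measure ℝ) t =
        Complex.exp (S * alg.K g • (-((t : ℂ) ^ 2 + t * Complex.I) / 2)) := by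
      change charFun (gaussianReal _ _) t = _
      rw [charFun_gaussianReal, Complex.real_smul]
      congr 1
      have : (alg.K g : ℂ) * S = (s : ℂ) ^ 2 := by exact_mod_cast hs
      simp only [NNReal.coe_mk]
      push_cast
      linear_combination (((t : ℂ) ^ 2 + t * Complex.I) / 2) * this
    rw [e1, e2]
    exact hlim
  have hconv := ProbabilityMeasure.tendsto_of_tendsto_charFun hchar
  rw [ProbabilityMeasure.tendsto_iff_forall_integral_tendsto] at hconv
  have := hconv (BoundedContinuousFunction.ofNormedAddCommGroup cutExp continuous_cutExp 1
    fun r => by rw [Real.norm_of_nonneg (cutExp_nonneg r)]; exact cutExp_le_one r)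
  refine this.congr fun n => ?_
  exact integral_map (hm n) continuous_cutExp.aestronglyMeasurable

/-- With x = -s²/2 + s z the exponent is nonpositive for z ≤ s/2 and nonnegative beyond. On the left
e^x shifts the standard normal density to mean s, on the right the integrand is 1, and each half has
mass Φ(-s/2). -/
theorem integral_cutExp_gaussianReal {s : ℝ} (hs : 0 ≤ s) :
    ∫ x, cutExp x ∂(gaussianReal (-(s ^ 2 / 2)) (NNReal.mk (s ^ 2) (sq_nonneg s))) =
      2 * cdf (gaussianReal 0 1) (-(s / 2)) := by
  have hmap : gaussianReal (-(s ^ 2 / 2)) (NNReal.mk (s ^ 2) (sq_nonneg s)) =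
      (gaussianReal 0 1).map (fun z => -(s ^ 2 / 2) + s * z) := by
    have e : (fun z : ℝ => -(s ^ 2 / 2) + s * z) =
        (fun z => -(s ^ 2 / 2) + z) ∘ (fun z => s * z) := rfl
    rw [e, ← Measure.map_map (by fun_prop) (by fun_prop), gaussianReal_map_const_mul,
      gaussianReal_map_const_add]
    simp
  rw [hmap, integral_map (by fun_prop) continuous_cutExp.aestronglyMeasurable]
  have hb : Integrable (fun z => cutExp (-(s ^ 2 / 2) + s * z)) (gaussianReal 0 1) :=
    Integrable.of_bound (continuous_cutExp.comp (by fun_prop)).aestronglyMeasurable 1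
      (ae_of_all _ fun z => by rw [Real.norm_of_nonneg (cutExp_nonneg _)]; exact cutExp_le_one _)
  have hms : MeasurableSet (Set.Iic (s / 2)) := measurableSet_Iic
  have hsq : ∀ z : ℝ, gaussianPDFReal 0 1 z * Real.exp (-(s ^ 2 / 2) + s * z) =
      gaussianPDFReal s 1 z := fun z => by
    simp only [gaussianPDFReal]
    rw [mul_assoc, ← Real.exp_add]
    congr 2
    simp
    ring
  rw [← integral_add_compl hms hb, Set.compl_Iic]
  have h1 : ∫ z in Set.Iic (s / 2), cutExp (-(s ^ 2 / 2) + s * z) ∂(gaussianReal 0 1) =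
      (gaussianReal s 1).real (Set.Iic (s / 2)) := by
    calc _ = ∫ z in Set.Iic (s / 2), Real.exp (-(s ^ 2 / 2) + s * z) ∂(gaussianReal 0 1) := by
          refine setIntegral_congr_fun hms fun z hz => ?_
          refine min_eq_right (Real.exp_le_one_iff.2 ?_)
          have : z ≤ s / 2 := hz
          nlinarith
      _ = ∫ z in Set.Iic (s / 2), gaussianPDFReal s 1 z := by
          rw [← integral_indicator hms, integral_gaussianReal_eq_integral_smul one_ne_zero,
            ← integral_indicator hms]
          congr 1
          ext z
          by_cases hz : z ∈ Set.Iic (s / 2)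
          · simp only [Set.indicator_of_mem hz, smul_eq_mul, hsq]
          · simp only [Set.indicator_of_notMem hz, smul_zero]
      _ = _ := by
          rw [Measure.real, gaussianReal_apply_eq_integral _ one_ne_zero, ENNReal.toReal_ofReal]
          exact integral_nonneg fun z => gaussianPDFReal_nonneg _ _ _
  have h2 : ∫ z in Set.Ioi (s / 2), cutExp (-(s ^ 2 / 2) + s * z) ∂(gaussianReal 0 1) =
      (gaussianReal 0 1).real (Set.Ioi (s / 2)) := by
    rw [setIntegral_congr_fun (g := fun _ => (1 : ℝ)) measurableSet_Ioi fun z hz => ?_]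
    · simp
    · refine min_eq_left (Real.one_le_exp ?_)
      have : s / 2 < z := hz
      nlinarith
  have e1 : (gaussianReal s 1).real (Set.Iic (s / 2)) =
      (gaussianReal 0 1).real (Set.Iic (-(s / 2))) := by
    have : gaussianReal s 1 = (gaussianReal 0 1).map (fun z => s + z) := by
      rw [gaussianReal_map_const_add]; simp
    rw [this, map_measureReal_apply (by fun_prop) hms]
    congr 1
    ext z
    simp only [Set.mem_preimage, Set.mem_Iic]
    constructor <;> intro h <;> linarith
  have e2 : (gaussianReal 0 1).real (Set.Ioi (s / 2)) =
      (gaussianReal 0 1).real (Set.Iic (-(s / 2))) := by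
    have hneg : (gaussianReal 0 1).map (fun z : ℝ => -z) = gaussianReal 0 1 := by
      rw [gaussianReal_map_neg]; simp
    have : NullSingletonClass (gaussianReal 0 1) := nullSingletonClass_gaussianReal one_ne_zero
    rw [← measureReal_congr (Iio_ae_eq_Iic (μ := gaussianReal 0 1) (a := -(s / 2)))]
    conv_rhs => rw [← hneg, map_measureReal_apply (by fun_prop) measurableSet_Iio]
    congr 1
    ext z
    simp
  rw [h1, h2, e1, e2, cdf_eq_real]
  ring

/-! ### The state, the noise and the proposal under the product law -/

/-- Checked on boxes, where the indicator is a product and the integral factors. -/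
theorem pi_withDensity_ofReal {n : ℕ} {f : Fin n → ℝ → ℝ} (h0 : ∀ i x, 0 ≤ f i x)
    (hi : ∀ i, Integrable (f i)) :
    Measure.pi (fun i => (volume : Measure ℝ).withDensity fun x => ENNReal.ofReal (f i x)) =
      (volume : Measure (Fin n → ℝ)).withDensity fun x => ENNReal.ofReal (∏ i, f i (x i)) := by
  have hfin (i) : IsFiniteMeasure
      ((volume : Measure ℝ).withDensity fun x => ENNReal.ofReal (f i x)) :=
    isFiniteMeasure_withDensity_ofReal (hi i).2
  refine Measure.pi_eq fun s hs => ?_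
  rw [withDensity_apply _ (MeasurableSet.univ_pi hs), ← lintegral_indicator
    (MeasurableSet.univ_pi hs)]
  have e1 : (Set.univ.pi s).indicator (fun x : Fin n → ℝ => ENNReal.ofReal (∏ i, f i (x i))) =
      fun x => ENNReal.ofReal (∏ i, (s i).indicator (f i) (x i)) := by
    ext x
    by_cases hx : x ∈ Set.univ.pi s
    · rw [Set.indicator_of_mem hx]
      congr 1
      exact Finset.prod_congr rfl fun i _ => (Set.indicator_of_mem (hx i trivial) _).symm
    · rw [Set.indicator_of_notMem hx]
      have : ∃ i, x i ∉ s i := by simpa [Set.mem_pi] using hx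
      obtain ⟨i, hxi⟩ := this
      rw [Finset.prod_eq_zero (Finset.mem_univ i) (Set.indicator_of_notMem hxi _),
        ENNReal.ofReal_zero]
  have hn (i) (x : ℝ) : 0 ≤ (s i).indicator (f i) x := Set.indicator_nonneg (fun x _ => h0 i x) x
  have hii (i) : Integrable ((s i).indicator (f i)) := (hi i).indicator (hs i)
  have hint : Integrable fun x : Fin n → ℝ => ∏ i, (s i).indicator (f i) (x i) :=
    Integrable.fintype_prod (μ := fun _ => volume) hii
  rw [e1, ← ofReal_integral_eq_lintegral_ofReal hint
    (ae_of_all _ fun x => Finset.prod_nonneg fun i _ => hn i (x i)),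
    integral_fintype_prod_volume_eq_prod, ENNReal.ofReal_prod_of_nonneg
    fun i _ => integral_nonneg (hn i)]
  refine Finset.prod_congr rfl fun i _ => ?_
  rw [withDensity_apply _ (hs i), ← lintegral_indicator (hs i),
    ofReal_integral_eq_lintegral_ofReal (hii i) (ae_of_all _ (hn i))]
  congr 1
  ext x
  by_cases hx : x ∈ s i <;> simp [hx]

theorem Regular.map_baseMeasure {g : ℝ → ℝ} (hg : Regular g) {a : ℝ} (ha : 0 < a) :
    (baseMeasure g).map (fun x => a * x) =
      volume.withDensity fun x => ENNReal.ofReal (1 / a * Real.exp (-g (x / a))) := by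
  have hc := hg.continuous
  have hm : Measurable fun x => ENNReal.ofReal (Real.exp (-g x)) := by fun_prop
  have hm2 : Measurable fun x => ENNReal.ofReal (1 / a * Real.exp (-g (x / a))) := by fun_prop
  refine Measure.ext_of_lintegral _ fun G hG => ?_
  rw [lintegral_map hG (by fun_prop), baseMeasure,
    lintegral_withDensity_eq_lintegral_mul _ hm (by fun_prop),
    lintegral_withDensity_eq_lintegral_mul _ hm2 hG]
  conv_rhs => rw [← Real.smul_map_volume_mul_left ha.ne']
  rw [lintegral_smul_measure, lintegral_map (by fun_prop) (by fun_prop), smul_eq_mul,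
    ← lintegral_const_mul _ (by fun_prop)]
  refine lintegral_congr fun x => ?_
  simp only [Pi.mul_apply]
  rw [← mul_assoc, ← ENNReal.ofReal_mul (abs_nonneg a), abs_of_pos ha,
    mul_div_cancel_left₀ _ ha.ne', ← mul_assoc, mul_one_div_cancel ha.ne', one_mul]

theorem Regular.integrable_scaled {g : ℝ → ℝ} (hg : Regular g) {a : ℝ} (ha : 0 < a) :
    Integrable fun x => 1 / a * Real.exp (-g (x / a)) :=
  (hg.integrable_exp_neg.comp_div ha.ne').const_mul _

theorem Regular.refMeasure_eq {g : ℝ → ℝ} (hg : Regular g) {n : ℕ} {lam : Fin n → ℝ}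
    (hl : ∀ i, 0 < lam i) :
    refMeasure g lam = (Measure.pi fun _ : Fin n => baseMeasure g).map
      fun x i => lam i * x i := by
  have := hg.isProbabilityMeasure_baseMeasure
  have hpm (i : Fin n) : IsProbabilityMeasure ((baseMeasure g).map fun x => lam i * x) :=
    Measure.isProbabilityMeasure_map (by fun_prop)
  rw [Measure.pi_map_pi (μ := fun _ : Fin n => baseMeasure g) (f := fun i x => lam i * x)
    (fun i => by fun_prop)]
  rw [funext fun i => hg.map_baseMeasure (hl i), pi_withDensity_ofReal (f := fun i x => 1 / lam i * Real.exp (-g (x / lam i)))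
    (fun i x => by have := hl i; positivity) (fun i => hg.integrable_scaled (hl i))]
  rfl

theorem isProbabilityMeasure_stdGauss (n : ℕ) : IsProbabilityMeasure (stdGauss n) := by
  unfold stdGauss
  infer_instance

/-- The state, in terms of its rescaled coordinates. -/
def scaledState {n : ℕ} (lam : Fin n → ℝ) (ξ : Fin n → ℝ × ℝ) : Fin n → ℝ :=
  fun i => lam i * (ξ i).1

/-- The noise. -/
def noise {n : ℕ} (ξ : Fin n → ℝ × ℝ) : Fin n → ℝ := fun i => (ξ i).2

/-- The proposal, in terms of rescaled coordinates. -/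
def Algorithm.scaledProposal (alg : Algorithm) (g : ℝ → ℝ) {n : ℕ} (lam : Fin n → ℝ) (σ : ℝ)
    (ξ : Fin n → ℝ × ℝ) : Fin n → ℝ :=
  fun i => lam i * alg.step g (σ / lam i) (ξ i).1 (ξ i).2

theorem measurable_scaledState {n : ℕ} (lam : Fin n → ℝ) : Measurable (scaledState lam) := by
  unfold scaledState; fun_prop

theorem measurable_noise {n : ℕ} : Measurable (noise (n := n)) := by
  unfold noise; fun_prop

theorem Regular.measurable_scaledProposal {g : ℝ → ℝ} (hg : Regular g) (alg : Algorithm) {n : ℕ}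
    (lam : Fin n → ℝ) (σ : ℝ) : Measurable (alg.scaledProposal g lam σ) :=
  measurable_pi_lambda _ fun i =>
    ((hg.measurable_step alg (σ / lam i)).comp (measurable_pi_apply i)).const_mul _

/-- This moves every expectation over state and noise to a space of i.i.d. pairs, where independence
of the coordinates is immediate. -/
theorem Regular.map_productLaw {g : ℝ → ℝ} (hg : Regular g) {n : ℕ} {lam : Fin n → ℝ}
    (hl : ∀ i, 0 < lam i) :
    (productLaw g n).map (fun ξ => (scaledState lam ξ, noise ξ)) =
      (refMeasure g lam).prod (stdGauss n) := by
  have := hg.isProbabilityMeasure_baseMeasure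
  have := isProbabilityMeasure_stdGauss n
  have hmp := measurePreserving_arrowProdEquivProdArrow ℝ ℝ (Fin n) (fun _ => baseMeasure g)
    (fun _ => gaussianReal 0 1)
  have hsc : Measurable fun (x : Fin n → ℝ) i => lam i * x i := by fun_prop
  have h1 := Measure.map_prod_map (Measure.pi fun _ : Fin n => baseMeasure g) (stdGauss n) hsc
    measurable_id
  rw [Measure.map_id, ← hg.refMeasure_eq hl] at h1
  rw [h1, stdGauss, ← hmp.map_eq, Measure.map_map (hsc.prodMap measurable_id) hmp.measurable]
  rfl

/-! ### Proposal and acceptance probability in rescaled coordinates -/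

theorem Regular.fderiv_log_refDensity {g : ℝ → ℝ} (hg : Regular g) {n : ℕ} {lam : Fin n → ℝ}
    (hl : ∀ i, 0 < lam i) (x : Fin n → ℝ) (i : Fin n) :
    fderiv ℝ (fun w => Real.log (refDensity g lam w)) x (Pi.single i 1) =
      -(deriv g (x i / lam i) / lam i) := by
  have e : (fun w => Real.log (refDensity g lam w)) =
      fun w : Fin n → ℝ => ∑ j, (Real.log (1 / lam j) + -g (w j / lam j)) := by
    ext w
    rw [refDensity, Real.log_prod fun j _ => by have := hl j; positivity]
    refine Finset.sum_congr rfl fun j _ => ?_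
    have := hl j
    rw [Real.log_mul (by positivity) (by positivity), Real.log_exp]
  have hd (j) : HasFDerivAt (fun w : Fin n → ℝ => Real.log (1 / lam j) + -g (w j / lam j))
      (-((deriv g (x j / lam j) / lam j) • ContinuousLinearMap.proj (R := ℝ) j)) x := by
    have h1 : HasDerivAt (fun t => g (t / lam j)) (deriv g (x j / lam j) / lam j) (x j) := by
      have := (hg.hasDerivAt (x j / lam j)).comp (x j) ((hasDerivAt_id (x j)).div_const (lam j))
      convert! this using 1
      ring
    have h2 : HasFDerivAt (fun w : Fin n → ℝ => w j) (ContinuousLinearMap.proj (R := ℝ) j) x :=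
      (ContinuousLinearMap.proj (R := ℝ) (φ := fun _ : Fin n => ℝ) j).hasFDerivAt
    exact (h1.comp_hasFDerivAt x h2).neg.const_add _
  rw [e, (HasFDerivAt.fun_sum fun j _ => hd j).fderiv]
  simp [Pi.single_apply]

theorem Regular.proposalMean_apply {g : ℝ → ℝ} (hg : Regular g) (alg : Algorithm) {n : ℕ}
    {lam : Fin n → ℝ} (hl : ∀ i, 0 < lam i) (σ : ℝ) (x : Fin n → ℝ) (i : Fin n) :
    proposalMean alg g lam σ x i = lam i * alg.step g (σ / lam i) (x i / lam i) 0 := by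
  have := (hl i).ne'
  cases alg with
  | rwm =>
    simp only [proposalMean, Algorithm.step]
    field_simp
    ring
  | sla =>
    simp only [proposalMean, Algorithm.step, hg.fderiv_log_refDensity hl]
    field_simp
    ring

theorem Regular.proposal_apply {g : ℝ → ℝ} (hg : Regular g) (alg : Algorithm) {n : ℕ}
    {lam : Fin n → ℝ} (hl : ∀ i, 0 < lam i) (σ : ℝ) (x z : Fin n → ℝ) (i : Fin n) :
    proposal alg g lam σ x z i = lam i * alg.step g (σ / lam i) (x i / lam i) (z i) := by
  have := (hl i).ne'
  rw [proposal, hg.proposalMean_apply alg hl, alg.step_eq g _ _ (z i)]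
  field_simp

theorem Regular.proposal_scaledState {g : ℝ → ℝ} (hg : Regular g) (alg : Algorithm) {n : ℕ}
    {lam : Fin n → ℝ} (hl : ∀ i, 0 < lam i) (σ : ℝ) (ξ : Fin n → ℝ × ℝ) :
    proposal alg g lam σ (scaledState lam ξ) (noise ξ) = alg.scaledProposal g lam σ ξ := by
  ext i
  rw [hg.proposal_apply alg hl, Algorithm.scaledProposal, scaledState,
    mul_div_cancel_left₀ _ (hl i).ne', noise]

theorem Regular.measurable_proposal {g : ℝ → ℝ} (hg : Regular g) (alg : Algorithm) {n : ℕ}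
    {lam : Fin n → ℝ} (hl : ∀ i, 0 < lam i) (σ : ℝ) :
    Measurable fun v : (Fin n → ℝ) × (Fin n → ℝ) => proposal alg g lam σ v.1 v.2 := by
  refine measurable_pi_lambda _ fun i => ?_
  simp only [hg.proposal_apply alg hl]
  exact ((hg.measurable_step alg (σ / lam i)).comp
    (f := fun v : (Fin n → ℝ) × (Fin n → ℝ) => (v.1 i / lam i, v.2 i)) (by fun_prop)).const_mul _

/-- The prefactor does not depend on x or y, so it cancels in the acceptance ratio, and only the
one-coordinate detailed balance remains. -/
theorem Algorithm.exp_mul_gaussianPDFReal (alg : Algorithm) (g : ℝ → ℝ) {a σ : ℝ} (ha : 0 < a)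
    (hσ : 0 < σ) (x y : ℝ) :
    Real.exp (-g (x / a)) * gaussianPDFReal (a * alg.step g (σ / a) (x / a) 0)
        ⟨σ ^ 2, sq_nonneg σ⟩ y =
      (√(2 * Real.pi * σ ^ 2))⁻¹ * √(2 * Real.pi * (σ / a) ^ 2) *
        alg.pairDensity g (σ / a) (x / a) (y / a) := by
  have hne : √(2 * Real.pi * (σ / a) ^ 2) ≠ 0 := by positivity
  have h1 := gaussianPDFReal_sq (a * alg.step g (σ / a) (x / a) 0) σ y
  have h2 := gaussianPDFReal_sq (alg.step g (σ / a) (x / a) 0) (σ / a) (y / a)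
  rw [Algorithm.pairDensity]
  change _ * gaussianPDFReal _ (NNReal.mk (σ ^ 2) (sq_nonneg σ)) y = _
  rw [h1, h2]
  have h3 : -(y - a * alg.step g (σ / a) (x / a) 0) ^ 2 / (2 * σ ^ 2) =
      -(y / a - alg.step g (σ / a) (x / a) 0) ^ 2 / (2 * (σ / a) ^ 2) := by
    field_simp
  rw [h3]
  field_simp

/-- The acceptance probability in terms of the log acceptance ratio of the product law. -/
theorem Regular.accept_eq {g : ℝ → ℝ} (hg : Regular g) (alg : Algorithm) {n : ℕ}
    {lam : Fin n → ℝ} (hl : ∀ i, 0 < lam i) {σ : ℝ} (hσ : 0 < σ) (φ : (Fin n → ℝ) → ℝ)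
    (x y : Fin n → ℝ) :
    accept alg g lam φ σ x y =
      cutExp (∑ i, alg.pairRatio g (σ / lam i) (x i / lam i) (y i / lam i) + φ x - φ y) := by
  have hq (x y : Fin n → ℝ) : refDensity g lam x * proposalDensity alg g lam σ x y =
      ∏ i, (1 / lam i * ((√(2 * Real.pi * σ ^ 2))⁻¹ * √(2 * Real.pi * (σ / lam i) ^ 2)) *
        alg.pairDensity g (σ / lam i) (x i / lam i) (y i / lam i)) := by
    rw [refDensity, proposalDensity, ← Finset.prod_mul_distrib]
    refine Finset.prod_congr rfl fun i _ => ?_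
    rw [hg.proposalMean_apply alg hl, mul_assoc, alg.exp_mul_gaussianPDFReal g (hl i) hσ]
    ring
  have hpos (i) (s t : ℝ) : 0 < alg.pairDensity g (σ / lam i) s t := by
    have := hl i
    refine mul_pos (Real.exp_pos _) ?_
    rw [gaussianPDFReal_sq]
    positivity
  have hqpos (x y : Fin n → ℝ) : 0 < refDensity g lam x * proposalDensity alg g lam σ x y := by
    rw [hq]
    refine Finset.prod_pos fun i _ => ?_
    have := hl i
    have := hpos i (x i / lam i) (y i / lam i)
    positivity
  have hswap : refDensity g lam y * proposalDensity alg g lam σ y x =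
      refDensity g lam x * proposalDensity alg g lam σ x y *
        Real.exp (∑ i, alg.pairRatio g (σ / lam i) (x i / lam i) (y i / lam i)) := by
    rw [hq, hq, Real.exp_sum, ← Finset.prod_mul_distrib]
    refine Finset.prod_congr rfl fun i _ => ?_
    rw [mul_assoc (1 / lam i * _), alg.pairDensity_mul_exp g (div_pos hσ (hl i)).ne']
  -- The denominator is positive everywhere, so the default value 0 of the acceptance probability
  -- never occurs.
  have hpos1 : 0 < targetDensity g lam φ x * proposalDensity alg g lam σ x y := by
    rw [targetDensity, mul_assoc]
    exact mul_pos (Real.exp_pos _) (hqpos x y)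
  rw [accept, if_pos hpos1, cutExp]
  congr 1
  rw [div_eq_iff hpos1.ne', targetDensity, targetDensity, mul_assoc, hswap, mul_assoc,
    sub_eq_add_neg, Real.exp_add, Real.exp_add]
  have : Real.exp (φ x) * Real.exp (-φ x) = 1 := by rw [← Real.exp_add]; simp
  linear_combination (-(Real.exp (-φ y) * (refDensity g lam x * proposalDensity alg g lam σ x y) *
    Real.exp (∑ i, alg.pairRatio g (σ / lam i) (x i / lam i) (y i / lam i)))) * this

theorem Regular.accept_scaled {g : ℝ → ℝ} (hg : Regular g) (alg : Algorithm) {n : ℕ}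
    {lam : Fin n → ℝ} (hl : ∀ i, 0 < lam i) {σ : ℝ} (hσ : 0 < σ) (φ : (Fin n → ℝ) → ℝ)
    (ξ : Fin n → ℝ × ℝ) :
    accept alg g lam φ σ (scaledState lam ξ)
        (proposal alg g lam σ (scaledState lam ξ) (noise ξ)) =
      cutExp (alg.totalRatio g (fun i => σ / lam i) ξ + φ (scaledState lam ξ) -
        φ (alg.scaledProposal g lam σ ξ)) := by
  rw [hg.accept_eq alg hl hσ, hg.proposal_scaledState alg hl]
  congr 3
  refine Finset.sum_congr rfl fun i _ => ?_
  rw [alg.logRatio_eq_pairRatio, scaledState, Algorithm.scaledProposal,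
    mul_div_cancel_left₀ _ (hl i).ne', mul_div_cancel_left₀ _ (hl i).ne']

theorem Regular.measurable_accept {g : ℝ → ℝ} (hg : Regular g) (alg : Algorithm) {n : ℕ}
    {lam : Fin n → ℝ} (hl : ∀ i, 0 < lam i) {σ : ℝ} (hσ : 0 < σ) {φ : (Fin n → ℝ) → ℝ}
    (hφ : Measurable φ) :
    Measurable fun v : (Fin n → ℝ) × (Fin n → ℝ) =>
      accept alg g lam φ σ v.1 (proposal alg g lam σ v.1 v.2) := by
  have hp := hg.measurable_proposal alg hl σ
  have hpm (h : ℝ) : Measurable fun p : ℝ × ℝ => alg.pairRatio g h p.1 p.2 := by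
    have := hg.continuous_deriv
    have := hg.continuous
    cases alg <;> simp only [Algorithm.pairRatio] <;> fun_prop
  simp only [hg.accept_eq alg hl hσ]
  refine continuous_cutExp.measurable.comp ((Measurable.add ?_ (hφ.comp measurable_fst)).sub
    (hφ.comp hp))
  refine Finset.measurable_fun_sum _ fun i _ => ?_
  refine (hpm _).comp (Measurable.prodMk (by fun_prop) ?_)
  exact ((measurable_pi_apply i).comp hp).div_const _

/-- The law of the proposal has a density. -/
theorem Regular.ae_scaledProposal {g : ℝ → ℝ} (hg : Regular g) (alg : Algorithm) {n : ℕ}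
    {lam : Fin n → ℝ} (hl : ∀ i, 0 < lam i) {σ : ℝ} (hσ : 0 < σ) {p : (Fin n → ℝ) → Prop}
    (h : ∀ᵐ x ∂(refMeasure g lam), p x) :
    ∀ᵐ ξ ∂(productLaw g n), p (scaledState lam ξ) ∧ p (alg.scaledProposal g lam σ ξ) := by
  have hmap := hg.map_productLaw hl
  have hmm : Measurable fun ξ : Fin n → ℝ × ℝ => (scaledState lam ξ, noise ξ) :=
    (measurable_scaledState lam).prodMk measurable_noise
  have := isProbabilityMeasure_stdGauss n
  have hsf : SFinite (refMeasure g lam) := by unfold refMeasure; infer_instance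
  -- The reference density is strictly positive, so a null set of the reference law is also Lebesgue
  -- null.
  have hvol : (volume : Measure (Fin n → ℝ)) ≪ refMeasure g lam := by
    refine withDensity_absolutelyContinuous' ?_ (ae_of_all _ fun x => ?_)
    · have := hg.continuous
      have : Measurable fun x : Fin n → ℝ => refDensity g lam x := by
        unfold refDensity
        exact Finset.measurable_fun_prod _ fun i _ => by fun_prop
      exact this.ennreal_ofReal.aemeasurable
    · rw [ne_eq, ENNReal.ofReal_eq_zero, not_le]
      exact Finset.prod_pos fun i _ => by have := hl i; positivity
  have hgauss : stdGauss n ≪ (volume : Measure (Fin n → ℝ)) := by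
    have : stdGauss n = (volume : Measure (Fin n → ℝ)).withDensity
        fun x => ENNReal.ofReal (∏ i, gaussianPDFReal 0 1 (x i)) := by
      rw [← pi_withDensity_ofReal (f := fun _ => gaussianPDFReal 0 1)
        (fun _ x => gaussianPDFReal_nonneg _ _ _) (fun _ => integrable_gaussianPDFReal _ _),
        stdGauss, gaussianReal_of_var_ne_zero _ one_ne_zero]
      rfl
    rw [this]
    exact withDensity_absolutelyContinuous _ _
  obtain ⟨N, hpN, hNm, hN0⟩ := exists_measurable_superset_of_null (ae_iff.1 h)
  have h1 : ∀ᵐ v ∂((refMeasure g lam).prod (stdGauss n)), p v.1 :=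
    Measure.quasiMeasurePreserving_fst.ae h
  have h2 : ∀ᵐ v ∂((refMeasure g lam).prod (stdGauss n)), proposal alg g lam σ v.1 v.2 ∉ N := by
    rw [ae_iff]
    simp only [not_not]
    -- For each fixed x the proposal is an invertible affine function of the noise, so the preimage
    -- of a Lebesgue null set is Lebesgue null, hence Gaussian null. A measurable superset of the
    -- exceptional set is needed for this Fubini argument.
    refine Measure.measure_prod_null_of_ae_null (hg.measurable_proposal alg hl σ hNm)
      (ae_of_all _ fun x => hgauss ?_)
    have hvN : (volume : Measure (Fin n → ℝ)) N = 0 := hvol hN0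
    have e : Prod.mk x ⁻¹' {v : (Fin n → ℝ) × (Fin n → ℝ) | proposal alg g lam σ v.1 v.2 ∈ N} =
        (σ • ·) ⁻¹' ((proposalMean alg g lam σ x + ·) ⁻¹' N) := rfl
    have e2 := Measure.addHaar_preimage_smul (volume : Measure (Fin n → ℝ)) hσ.ne'
      ((proposalMean alg g lam σ x + ·) ⁻¹' N)
    rw [measure_preimage_add, hvN, mul_zero] at e2
    exact e2
  have h3 := h1.and h2
  rw [← hmap] at h3
  filter_upwards [ae_of_ae_map hmm.aemeasurable h3] with ξ hξ
  refine ⟨hξ.1, ?_⟩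
  by_contra hc
  refine hξ.2 (hpN ?_)
  change ¬p _
  rwa [hg.proposal_scaledState alg hl]

/-! ### Expectations under the target law -/

theorem withDensity_map_eq {α β : Type*} [MeasurableSpace α] [MeasurableSpace β] {μ : Measure α}
    {f : α → β} (hf : Measurable f) {w : β → ENNReal} (hw : Measurable w) :
    (μ.map f).withDensity w = (μ.withDensity (w ∘ f)).map f := by
  refine Measure.ext_of_lintegral _ fun G hG => ?_
  rw [lintegral_withDensity_eq_lintegral_mul _ hw hG, lintegral_map (hw.mul hG) hf,
    lintegral_map hG hf]
  exact (lintegral_withDensity_eq_lintegral_mul _ (hw.comp hf) (hG.comp hf)).symm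

theorem Regular.target_prod_eq {g : ℝ → ℝ} (hg : Regular g) {n : ℕ} {lam : Fin n → ℝ}
    (hl : ∀ i, 0 < lam i) {φ : (Fin n → ℝ) → ℝ} (hφ : Measurable φ) :
    (target g lam φ).prod (stdGauss n) =
      ((productLaw g n).withDensity
        fun ξ => ENNReal.ofReal (Real.exp (-φ (scaledState lam ξ)))).map
        fun ξ => (scaledState lam ξ, noise ξ) := by
  have := isProbabilityMeasure_stdGauss n
  have hsf : SFinite (refMeasure g lam) := by unfold refMeasure; infer_instance
  have hw : Measurable fun x : Fin n → ℝ => ENNReal.ofReal (Real.exp (-φ x)) := by fun_prop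
  rw [target, prod_withDensity_left hw, ← hg.map_productLaw hl]
  exact withDensity_map_eq ((measurable_scaledState lam).prodMk measurable_noise)
    (hw.comp measurable_fst)

theorem Regular.integral_target_prod {g : ℝ → ℝ} (hg : Regular g) {n : ℕ} {lam : Fin n → ℝ}
    (hl : ∀ i, 0 < lam i) {φ : (Fin n → ℝ) → ℝ} (hφ : Measurable φ)
    {F : (Fin n → ℝ) × (Fin n → ℝ) → ℝ} (hF : Measurable F) :
    ∫ v, F v ∂((target g lam φ).prod (stdGauss n)) =
      ∫ ξ, Real.exp (-φ (scaledState lam ξ)) * F (scaledState lam ξ, noise ξ)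
        ∂(productLaw g n) := by
  have hs := measurable_scaledState lam
  have hw : Measurable fun ξ => ENNReal.ofReal (Real.exp (-φ (scaledState lam ξ))) := by fun_prop
  rw [hg.target_prod_eq hl hφ, integral_map (hs.prodMk measurable_noise).aemeasurable
    hF.aestronglyMeasurable, integral_withDensity_eq_integral_toReal_smul hw (by simp)]
  simp [ENNReal.toReal_ofReal (Real.exp_pos _).le]

theorem Regular.integrable_target_prod_iff {g : ℝ → ℝ} (hg : Regular g) {n : ℕ} {lam : Fin n → ℝ}
    (hl : ∀ i, 0 < lam i) {φ : (Fin n → ℝ) → ℝ} (hφ : Measurable φ)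
    {F : (Fin n → ℝ) × (Fin n → ℝ) → ℝ} (hF : Measurable F) :
    Integrable F ((target g lam φ).prod (stdGauss n)) ↔
      Integrable (fun ξ => F (scaledState lam ξ, noise ξ) *
        Real.exp (-φ (scaledState lam ξ))) (productLaw g n) := by
  have hs := measurable_scaledState lam
  have hw : Measurable fun ξ => ENNReal.ofReal (Real.exp (-φ (scaledState lam ξ))) := by fun_prop
  rw [hg.target_prod_eq hl hφ, integrable_map_measure hF.aestronglyMeasurable
    (hs.prodMk measurable_noise).aemeasurable, integrable_withDensity_iff hw (by simp)]
  simp [ENNReal.toReal_ofReal (Real.exp_pos _).le]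

/-- The acceptance probability of the step described by `ξ`. -/
def Algorithm.acceptScaled (alg : Algorithm) (g : ℝ → ℝ) {n : ℕ} (lam : Fin n → ℝ)
    (ψ : (Fin n → ℝ) → ℝ) (σ : ℝ) (ξ : Fin n → ℝ × ℝ) : ℝ :=
  cutExp (alg.totalRatio g (fun i => σ / lam i) ξ + ψ (scaledState lam ξ) -
    ψ (alg.scaledProposal g lam σ ξ))

theorem Regular.meanAccept_eq {g : ℝ → ℝ} (hg : Regular g) (alg : Algorithm) {n : ℕ}
    {lam : Fin n → ℝ} (hl : ∀ i, 0 < lam i) {σ : ℝ} (hσ : 0 < σ) {φ ψ : (Fin n → ℝ) → ℝ}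
    (hφ : Measurable φ) (hψ : ψ =ᵐ[refMeasure g lam] φ) :
    meanAccept alg g lam φ σ = ∫ ξ, Real.exp (-ψ (scaledState lam ξ)) *
      alg.acceptScaled g lam ψ σ ξ ∂(productLaw g n) := by
  rw [meanAccept, hg.integral_target_prod hl hφ (hg.measurable_accept alg hl hσ hφ)]
  refine integral_congr_ae ?_
  filter_upwards [hg.ae_scaledProposal alg hl hσ hψ] with ξ hξ
  rw [hg.accept_scaled alg hl hσ, Algorithm.acceptScaled, hξ.1, hξ.2]

/-- The weight is the density of the target law, and the noise is independent of the state, so the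
weight integrates out. It normalizes the weighted means for w = 1 and w(z) = z². -/
theorem Regular.integral_exp_neg_eq_one {g : ℝ → ℝ} (hg : Regular g) {n : ℕ}
    {lam : Fin n → ℝ} (hl : ∀ i, 0 < lam i) {φ ψ : (Fin n → ℝ) → ℝ}
    (hφ : Measurable φ) (hψ : ψ =ᵐ[refMeasure g lam] φ)
    (hP : IsProbabilityMeasure (target g lam φ)) {w : ℝ → ℝ} (hw : Measurable w)
    (i : Fin n) :
    ∫ ξ, Real.exp (-ψ (scaledState lam ξ)) * w (ξ i).2 ∂(productLaw g n) =
      ∫ z, w z ∂(gaussianReal 0 1) := by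
  have := isProbabilityMeasure_stdGauss n
  have h1 := hg.integral_target_prod hl hφ (F := fun v => w (v.2 i)) (by fun_prop)
  have h2 : ∫ v, w (v.2 i) ∂((target g lam φ).prod (stdGauss n)) =
      ∫ z, w z ∂(gaussianReal 0 1) := by
    rw [integral_fun_snd (fun z : Fin n → ℝ => w (z i))]
    rw [probReal_univ, one_smul]
    have hmp := MeasureTheory.measurePreserving_eval (fun _ : Fin n => gaussianReal 0 1) i
    rw [← hmp.map_eq, integral_map hmp.measurable.aemeasurable hw.aestronglyMeasurable]
    rfl
  rw [← h2, h1]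
  refine integral_congr_ae ?_
  -- Only the assertion about the state is used; the algorithm and the step size 1 are arbitrary.
  filter_upwards [hg.ae_scaledProposal Algorithm.rwm hl one_pos hψ] with ξ hξ
  rw [hξ.1]
  rfl

/-! ### One step of the chain: integrating out the acceptance variable -/

theorem integral_unit_indicator {a : ℝ} (h0 : 0 ≤ a) (h1 : a ≤ 1) (c : ℝ) :
    ∫ u in Set.Icc (0 : ℝ) 1, (if u ≤ a then c else 0) = a * c := by
  have e : (fun u : ℝ => if u ≤ a then c else 0) = (Set.Iic a).indicator fun _ => c := by
    ext u; simp [Set.indicator_apply]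
  rw [e, setIntegral_indicator measurableSet_Iic, setIntegral_const, smul_eq_mul]
  have : Set.Icc (0 : ℝ) 1 ∩ Set.Iic a = Set.Icc 0 a := by
    ext u
    simp only [Set.mem_inter_iff, Set.mem_Icc, Set.mem_Iic]
    constructor
    · rintro ⟨⟨h2, _⟩, h3⟩; exact ⟨h2, h3⟩
    · rintro ⟨h2, h3⟩; exact ⟨⟨h2, h3.trans h1⟩, h3⟩
  rw [this, Real.volume_real_Icc_of_le h0, sub_zero]

theorem Regular.accept_mem {g : ℝ → ℝ} (hg : Regular g) (alg : Algorithm) {n : ℕ}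
    {lam : Fin n → ℝ} (hl : ∀ i, 0 < lam i) {σ : ℝ} (hσ : 0 < σ) (φ : (Fin n → ℝ) → ℝ)
    (x y : Fin n → ℝ) :
    0 ≤ accept alg g lam φ σ x y ∧ accept alg g lam φ σ x y ≤ 1 := by
  rw [hg.accept_eq alg hl hσ]
  exact ⟨cutExp_nonneg _, cutExp_le_one _⟩

theorem sqJump_eq (alg : Algorithm) (g : ℝ → ℝ) {n : ℕ} (lam : Fin n → ℝ)
    (φ : (Fin n → ℝ) → ℝ) (σ : ℝ) (i : Fin n) (x z : Fin n → ℝ) (u : ℝ) :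
    sqJump alg g lam φ σ i (x, z, u) =
      if u ≤ accept alg g lam φ σ x (proposal alg g lam σ x z) then
        (proposal alg g lam σ x z i - x i) ^ 2 else 0 := by
  simp only [sqJump, i.2, dite_true, nextState]
  split_ifs <;> simp

/-- The squared jump is integrable as soon as the squared distance to the proposal is, and its mean
is the mean of this distance weighted by the acceptance probability. -/
theorem Regular.meanSqJump_eq {g : ℝ → ℝ} (hg : Regular g) (alg : Algorithm) {n : ℕ}
    {lam : Fin n → ℝ} (hl : ∀ i, 0 < lam i) {σ : ℝ} (hσ : 0 < σ) {φ ψ : (Fin n → ℝ) → ℝ}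
    (hφ : Measurable φ) (hψ : ψ =ᵐ[refMeasure g lam] φ) (i : Fin n)
    (hi : Integrable (fun ξ => (alg.scaledProposal g lam σ ξ i - scaledState lam ξ i) ^ 2 *
      Real.exp (-ψ (scaledState lam ξ))) (productLaw g n)) :
    Integrable (sqJump alg g lam φ σ i) (stepLaw g lam φ) ∧
    meanSqJump alg g lam φ σ i = ∫ ξ, Real.exp (-ψ (scaledState lam ξ)) *
      (alg.acceptScaled g lam ψ σ ξ *
        (alg.scaledProposal g lam σ ξ i - scaledState lam ξ i) ^ 2) ∂(productLaw g n) := by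
  have := isProbabilityMeasure_stdGauss n
  have hsf : SFinite (target g lam φ) := by unfold target refMeasure; infer_instance
  have hp := hg.measurable_proposal alg hl σ
  have ha := hg.measurable_accept alg hl hσ hφ
  have hae := hg.ae_scaledProposal alg hl hσ hψ
  let U : Measure ℝ := volume.restrict (Set.Icc 0 1)
  have hd : Measurable fun v : (Fin n → ℝ) × (Fin n → ℝ) =>
      (proposal alg g lam σ v.1 v.2 i - v.1 i) ^ 2 :=
    (((measurable_pi_apply i).comp hp).sub (by fun_prop)).pow_const 2
  have hdi : Integrable (fun v : (Fin n → ℝ) × (Fin n → ℝ) =>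
      (proposal alg g lam σ v.1 v.2 i - v.1 i) ^ 2) ((target g lam φ).prod (stdGauss n)) := by
    rw [hg.integrable_target_prod_iff hl hφ hd]
    refine hi.congr ?_
    filter_upwards [hae] with ξ hξ
    rw [hξ.1, hg.proposal_scaledState alg hl]
  -- Regrouping makes the uniform variable the innermost one in Fubini's theorem; integrating it out
  -- turns the acceptance event into the factor a(x, y).
  have hassoc : (stepLaw g lam φ) =
      (((target g lam φ).prod (stdGauss n)).prod U).map MeasurableEquiv.prodAssoc :=
    Measure.prodAssoc_prod.symm
  let J : ((Fin n → ℝ) × (Fin n → ℝ)) × ℝ → ℝ := fun v =>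
    if v.2 ≤ accept alg g lam φ σ v.1.1 (proposal alg g lam σ v.1.1 v.1.2) then
      (proposal alg g lam σ v.1.1 v.1.2 i - v.1.1 i) ^ 2 else 0
  have hJ : Measurable J :=
    Measurable.ite (measurableSet_le measurable_snd (ha.comp measurable_fst))
      (hd.comp measurable_fst) measurable_const
  have hJi : Integrable J (((target g lam φ).prod (stdGauss n)).prod U) := by
    have h1 : Integrable (fun v : ((Fin n → ℝ) × (Fin n → ℝ)) × ℝ =>
        (proposal alg g lam σ v.1.1 v.1.2 i - v.1.1 i) ^ 2)
        (((target g lam φ).prod (stdGauss n)).prod U) := by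
      have := hdi.mul_prod (ν := U) (g := fun _ => (1 : ℝ)) (integrable_const 1)
      simpa using this
    refine h1.mono' hJ.aestronglyMeasurable (ae_of_all _ fun v => ?_)
    simp only [J]
    split_ifs
    · rw [Real.norm_of_nonneg (sq_nonneg _)]
    · rw [norm_zero]; exact sq_nonneg _
  have hcomp : (sqJump alg g lam φ σ i) ∘ MeasurableEquiv.prodAssoc = J := by
    ext v
    exact sqJump_eq alg g lam φ σ i v.1.1 v.1.2 v.2
  constructor
  · rw [hassoc, MeasurableEquiv.prodAssoc.measurableEmbedding.integrable_map_iff, hcomp]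
    exact hJi
  · rw [meanSqJump, hassoc, integral_map_equiv]
    have e1 : ∫ v, sqJump alg g lam φ σ i (MeasurableEquiv.prodAssoc v)
        ∂(((target g lam φ).prod (stdGauss n)).prod U) =
        ∫ v, J v ∂(((target g lam φ).prod (stdGauss n)).prod U) := by
      rw [← hcomp]; rfl
    rw [e1, integral_prod _ hJi]
    have e2 : ∀ v : (Fin n → ℝ) × (Fin n → ℝ), ∫ u, J (v, u) ∂U =
        accept alg g lam φ σ v.1 (proposal alg g lam σ v.1 v.2) *
          (proposal alg g lam σ v.1 v.2 i - v.1 i) ^ 2 := fun v =>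
      have hm := hg.accept_mem alg hl hσ φ v.1 (proposal alg g lam σ v.1 v.2)
      integral_unit_indicator hm.1 hm.2 ((proposal alg g lam σ v.1 v.2 i - v.1 i) ^ 2)
    simp only [e2]
    refine (hg.integral_target_prod hl hφ (F := fun v =>
      accept alg g lam φ σ v.1 (proposal alg g lam σ v.1 v.2) *
        (proposal alg g lam σ v.1 v.2 i - v.1 i) ^ 2) (ha.mul hd)).trans (integral_congr_ae ?_)
    filter_upwards [hae] with ξ hξ
    rw [hg.accept_scaled alg hl hσ, Algorithm.acceptScaled, hξ.1, hξ.2,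
      hg.proposal_scaledState alg hl]

/-! ### The weighted norms -/

theorem sNorm_nonneg {n : ℕ} (s : ℝ) (x : Fin n → ℝ) : 0 ≤ sNorm s x := Real.sqrt_nonneg _

theorem continuous_sNorm {n : ℕ} (s : ℝ) : Continuous (sNorm s : (Fin n → ℝ) → ℝ) := by
  unfold sNorm
  fun_prop

theorem sNorm_sq {n : ℕ} (s : ℝ) (x : Fin n → ℝ) :
    sNorm s x ^ 2 = ∑ i : Fin n, ((i : ℕ) + 1 : ℝ) ^ (2 * s) * x i ^ 2 :=
  Real.sq_sqrt (Finset.sum_nonneg fun i _ => by positivity)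

/-- A Euclidean norm of rescaled coordinates, which gives the triangle inequality. -/
theorem sNorm_eq_norm {n : ℕ} (s : ℝ) (x : Fin n → ℝ) :
    sNorm s x = ‖(WithLp.toLp 2 fun i : Fin n => ((i : ℕ) + 1 : ℝ) ^ s * x i :
      EuclideanSpace ℝ (Fin n))‖ := by
  rw [EuclideanSpace.norm_eq, sNorm]
  congr 1
  refine Finset.sum_congr rfl fun i _ => ?_
  have h : (0 : ℝ) < (i : ℕ) + 1 := by positivity
  simp only [Real.norm_eq_abs, sq_abs]
  rw [mul_pow, mul_comm 2 s, Real.rpow_mul h.le, Real.rpow_two]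

theorem sNorm_add_le {n : ℕ} (s : ℝ) (x y : Fin n → ℝ) : sNorm s (x + y) ≤ sNorm s x + sNorm s y := by
  simp only [sNorm_eq_norm]
  refine le_trans (le_of_eq ?_) (norm_add_le _ _)
  congr 1
  ext i
  simp [mul_add]

theorem sNorm_zero {n : ℕ} (s : ℝ) : sNorm s (0 : Fin n → ℝ) = 0 := by
  simp [sNorm]

/-- The first moment of the norm is at most the root of its second moment, and the latter is a
weighted sum over coordinates. -/
theorem integral_sNorm_le {Ω : Type*} [MeasurableSpace Ω] {P : Measure Ω} [IsProbabilityMeasure P]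
    {n : ℕ} (s : ℝ) {u : Ω → Fin n → ℝ} (hu : Measurable u) {c : Fin n → ℝ}
    (hi : ∀ i, Integrable (fun ξ => u ξ i ^ 2) P) (hc : ∀ i, ∫ ξ, u ξ i ^ 2 ∂P ≤ c i) :
    Integrable (fun ξ => sNorm s (u ξ)) P ∧
      ∫ ξ, sNorm s (u ξ) ∂P ≤ √(∑ i : Fin n, ((i : ℕ) + 1 : ℝ) ^ (2 * s) * c i) := by
  have hm : Measurable fun ξ => sNorm s (u ξ) := (continuous_sNorm s).measurable.comp hu
  have hL : MemLp (fun ξ => sNorm s (u ξ)) 2 P := by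
    rw [memLp_two_iff_integrable_sq hm.aestronglyMeasurable]
    simp only [sNorm_sq]
    exact integrable_finsetSum _ fun i _ => (hi i).const_mul _
  refine ⟨hL.integrable (by norm_num), ?_⟩
  have h := integral_abs_le_sqrt hL
  simp only [abs_of_nonneg (sNorm_nonneg s _), sNorm_sq] at h
  refine h.trans (Real.sqrt_le_sqrt ?_)
  rw [integral_finsetSum _ fun i _ => (hi i).const_mul _]
  refine Finset.sum_le_sum fun i _ => ?_
  rw [integral_const_mul]
  exact mul_le_mul_of_nonneg_left (hc i) (by positivity)

theorem summable_succ_rpow {t : ℝ} (ht : t < -1) : Summable fun j : ℕ => ((j : ℝ) + 1) ^ t := by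
  have := (summable_nat_add_iff 1).2 (Real.summable_nat_rpow.2 ht)
  simpa using this

/-- Tails of a convergent series of nonnegative terms, as sums over `Fin n`. -/
theorem exists_sum_fin_tail_le {f : ℕ → ℝ} (hf : Summable f) {ε : ℝ}
    (hε : 0 < ε) : ∃ N₀ : ℕ, ∀ N ≥ N₀, ∀ n : ℕ,
      ∑ i : Fin n, (if (i : ℕ) < N then 0 else f i) ≤ ε := by
  obtain ⟨s, hs⟩ := summable_iff_vanishing_norm.1 hf ε hε
  obtain ⟨N₀, hN₀⟩ := s.exists_nat_subset_range
  refine ⟨N₀, fun N hN n => ?_⟩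
  have hd : Disjoint ((Finset.range n).filter fun i => ¬ i < N) s := by
    rw [Finset.disjoint_left]
    intro i hi his
    have h1 := Finset.mem_range.1 (hN₀ his)
    have h2 := (Finset.mem_filter.1 hi).2
    omega
  have h := hs _ hd
  rw [Finset.sum_filter] at h
  have e : ∑ i : Fin n, (if (i : ℕ) < N then 0 else f i) =
      ∑ i ∈ Finset.range n, if ¬ i < N then f i else 0 := by
    rw [← Fin.sum_univ_eq_sum_range (fun i => if ¬ i < N then f i else 0)]
    refine Finset.sum_congr rfl fun i _ => ?_
    split_ifs <;> rfl
  rw [e]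
  exact (le_abs_self _).trans h.le

theorem sum_fin_le_tsum {f : ℕ → ℝ} (hf : Summable f) (h0 : ∀ j, 0 ≤ f j) (n : ℕ) :
    ∑ i : Fin n, f i ≤ ∑' j, f j := by
  rw [Fin.sum_univ_eq_sum_range f]
  exact hf.sum_le_tsum _ fun i _ => h0 i

/-! ### Locally Lipschitz functions of random vectors -/

/-- Near x the second norm stays below |x|_s + 1, so δ is bounded there. The conclusion also
supplies the measurability of the version ψ, which is not assumed. -/
theorem continuous_of_sNorm_lipschitz {n : ℕ} {ψ : (Fin n → ℝ) → ℝ} {δ : ℝ → ℝ → ℝ} {s s' : ℝ}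
    (hδ : ∀ R : ℝ, ∃ B : ℝ, ∀ a ∈ Set.Icc 0 R, ∀ b ∈ Set.Icc 0 R, δ a b ≤ B)
    (hψ : ∀ x y, |ψ y - ψ x| ≤ δ (sNorm s x) (sNorm s y) * sNorm s' (y - x)) :
    Continuous ψ := by
  rw [continuous_iff_continuousAt]
  intro x
  obtain ⟨B, hB⟩ := hδ (sNorm s x + 1)
  have h0 : Tendsto (fun y => B * sNorm s' (y - x)) (𝓝 x) (𝓝 0) := by
    have : Continuous fun y : Fin n → ℝ => B * sNorm s' (y - x) :=
      continuous_const.mul ((continuous_sNorm s').comp (continuous_id.sub continuous_const))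
    have h := this.tendsto x
    simpa [sNorm_zero] using h
  rw [ContinuousAt, tendsto_iff_dist_tendsto_zero]
  refine squeeze_zero' (Eventually.of_forall fun _ => dist_nonneg) ?_ h0
  have h1 : ∀ᶠ y in 𝓝 x, sNorm s y < sNorm s x + 1 :=
    (continuous_sNorm s).continuousAt.eventually_lt continuousAt_const (by linarith)
  filter_upwards [h1] with y hy
  rw [Real.dist_eq]
  refine (hψ x y).trans (mul_le_mul_of_nonneg_right (hB _ ⟨sNorm_nonneg _ _, by linarith⟩ _
    ⟨sNorm_nonneg _ _, hy.le⟩) (sNorm_nonneg _ _))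

/-- A truncation with Markov's inequality: where the norms add up to more than R, the minimum is at
most 1, hence at most that sum divided by R; elsewhere δ is at most a constant B. What matters is
that η depends neither on n nor on ψ nor on the law P. -/
theorem exists_integral_min_le {δ : ℝ → ℝ → ℝ} (s s' : ℝ)
    (hδ : ∀ R : ℝ, ∃ B : ℝ, ∀ a ∈ Set.Icc 0 R, ∀ b ∈ Set.Icc 0 R, δ a b ≤ B) (A : ℝ) {ε : ℝ}
    (hε : 0 < ε) : ∃ η > 0, ∀ (n : ℕ) (ψ : (Fin n → ℝ) → ℝ), Measurable ψ →
      (∀ x y, |ψ y - ψ x| ≤ δ (sNorm s x) (sNorm s y) * sNorm s' (y - x)) →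
      ∀ (P : Measure (Fin n → ℝ × ℝ)) (_ : IsProbabilityMeasure P)
        (u v : (Fin n → ℝ × ℝ) → Fin n → ℝ), Measurable u → Measurable v →
      Integrable (fun ξ => sNorm s (u ξ)) P → Integrable (fun ξ => sNorm s (v ξ)) P →
      Integrable (fun ξ => sNorm s' (v ξ - u ξ)) P →
      ∫ ξ, sNorm s (u ξ) ∂P ≤ A → ∫ ξ, sNorm s (v ξ) ∂P ≤ A →
      ∫ ξ, sNorm s' (v ξ - u ξ) ∂P ≤ η → ∫ ξ, min 1 |ψ (v ξ) - ψ (u ξ)| ∂P ≤ ε := by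
  -- Chosen so that the two first moments contribute at most 2|A|/R ≤ ε/2.
  set R := (4 * |A| + 1) / ε with hR
  have hR0 : 0 < R := by positivity
  obtain ⟨B, hB⟩ := hδ R
  refine ⟨ε / (2 * (|B| + 1)), by positivity,
    fun n ψ hψm hψ P _ u v hu hv iu iv iw hAu hAv hη => ?_⟩
  have key (ξ) : min 1 |ψ (v ξ) - ψ (u ξ)| ≤
      (sNorm s (u ξ) + sNorm s (v ξ)) * R⁻¹ + (|B| + 1) * sNorm s' (v ξ - u ξ) := by
    have h1 := sNorm_nonneg s (u ξ)
    have h2 := sNorm_nonneg s (v ξ)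
    have h3 := sNorm_nonneg s' (v ξ - u ξ)
    by_cases hc : sNorm s (u ξ) + sNorm s (v ξ) ≤ R
    · refine (min_le_right _ _).trans ((hψ _ _).trans ?_)
      have := hB _ ⟨h1, by linarith⟩ _ ⟨h2, by linarith⟩
      have h4 : δ (sNorm s (u ξ)) (sNorm s (v ξ)) ≤ |B| + 1 := by linarith [le_abs_self B]
      have h5 : 0 ≤ (sNorm s (u ξ) + sNorm s (v ξ)) * R⁻¹ := by positivity
      linarith [mul_le_mul_of_nonneg_right h4 h3]
    · refine (min_le_left _ _).trans ?_
      have h5 : 1 ≤ (sNorm s (u ξ) + sNorm s (v ξ)) * R⁻¹ := by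
        rw [← div_eq_mul_inv, le_div_iff₀ hR0]; linarith
      have : 0 ≤ (|B| + 1) * sNorm s' (v ξ - u ξ) := by positivity
      linarith
  have hi1 : Integrable (fun ξ => (sNorm s (u ξ) + sNorm s (v ξ)) * R⁻¹) P :=
    (iu.add iv).mul_const _
  have hi2 := iw.const_mul (|B| + 1)
  calc _ ≤ ∫ ξ, ((sNorm s (u ξ) + sNorm s (v ξ)) * R⁻¹ + (|B| + 1) * sNorm s' (v ξ - u ξ)) ∂P := by
        refine integral_mono_of_nonneg (ae_of_all _ fun ξ => le_min zero_le_one (abs_nonneg _))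
          (hi1.add hi2) (ae_of_all _ key)
    _ = (∫ ξ, sNorm s (u ξ) ∂P + ∫ ξ, sNorm s (v ξ) ∂P) * R⁻¹ +
          (|B| + 1) * ∫ ξ, sNorm s' (v ξ - u ξ) ∂P := by
        rw [integral_add hi1 hi2, integral_mul_const, integral_const_mul, integral_add iu iv]
    _ ≤ (|A| + |A|) * R⁻¹ + (|B| + 1) * (ε / (2 * (|B| + 1))) := by
        have := le_abs_self A
        gcongr <;> linarith
    _ ≤ ε := by
        rw [hR, inv_div]
        have h1 : (|A| + |A|) * (ε / (4 * |A| + 1)) ≤ ε / 2 := by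
          rw [mul_div_assoc', div_le_iff₀ (by positivity)]
          nlinarith [abs_nonneg A]
        have h2 : (|B| + 1) * (ε / (2 * (|B| + 1))) = ε / 2 := by field_simp
        linarith

/-! ### Comparison with the product case -/

/-- Cauchy–Schwarz, with T² ≤ T for values in [0, 1]. Smallness of E[T] thus survives multiplication
by an unbounded V. -/
theorem integral_mul_le_sqrt {Ω : Type*} [MeasurableSpace Ω] {P : Measure Ω}
    [IsProbabilityMeasure P] {T V : Ω → ℝ} (hT : Measurable T) (hT0 : ∀ ξ, 0 ≤ T ξ)
    (hT1 : ∀ ξ, T ξ ≤ 1) (hV0 : ∀ ξ, 0 ≤ V ξ) (hV : MemLp V 2 P) :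
    ∫ ξ, T ξ * V ξ ∂P ≤ √(∫ ξ, T ξ ∂P) * √(∫ ξ, V ξ ^ 2 ∂P) := by
  have hTi : Integrable T P := (integrable_const (1 : ℝ)).mono' hT.aestronglyMeasurable
    (ae_of_all _ fun ξ => by rw [Real.norm_of_nonneg (hT0 ξ)]; exact hT1 ξ)
  have hT2 : Integrable (fun ξ => T ξ ^ 2) P :=
    (integrable_const (1 : ℝ)).mono' (by fun_prop) (ae_of_all _ fun ξ => by
      rw [Real.norm_of_nonneg (sq_nonneg _)]; exact pow_le_one₀ (hT0 ξ) (hT1 ξ))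
  have hTL : MemLp T 2 P := (memLp_two_iff_integrable_sq hT.aestronglyMeasurable).2 hT2
  have h := integral_mul_le_Lp_mul_Lq_of_nonneg (μ := P) (p := 2) (q := 2)
    Real.HolderConjugate.two_two (f := T) (g := V) (ae_of_all _ hT0) (ae_of_all _ hV0)
    (by simpa using hTL) (by simpa using hV)
  simp only [Real.rpow_two, ← Real.sqrt_eq_rpow] at h
  refine h.trans (mul_le_mul_of_nonneg_right (Real.sqrt_le_sqrt ?_) (Real.sqrt_nonneg _))
  exact integral_mono hT2 hTi fun ξ => by nlinarith [hT0 ξ, hT1 ξ]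

theorem Regular.measurePreserving_eval_snd {g : ℝ → ℝ} (hg : Regular g) {n : ℕ} (i : Fin n) :
    MeasurePreserving (fun ξ : Fin n → ℝ × ℝ => (ξ i).2) (productLaw g n) (gaussianReal 0 1) := by
  have := hg.isProbabilityMeasure_baseMeasure
  exact measurePreserving_snd.comp (hg.measurePreserving_eval i)

/-- On [M, ∞) the function e^{-a} is e^{-M}-Lipschitz with values in (0, e^{-M}]. -/
theorem abs_exp_neg_sub_le {M a b : ℝ} (ha : M ≤ a) (hb : M ≤ b) :
    |Real.exp (-a) - Real.exp (-b)| ≤ Real.exp (-M) * min 1 |a - b| := by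
  wlog hab : a ≤ b generalizing a b
  · rw [abs_sub_comm, abs_sub_comm a]
    exact this hb ha (le_of_not_ge hab)
  have h1 : Real.exp (-b) ≤ Real.exp (-a) := Real.exp_le_exp.2 (by linarith)
  have h2 : Real.exp (-a) ≤ Real.exp (-M) := Real.exp_le_exp.2 (by linarith)
  rw [abs_of_nonneg (by linarith), mul_min_of_nonneg _ _ (Real.exp_pos _).le, mul_one]
  refine le_min (by linarith [Real.exp_pos (-b)]) ?_
  have h3 : Real.exp (-b) = Real.exp (-a) * Real.exp (a - b) := by
    rw [← Real.exp_add]; ring_nf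
  rw [abs_sub_comm, abs_of_nonneg (by linarith : 0 ≤ b - a), h3]
  have h4 := Real.add_one_le_exp (a - b)
  have h5 : Real.exp (-a) - Real.exp (-a) * Real.exp (a - b) ≤ Real.exp (-a) * (b - a) := by
    nlinarith [Real.exp_pos (-a)]
  exact h5.trans (mul_le_mul_of_nonneg_right h2 (by linarith))

/-- The configuration that keeps the coordinates in `s` and is zero elsewhere. -/
def restrictTo {n : ℕ} (s : Finset (Fin n)) (ξ : Fin n → ℝ × ℝ) : Fin n → ℝ × ℝ :=
  fun j => if j ∈ s then ξ j else 0

theorem measurable_restrictTo {n : ℕ} (s : Finset (Fin n)) : Measurable (restrictTo s) := by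
  refine measurable_pi_lambda _ fun j => ?_
  unfold restrictTo
  split_ifs <;> fun_prop

theorem Regular.indepFun_restrictTo {g : ℝ → ℝ} (hg : Regular g) {n : ℕ} {s t : Finset (Fin n)}
    (hst : Disjoint s t) : IndepFun (restrictTo s) (restrictTo t) (productLaw g n) := by
  have := hg.isProbabilityMeasure_pairMeasure
  have h := (iIndepFun_pi (X := fun _ : Fin n => (id : ℝ × ℝ → ℝ × ℝ))
    (μ := fun _ : Fin n => pairMeasure g) fun _ => aemeasurable_id).indepFun_finset s t hst
      fun i => measurable_pi_apply i
  have hext (r : Finset (Fin n)) : Measurable fun (q : r → ℝ × ℝ) (j : Fin n) =>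
      if hj : j ∈ r then q ⟨j, hj⟩ else 0 := by
    refine measurable_pi_lambda _ fun j => ?_
    split_ifs <;> fun_prop
  -- The restriction is a measurable function, extension by zero, of the tuple of coordinates in r,
  -- so independence of the tuples carries over.
  have he (r : Finset (Fin n)) : restrictTo r = (fun (q : r → ℝ × ℝ) (j : Fin n) =>
      if hj : j ∈ r then q ⟨j, hj⟩ else 0) ∘ fun (ξ : Fin n → ℝ × ℝ) (i : r) => id (ξ i) := by
    ext1 ξ
    ext1 j
    simp only [restrictTo, Function.comp, id]
    split_ifs <;> rfl
  rw [he s, he t]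
  exact h.comp (hext s) (hext t)

theorem Regular.integral_restrictTo_mul {g : ℝ → ℝ} (hg : Regular g) {n : ℕ}
    {s t : Finset (Fin n)} (hst : Disjoint s t) {F G : (Fin n → ℝ × ℝ) → ℝ} (hF : Measurable F)
    (hG : Measurable G) :
    ∫ ξ, F (restrictTo s ξ) * G (restrictTo t ξ) ∂(productLaw g n) =
      (∫ ξ, F (restrictTo s ξ) ∂(productLaw g n)) * ∫ ξ, G (restrictTo t ξ) ∂(productLaw g n) :=
  ((hg.indepFun_restrictTo hst).comp hF hG).integral_fun_mul_eq_mul_integral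
    (hF.comp (measurable_restrictTo s)).aestronglyMeasurable
    (hG.comp (measurable_restrictTo t)).aestronglyMeasurable

/-- The weighted mean acceptance probability is close to the mean acceptance probability under the
reference law, if `ψ` varies little in one step and depends mostly on the coordinates in `s`, which
contribute little to the acceptance ratio. -/
theorem Regular.abs_integral_weighted_sub_le {g : ℝ → ℝ} (hg : Regular g) (alg : Algorithm)
    {n : ℕ} {lam : Fin n → ℝ} {σ : ℝ} {ψ : (Fin n → ℝ) → ℝ} (hψ : Measurable ψ) {M : ℝ}
    (hM : ∀ x, M ≤ ψ x) {v : ℝ → ℝ} (hv : Measurable v) (hv0 : ∀ z, 0 ≤ v z)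
    (hv2 : MemLp v 2 (gaussianReal 0 1)) (i : Fin n) (s : Finset (Fin n)) (hi : i ∈ s)
    (h1 : ∫ ξ, Real.exp (-ψ (scaledState lam ξ)) * v (ξ i).2 ∂(productLaw g n) = 1)
    (hr : Integrable (alg.partialRatio g (fun i => σ / lam i) s) (productLaw g n)) :
    |∫ ξ, Real.exp (-ψ (scaledState lam ξ)) * (alg.acceptScaled g lam ψ σ ξ * v (ξ i).2)
        ∂(productLaw g n) -
      ∫ ξ, cutExp (alg.totalRatio g (fun i => σ / lam i) ξ) ∂(productLaw g n)| ≤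
    Real.exp (-M) * ((√(∫ ξ, min 1 |ψ (alg.scaledProposal g lam σ ξ) - ψ (scaledState lam ξ)|
        ∂(productLaw g n)) +
      2 * √(∫ ξ, min 1 |ψ (scaledState lam ξ) - ψ (scaledState lam (restrictTo s ξ))|
        ∂(productLaw g n)) +
      √(∫ ξ, |alg.partialRatio g (fun i => σ / lam i) s ξ| ∂(productLaw g n))) *
        √(∫ z, v z ^ 2 ∂(gaussianReal 0 1))) +
      ∫ ξ, |alg.partialRatio g (fun i => σ / lam i) s ξ| ∂(productLaw g n) := by
  classical
  have hP := hg.isProbabilityMeasure_productLaw n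
  have := hg.isProbabilityMeasure_pairMeasure
  set P := productLaw g n
  set h : Fin n → ℝ := fun i => σ / lam i
  set b := Real.exp (-M)
  have hb : 0 < b := Real.exp_pos _
  have hmx := measurable_scaledState lam
  have hmy := hg.measurable_scaledProposal alg lam σ
  have hmr := measurable_restrictTo s
  have hmR := hg.measurable_totalRatio alg h
  have hmS := hg.measurable_partialRatio alg h s
  have hmC := hg.measurable_partialRatio alg h sᶜ
  have hmc : Measurable cutExp := continuous_cutExp.measurable
  let V : (Fin n → ℝ × ℝ) → ℝ := fun ξ => v (ξ i).2
  let w : (Fin n → ℝ × ℝ) → ℝ := fun ξ => Real.exp (-ψ (scaledState lam ξ))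
  -- `wN` sees only the coordinates in s and `c'` only those outside s. The proof passes from E[w a
  -- V] to E[wN V c'], factors it, and returns to E[c].
  let wN : (Fin n → ℝ × ℝ) → ℝ := fun ξ => Real.exp (-ψ (scaledState lam (restrictTo s ξ)))
  let a : (Fin n → ℝ × ℝ) → ℝ := alg.acceptScaled g lam ψ σ
  let c : (Fin n → ℝ × ℝ) → ℝ := fun ξ => cutExp (alg.totalRatio g h ξ)
  let c' : (Fin n → ℝ × ℝ) → ℝ := fun ξ => cutExp (alg.partialRatio g h sᶜ ξ)
  let d : (Fin n → ℝ × ℝ) → ℝ := fun ξ =>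
    min 1 |ψ (alg.scaledProposal g lam σ ξ) - ψ (scaledState lam ξ)|
  let t : (Fin n → ℝ × ℝ) → ℝ := fun ξ =>
    min 1 |ψ (scaledState lam ξ) - ψ (scaledState lam (restrictTo s ξ))|
  let r : (Fin n → ℝ × ℝ) → ℝ := fun ξ => min 1 |alg.partialRatio g h s ξ|
  have mV : Measurable V := by fun_prop
  have mw : Measurable w := by fun_prop
  have mwN : Measurable wN := by fun_prop
  have ma : Measurable a := by
    simp only [a]
    unfold Algorithm.acceptScaled
    fun_prop
  have mc : Measurable c := by fun_prop
  have mc' : Measurable c' := by fun_prop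
  have md : Measurable d := by fun_prop
  have mt : Measurable t := by fun_prop
  have mr : Measurable r := by fun_prop
  have hVL : MemLp V 2 P :=
    hv2.comp_measurePreserving (hg.measurePreserving_eval_snd i)
  have hV2 : ∫ ξ, V ξ ^ 2 ∂P = ∫ z, v z ^ 2 ∂(gaussianReal 0 1) := by
    have hmp := hg.measurePreserving_eval_snd i
    rw [← hmp.map_eq, integral_map hmp.measurable.aemeasurable
      (hv.pow_const 2).aestronglyMeasurable]
  have hVi : Integrable V P := hVL.integrable (by norm_num)
  have hV0 (ξ) : 0 ≤ V ξ := hv0 _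
  have hbV {F : (Fin n → ℝ × ℝ) → ℝ} {B : ℝ} (hF : Measurable F) (hB : ∀ ξ, |F ξ| ≤ B) :
      Integrable (fun ξ => F ξ * V ξ) P :=
    hVi.bdd_mul hF.aestronglyMeasurable (ae_of_all _ fun ξ => hB ξ)
  have hbi {F : (Fin n → ℝ × ℝ) → ℝ} {B : ℝ} (hF : Measurable F) (hB : ∀ ξ, |F ξ| ≤ B) :
      Integrable F P :=
    (integrable_const B).mono' hF.aestronglyMeasurable (ae_of_all _ fun ξ => hB ξ)
  have w0 (ξ) : 0 ≤ w ξ := (Real.exp_pos _).le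
  have wb (ξ) : w ξ ≤ b := Real.exp_le_exp.2 (neg_le_neg (hM _))
  have wN0 (ξ) : 0 ≤ wN ξ := (Real.exp_pos _).le
  have wNb (ξ) : wN ξ ≤ b := Real.exp_le_exp.2 (neg_le_neg (hM _))
  have a0 (ξ) : 0 ≤ a ξ := cutExp_nonneg _
  have a1 (ξ) : a ξ ≤ 1 := cutExp_le_one _
  have c0 (ξ) : 0 ≤ c ξ := cutExp_nonneg _
  have c1 (ξ) : c ξ ≤ 1 := cutExp_le_one _
  have c'0 (ξ) : 0 ≤ c' ξ := cutExp_nonneg _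
  have c'1 (ξ) : c' ξ ≤ 1 := cutExp_le_one _
  have min01 (x : ℝ) : 0 ≤ min 1 |x| := le_min zero_le_one (abs_nonneg _)
  have hmin (x : ℝ) : abs (min 1 |x|) ≤ 1 := by
    rw [abs_of_nonneg (min01 x)]; exact min_le_left _ _
  have idV := hbV md fun ξ => hmin _
  have itV := hbV mt fun ξ => hmin _
  have irV := hbV mr fun ξ => hmin _
  have hac (ξ) : |a ξ - c ξ| ≤ d ξ := by
    refine (abs_cutExp_sub_le_min _ _).trans (le_of_eq ?_)
    simp only [d]
    rw [abs_sub_comm (ψ _)]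
    congr 2
    ring
  have hcc (ξ) : |c ξ - c' ξ| ≤ r ξ := by
    refine (abs_cutExp_sub_le_min _ _).trans (le_of_eq ?_)
    have : alg.totalRatio g h ξ = alg.partialRatio g h s ξ + alg.partialRatio g h sᶜ ξ :=
      (Finset.sum_add_sum_compl s _).symm
    simp only [r]
    rw [this]
    congr 2
    ring
  have hww (ξ) : |w ξ - wN ξ| ≤ b * t ξ := abs_exp_neg_sub_le (hM _) (hM _)
  have hdV := integral_mul_le_sqrt md (fun ξ => min01 _) (fun ξ => min_le_left _ _) hV0 hVL
  have htV := integral_mul_le_sqrt mt (fun ξ => min01 _) (fun ξ => min_le_left _ _) hV0 hVL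
  have hrV := integral_mul_le_sqrt mr (fun ξ => min01 _) (fun ξ => min_le_left _ _) hV0 hVL
  rw [hV2] at hdV htV hrV
  have hir : Integrable r P := hbi mr fun ξ => hmin _
  have hrr : ∫ ξ, r ξ ∂P ≤ ∫ ξ, |alg.partialRatio g h s ξ| ∂P :=
    integral_mono hir hr.abs fun ξ => min_le_right _ _
  have iwaV : Integrable (fun ξ => w ξ * (a ξ * V ξ)) P := by
    have := hbV (F := fun ξ => w ξ * a ξ) (B := b) (by fun_prop) fun ξ => by
      rw [abs_of_nonneg (mul_nonneg (w0 ξ) (a0 ξ))]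
      nlinarith [w0 ξ, a0 ξ, wb ξ, a1 ξ]
    simpa only [mul_assoc] using this
  have iwNc'V : Integrable (fun ξ => wN ξ * V ξ * c' ξ) P := by
    have := hbV (F := fun ξ => wN ξ * c' ξ) (B := b) (by fun_prop) fun ξ => by
      rw [abs_of_nonneg (mul_nonneg (wN0 ξ) (c'0 ξ))]
      nlinarith [wN0 ξ, c'0 ξ, wNb ξ, c'1 ξ]
    exact this.congr (ae_of_all _ fun ξ => by ring)
  have iwV : Integrable (fun ξ => w ξ * V ξ) P :=
    hbV mw fun ξ => by rw [abs_of_nonneg (w0 ξ)]; exact wb ξ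
  have iwNV : Integrable (fun ξ => wN ξ * V ξ) P :=
    hbV mwN fun ξ => by rw [abs_of_nonneg (wN0 ξ)]; exact wNb ξ
  have ic : Integrable c P := hbi mc fun ξ => by rw [abs_of_nonneg (c0 ξ)]; exact c1 ξ
  have ic' : Integrable c' P := hbi mc' fun ξ => by rw [abs_of_nonneg (c'0 ξ)]; exact c'1 ξ
  -- V depends on coordinate i alone, and i ∈ s, so wN V and c' are functions of disjoint blocks.
  have hind : ∫ ξ, wN ξ * V ξ * c' ξ ∂P = (∫ ξ, wN ξ * V ξ ∂P) * ∫ ξ, c' ξ ∂P := by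
    have := hg.integral_restrictTo_mul (s := s) (t := sᶜ) disjoint_compl_right
      (F := fun ξ => Real.exp (-ψ (scaledState lam ξ)) * v (ξ i).2)
      (G := fun ξ => cutExp (alg.partialRatio g h sᶜ ξ)) (by fun_prop) (by fun_prop)
    have e1 (ξ) : (restrictTo s ξ i).2 = (ξ i).2 := by simp [restrictTo, hi]
    have e2 (ξ) : alg.partialRatio g h sᶜ (restrictTo sᶜ ξ) = alg.partialRatio g h sᶜ ξ :=
      Finset.sum_congr rfl fun j hj => by simp only [restrictTo, if_pos hj]
    simpa only [e1, e2] using this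
  have step1 : |∫ ξ, w ξ * (a ξ * V ξ) ∂P - ∫ ξ, wN ξ * V ξ * c' ξ ∂P| ≤
      b * (∫ ξ, d ξ * V ξ ∂P + ∫ ξ, t ξ * V ξ ∂P + ∫ ξ, r ξ * V ξ ∂P) := by
    rw [← integral_sub iwaV iwNc'V, ← integral_add idV itV,
      ← integral_add (f := fun ξ => d ξ * V ξ + t ξ * V ξ) (idV.add itV) irV,
      ← integral_const_mul]
    refine abs_integral_le_integral_abs.trans (integral_mono (iwaV.sub iwNc'V).abs
      (((idV.add itV).add irV).const_mul b) fun ξ => ?_)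
    -- Three replacements, one per error term: a by c (ψ varies little in one step), w by wN (ψ
    -- depends mostly on s), c by c' (s contributes little to the ratio). The normalization of wN V
    -- costs the error t once more, which accounts for the factor 2.
    have e : w ξ * (a ξ * V ξ) - wN ξ * V ξ * c' ξ =
        (w ξ * (a ξ - c ξ) + (w ξ - wN ξ) * c ξ + wN ξ * (c ξ - c' ξ)) * V ξ := by ring
    have e1 : |w ξ * (a ξ - c ξ)| ≤ b * d ξ := by
      rw [abs_mul, abs_of_nonneg (w0 ξ)]
      exact mul_le_mul (wb ξ) (hac ξ) (abs_nonneg _) hb.le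
    have e2 : |(w ξ - wN ξ) * c ξ| ≤ b * t ξ := by
      rw [abs_mul, abs_of_nonneg (c0 ξ)]
      exact (mul_le_of_le_one_right (abs_nonneg _) (c1 ξ)).trans (hww ξ)
    have e3 : |wN ξ * (c ξ - c' ξ)| ≤ b * r ξ := by
      rw [abs_mul, abs_of_nonneg (wN0 ξ)]
      exact mul_le_mul (wNb ξ) (hcc ξ) (abs_nonneg _) hb.le
    have e4 := (abs_add_le (w ξ * (a ξ - c ξ) + (w ξ - wN ξ) * c ξ) (wN ξ * (c ξ - c' ξ))).trans
      (add_le_add (abs_add_le _ _) le_rfl)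
    dsimp only
    rw [e, abs_mul, abs_of_nonneg (hV0 ξ)]
    calc _ ≤ (b * d ξ + b * t ξ + b * r ξ) * V ξ :=
          mul_le_mul_of_nonneg_right (by linarith) (hV0 ξ)
      _ = _ := by ring
  have step2 : |∫ ξ, wN ξ * V ξ ∂P - 1| ≤ b * ∫ ξ, t ξ * V ξ ∂P := by
    rw [← h1, abs_sub_comm, ← integral_sub iwV iwNV, ← integral_const_mul]
    refine abs_integral_le_integral_abs.trans (integral_mono (iwV.sub iwNV).abs
      (itV.const_mul b) fun ξ => ?_)
    dsimp only
    change |w ξ * V ξ - wN ξ * V ξ| ≤ _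
    rw [← sub_mul, abs_mul, abs_of_nonneg (hV0 ξ), ← mul_assoc]
    exact mul_le_mul_of_nonneg_right (hww ξ) (hV0 ξ)
  have step3 : |∫ ξ, c' ξ ∂P - ∫ ξ, c ξ ∂P| ≤ ∫ ξ, r ξ ∂P := by
    rw [abs_sub_comm, ← integral_sub ic ic']
    exact abs_integral_le_integral_abs.trans (integral_mono (ic.sub ic').abs hir hcc)
  have q0 : 0 ≤ ∫ ξ, c' ξ ∂P := integral_nonneg c'0
  have q1 : ∫ ξ, c' ξ ∂P ≤ 1 := by
    have := integral_mono ic' (integrable_const (1 : ℝ)) c'1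
    simpa using this
  have step4 : |(∫ ξ, wN ξ * V ξ ∂P) * (∫ ξ, c' ξ ∂P) - ∫ ξ, c' ξ ∂P| ≤
      b * ∫ ξ, t ξ * V ξ ∂P := by
    rw [← sub_one_mul, abs_mul, abs_of_nonneg q0]
    exact (mul_le_of_le_one_right (abs_nonneg _) q1).trans step2
  rw [hind] at step1
  have tri := (abs_sub_le (∫ ξ, w ξ * (a ξ * V ξ) ∂P)
    ((∫ ξ, wN ξ * V ξ ∂P) * ∫ ξ, c' ξ ∂P) (∫ ξ, c ξ ∂P)).trans
    (add_le_add le_rfl (abs_sub_le _ (∫ ξ, c' ξ ∂P) _))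
  have hrs : √(∫ ξ, r ξ ∂P) ≤ √(∫ ξ, |alg.partialRatio g h s ξ| ∂P) := Real.sqrt_le_sqrt hrr
  have hV2' := Real.sqrt_nonneg (∫ z, v z ^ 2 ∂(gaussianReal 0 1))
  have hrV' := hrV.trans (mul_le_mul_of_nonneg_right hrs hV2')
  refine tri.trans ?_
  have fin : b * (∫ ξ, d ξ * V ξ ∂P + ∫ ξ, t ξ * V ξ ∂P + ∫ ξ, r ξ * V ξ ∂P) +
      b * ∫ ξ, t ξ * V ξ ∂P ≤ b * ((√(∫ ξ, d ξ ∂P) + 2 * √(∫ ξ, t ξ ∂P) +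
        √(∫ ξ, |alg.partialRatio g h s ξ| ∂P)) * √(∫ z, v z ^ 2 ∂(gaussianReal 0 1))) := by
    rw [← mul_add]
    refine mul_le_mul_of_nonneg_left ?_ hb.le
    linarith
  linarith

/-! ### The scaling regime -/

/-- The assumptions on the scales and on the step sizes. -/
structure Scaling (κ Cm Cp l ρ : ℝ) (lam : (n : ℕ) → Fin n → ℝ) (σ : ℕ → ℝ) : Prop where
  exponent_nonneg : 0 ≤ κ
  lower_pos : 0 < Cm
  upper_pos : 0 < Cp
  bounds : ∀ (n : ℕ) (i : Fin n),
    Cm * ((i : ℕ) + 1 : ℝ) ^ (-κ) ≤ lam n i ∧ lam n i ≤ Cp * ((i : ℕ) + 1 : ℝ) ^ (-κ)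
  length_pos : 0 < l
  step_sq : ∀ n : ℕ, 1 ≤ n → 0 < σ n ∧ σ n ^ 2 = l ^ 2 * (n : ℝ) ^ (-ρ)

namespace Scaling

variable {κ Cm Cp l ρ : ℝ} {lam : (n : ℕ) → Fin n → ℝ} {σ : ℕ → ℝ}

theorem lam_pos (H : Scaling κ Cm Cp l ρ lam σ) (n : ℕ) (i : Fin n) : 0 < lam n i :=
  lt_of_lt_of_le (mul_pos H.lower_pos (by positivity)) (H.bounds n i).1

theorem step_eq (H : Scaling κ Cm Cp l ρ lam σ) {n : ℕ} (hn : 1 ≤ n) :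
    σ n = l * (n : ℝ) ^ (-ρ / 2) := by
  have h0 : (0 : ℝ) ≤ n := n.cast_nonneg
  obtain ⟨h1, h2⟩ := H.step_sq n hn
  have h3 : (l * (n : ℝ) ^ (-ρ / 2)) ^ 2 = l ^ 2 * (n : ℝ) ^ (-ρ) := by
    rw [mul_pow, ← Real.rpow_two ((n : ℝ) ^ _), ← Real.rpow_mul h0]
    ring_nf
  have h4 : 0 ≤ l * (n : ℝ) ^ (-ρ / 2) := mul_nonneg H.length_pos.le (Real.rpow_nonneg h0 _)
  exact (sq_eq_sq₀ h1.le h4).1 (h2.trans h3.symm)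

theorem ratio_pos (H : Scaling κ Cm Cp l ρ lam σ) {n : ℕ} (hn : 1 ≤ n) (i : Fin n) :
    0 < σ n / lam n i := div_pos (H.step_sq n hn).1 (H.lam_pos n i)

/-- The smallest scales, at i = n, dominate. The bound tends to 0 exactly when ρ > 2κ. -/
theorem ratio_le (H : Scaling κ Cm Cp l ρ lam σ) {n : ℕ} (hn : 1 ≤ n) (i : Fin n) :
    σ n / lam n i ≤ l / Cm * (n : ℝ) ^ (κ - ρ / 2) := by
  have hn0 : (0 : ℝ) < n := by exact_mod_cast hn
  have hi0 : (0 : ℝ) < (i : ℕ) + 1 := by positivity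
  have hi : ((i : ℕ) + 1 : ℝ) ≤ n := by exact_mod_cast i.2
  have hc := H.lower_pos
  have hσ := (H.step_sq n hn).1
  calc σ n / lam n i ≤ σ n / (Cm * ((i : ℕ) + 1 : ℝ) ^ (-κ)) :=
        div_le_div_of_nonneg_left hσ.le (by positivity) (H.bounds n i).1
    _ = σ n / Cm * ((i : ℕ) + 1 : ℝ) ^ κ := by
        rw [Real.rpow_neg hi0.le]; field_simp
    _ ≤ σ n / Cm * (n : ℝ) ^ κ :=
        mul_le_mul_of_nonneg_left (Real.rpow_le_rpow hi0.le hi H.exponent_nonneg) (by positivity)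
    _ = _ := by
        rw [H.step_eq hn, show κ - ρ / 2 = κ + (-ρ / 2) by ring, Real.rpow_add hn0]
        ring

theorem tendsto_bound (c : ℝ) (h : 2 * κ < ρ) :
    Tendsto (fun n : ℕ => c * (n : ℝ) ^ (κ - ρ / 2)) atTop (𝓝 0) := by
  have := (tendsto_rpow_neg_atTop (y := ρ / 2 - κ) (by linarith)).comp
    tendsto_natCast_atTop_atTop
  have h2 := this.const_mul c
  simpa [Function.comp_def] using h2

end Scaling

/-! ### Moments of the weighted norms -/

/-- The second moment of x_i is of order i^{-2κ}, so i^{2t} x_i² has mean of order i^{2(t-κ)}, which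
is summable for t < κ - 1/2. The set r allows the same bound for the whole state, its first
coordinates and its tail. -/
theorem Regular.integral_sNorm_scaledState_le {g : ℝ → ℝ} (hg : Regular g) {n : ℕ} {κ C : ℝ}
    {lam : Fin n → ℝ} (hl : ∀ i, 0 < lam i) (hu : ∀ i : Fin n, lam i ≤ C * ((i : ℕ) + 1 : ℝ) ^ (-κ))
    (t : ℝ) (r : Finset (Fin n)) :
    Integrable (fun ξ => sNorm t (scaledState lam (restrictTo r ξ))) (productLaw g n) ∧
      ∫ ξ, sNorm t (scaledState lam (restrictTo r ξ)) ∂(productLaw g n) ≤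
        √(C ^ 2 * (∫ q, q.1 ^ 2 ∂(pairMeasure g)) *
          ∑ i : Fin n, if i ∈ r then ((i : ℕ) + 1 : ℝ) ^ (2 * (t - κ)) else 0) := by
  have := hg.isProbabilityMeasure_productLaw n
  set m := ∫ q, q.1 ^ 2 ∂(pairMeasure g)
  have hm0 : 0 ≤ m := integral_nonneg fun q => sq_nonneg _
  have hi2 : Integrable (fun q : ℝ × ℝ => q.1 ^ 2) (pairMeasure g) :=
    hg.integrable_of_polyDom (polyDom_fst.pow one_le_growthWeight 2) (by fun_prop)
  have hcoord (i : Fin n) (ξ : Fin n → ℝ × ℝ) : scaledState lam (restrictTo r ξ) i ^ 2 =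
      (if i ∈ r then lam i ^ 2 else 0) * (ξ i).1 ^ 2 := by
    simp only [scaledState, restrictTo]
    split_ifs
    · ring
    · simp
  have hii (i : Fin n) : Integrable (fun ξ => (if i ∈ r then lam i ^ 2 else 0) * (ξ i).1 ^ 2)
      (productLaw g n) := (hg.integrable_eval i hi2).const_mul _
  obtain ⟨h1, h2⟩ := integral_sNorm_le (P := productLaw g n) t
    (u := fun ξ => scaledState lam (restrictTo r ξ))
    ((measurable_scaledState lam).comp (measurable_restrictTo r))
    (c := fun i => (if i ∈ r then lam i ^ 2 else 0) * m)
    (fun i => by simpa only [hcoord] using hii i) (fun i => by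
      simp only [hcoord]
      rw [integral_const_mul, hg.integral_eval i (F := fun q => q.1 ^ 2) (by fun_prop)])
  refine ⟨h1, h2.trans (Real.sqrt_le_sqrt ?_)⟩
  rw [Finset.mul_sum]
  refine Finset.sum_le_sum fun i _ => ?_
  split_ifs with hir
  · have hi0 : (0 : ℝ) < (i : ℕ) + 1 := by positivity
    have e : ((i : ℕ) + 1 : ℝ) ^ (2 * (t - κ)) =
        ((i : ℕ) + 1 : ℝ) ^ (2 * t) * (((i : ℕ) + 1 : ℝ) ^ (-κ)) ^ 2 := by
      rw [← Real.rpow_two (_ ^ (-κ)), ← Real.rpow_mul hi0.le, ← Real.rpow_add hi0]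
      ring_nf
    rw [e]
    have h3 := pow_le_pow_left₀ (hl i).le (hu i) 2
    calc _ ≤ ((i : ℕ) + 1 : ℝ) ^ (2 * t) * ((C * ((i : ℕ) + 1 : ℝ) ^ (-κ)) ^ 2 * m) := by gcongr
      _ = _ := by ring
  · simp

theorem scaledState_sub_restrictTo {n : ℕ} (lam : Fin n → ℝ) (s : Finset (Fin n))
    (ξ : Fin n → ℝ × ℝ) :
    scaledState lam ξ - scaledState lam (restrictTo s ξ) = scaledState lam (restrictTo sᶜ ξ) := by
  ext j
  simp only [scaledState, restrictTo, Pi.sub_apply, Finset.mem_compl]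
  split_ifs <;> simp

theorem Algorithm.abs_step_sub_le (alg : Algorithm) (g : ℝ → ℝ) {h : ℝ} (h0 : 0 ≤ h)
    (x z : ℝ) : |alg.step g h x z - x - h * z| ≤ h * (h * |deriv g x|) := by
  cases alg with
  | rwm =>
    have : Algorithm.rwm.step g h x z - x - h * z = 0 := by simp only [step]; ring
    rw [this, abs_zero]
    positivity
  | sla =>
    have : Algorithm.sla.step g h x z - x - h * z = -(h * (h * deriv g x) / 2) := by
      simp only [step]; ring
    rw [this, abs_neg, abs_div, abs_mul, abs_mul, abs_of_nonneg h0, abs_two]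
    have : 0 ≤ h * (h * |deriv g x|) := by positivity
    linarith

theorem Algorithm.abs_scaledProposal_sub_le (alg : Algorithm) (g : ℝ → ℝ) {n : ℕ}
    {lam : Fin n → ℝ} {σ : ℝ} (hσ : 0 < σ) (i : Fin n) (hl : 0 < lam i)
    (ξ : Fin n → ℝ × ℝ) :
    |alg.scaledProposal g lam σ ξ i - scaledState lam ξ i - σ * (ξ i).2| ≤
      σ * (σ / lam i * |deriv g (ξ i).1|) := by
  have h := alg.abs_step_sub_le g (h := σ / lam i) (by positivity) (ξ i).1 (ξ i).2
  have e : alg.scaledProposal g lam σ ξ i - scaledState lam ξ i - σ * (ξ i).2 =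
      lam i * (alg.step g (σ / lam i) (ξ i).1 (ξ i).2 - (ξ i).1 - σ / lam i * (ξ i).2) := by
    simp only [Algorithm.scaledProposal, scaledState]
    field_simp
  rw [e, abs_mul, abs_of_pos hl]
  calc _ ≤ lam i * (σ / lam i * (σ / lam i * |deriv g (ξ i).1|)) := by gcongr
    _ = _ := by field_simp

theorem Regular.polyDom_deriv_fst {g : ℝ → ℝ} (hg : Regular g) :
    PolyDom growthWeight fun q : ℝ × ℝ => deriv g q.1 := by
  obtain ⟨C, m, hC, hb⟩ := hg.polyDom_deriv
  refine ⟨C, m, hC, fun q => (hb q.1).trans ?_⟩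
  have h : 1 + |q.1| ≤ growthWeight q :=
    le_mul_of_one_le_right (by positivity) (by linarith [abs_nonneg q.2])
  exact mul_le_mul_of_nonneg_left (pow_le_pow_left₀ (by positivity) h m) hC

/-- Each coordinate moves by σ times a variable with bounded second moment, and i^{2t} ≤ n^{2κ}
i^{2(t-κ)} with a summable second factor. In the regime ρ > 2κ the product σ² n^{2κ} tends to 0, so
one step is negligible in the norm. -/
theorem Regular.exists_integral_sNorm_proposal_sub_le {g : ℝ → ℝ} (hg : Regular g)
    (alg : Algorithm) {κ t : ℝ} (hκ : 0 ≤ κ) (ht : t < κ - 1 / 2) :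
    ∃ D, 0 ≤ D ∧ ∀ (n : ℕ) (lam : Fin n → ℝ) (σ : ℝ), (∀ i, 0 < lam i) → 0 < σ →
      (∀ i, σ / lam i ≤ 1) →
      Integrable (fun ξ => sNorm t (alg.scaledProposal g lam σ ξ - scaledState lam ξ))
        (productLaw g n) ∧
      ∫ ξ, sNorm t (alg.scaledProposal g lam σ ξ - scaledState lam ξ) ∂(productLaw g n) ≤
        √(D * (σ ^ 2 * (n : ℝ) ^ (2 * κ))) := by
  set G : ℝ × ℝ → ℝ := fun q => (|q.2| + |deriv g q.1|) ^ 2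
  have hGm : Measurable G := by
    have := hg.continuous_deriv.measurable
    fun_prop
  have hGi : Integrable G (pairMeasure g) :=
    hg.integrable_of_polyDom ((polyDom_snd.abs.add one_le_growthWeight hg.polyDom_deriv_fst.abs).pow
      one_le_growthWeight 2) hGm
  have hG0 : 0 ≤ ∫ q, G q ∂(pairMeasure g) := integral_nonneg fun q => sq_nonneg _
  have hsum : Summable fun j : ℕ => ((j : ℝ) + 1) ^ (2 * (t - κ)) :=
    summable_succ_rpow (by linarith)
  have hT0 : 0 ≤ ∑' j : ℕ, ((j : ℝ) + 1) ^ (2 * (t - κ)) := tsum_nonneg fun j => by positivity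
  refine ⟨(∫ q, G q ∂(pairMeasure g)) * ∑' j : ℕ, ((j : ℝ) + 1) ^ (2 * (t - κ)), by positivity,
    fun n lam σ hl hσ h1 => ?_⟩
  have := hg.isProbabilityMeasure_productLaw n
  have hmy := hg.measurable_scaledProposal alg lam σ
  have hmx := measurable_scaledState lam
  have hpt (i : Fin n) (ξ : Fin n → ℝ × ℝ) :
      (alg.scaledProposal g lam σ ξ - scaledState lam ξ) i ^ 2 ≤ σ ^ 2 * G (ξ i) := by
    have h2 := alg.abs_scaledProposal_sub_le g hσ i (hl i) ξ
    have h3 : |(alg.scaledProposal g lam σ ξ - scaledState lam ξ) i| ≤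
        σ * (|(ξ i).2| + |deriv g (ξ i).1|) := by
      have h4 := abs_add_le (alg.scaledProposal g lam σ ξ i - scaledState lam ξ i - σ * (ξ i).2)
        (σ * (ξ i).2)
      rw [sub_add_cancel, abs_mul, abs_of_pos hσ] at h4
      have h5 : σ * (σ / lam i * |deriv g (ξ i).1|) ≤ σ * |deriv g (ξ i).1| :=
        mul_le_mul_of_nonneg_left (mul_le_of_le_one_left (abs_nonneg _) (h1 i)) hσ.le
      rw [Pi.sub_apply, mul_add]
      linarith
    have h4 := pow_le_pow_left₀ (abs_nonneg _) h3 2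
    rwa [sq_abs, mul_pow] at h4
  have hbi (i : Fin n) : Integrable (fun ξ => σ ^ 2 * G (ξ i)) (productLaw g n) :=
    (hg.integrable_eval i hGi).const_mul _
  have hii (i : Fin n) : Integrable (fun ξ =>
      (alg.scaledProposal g lam σ ξ - scaledState lam ξ) i ^ 2) (productLaw g n) := by
    refine (hbi i).mono' ?_ (ae_of_all _ fun ξ => ?_)
    · have : Measurable fun ξ => (alg.scaledProposal g lam σ ξ - scaledState lam ξ) i :=
        (measurable_pi_apply i).comp (hmy.sub hmx)
      exact (this.pow_const 2).aestronglyMeasurable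
    · rw [Real.norm_of_nonneg (sq_nonneg _)]
      exact hpt i ξ
  obtain ⟨r1, r2⟩ := integral_sNorm_le (P := productLaw g n) t (hmy.sub hmx)
    (c := fun _ => σ ^ 2 * ∫ q, G q ∂(pairMeasure g)) hii fun i => by
      refine (integral_mono (hii i) (hbi i) (hpt i)).trans ?_
      rw [integral_const_mul, hg.integral_eval i hGm]
  refine ⟨r1, r2.trans (Real.sqrt_le_sqrt ?_)⟩
  have h6 : ∑ i : Fin n, ((i : ℕ) + 1 : ℝ) ^ (2 * t) ≤
      (∑' j : ℕ, ((j : ℝ) + 1) ^ (2 * (t - κ))) * (n : ℝ) ^ (2 * κ) := by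
    calc _ ≤ ∑ i : Fin n, ((i : ℕ) + 1 : ℝ) ^ (2 * (t - κ)) * (n : ℝ) ^ (2 * κ) := by
          refine Finset.sum_le_sum fun i _ => ?_
          have hi0 : (0 : ℝ) < (i : ℕ) + 1 := by positivity
          have hi : ((i : ℕ) + 1 : ℝ) ≤ n := by exact_mod_cast i.2
          have e : ((i : ℕ) + 1 : ℝ) ^ (2 * t) =
              ((i : ℕ) + 1 : ℝ) ^ (2 * (t - κ)) * ((i : ℕ) + 1 : ℝ) ^ (2 * κ) := by
            rw [← Real.rpow_add hi0]; ring_nf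
          rw [e]
          exact mul_le_mul_of_nonneg_left (Real.rpow_le_rpow hi0.le hi (by positivity))
            (by positivity)
      _ ≤ _ := by
          rw [← Finset.sum_mul]
          exact mul_le_mul_of_nonneg_right (sum_fin_le_tsum hsum (fun j => by positivity) n)
            (by positivity)
  rw [← Finset.sum_mul]
  calc _ ≤ (∑' j : ℕ, ((j : ℝ) + 1) ^ (2 * (t - κ))) * (n : ℝ) ^ (2 * κ) *
        (σ ^ 2 * ∫ q, G q ∂(pairMeasure g)) := by gcongr
    _ = _ := by ring

/-! ### Changes of measure do not affect the limits -/

theorem exists_pos_mul_sqrt_add_le (K : ℝ) {ε : ℝ} (hε : 0 < ε) :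
    ∃ e > 0, K * (4 * √e) + e ≤ ε := by
  have h : Tendsto (fun e : ℝ => K * (4 * √e) + e) (𝓝[>] 0) (𝓝 0) := by
    have hc : Continuous fun e : ℝ => K * (4 * √e) + e := by fun_prop
    have := hc.tendsto 0
    simp only [Real.sqrt_zero, mul_zero, add_zero] at this
    exact this.mono_left nhdsWithin_le_nhds
  obtain ⟨e, h1, h2⟩ := ((h.eventually (gt_mem_nhds hε)).and self_mem_nhdsWithin).exists
  exact ⟨e, h2, h1.le⟩

/-- The mean acceptance probability weighted by a function of the noise in a fixed coordinate is
asymptotically the mean acceptance probability under the reference law. -/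
theorem Regular.eventually_abs_integral_weighted_sub_le {g : ℝ → ℝ} (hg : Regular g)
    (alg : Algorithm) {κ Cm Cp l ρ : ℝ} {lam : (n : ℕ) → Fin n → ℝ} {σ : ℕ → ℝ}
    (H : Scaling κ Cm Cp l ρ lam σ) (hρ : 2 * κ < ρ) {φ ψ : (n : ℕ) → (Fin n → ℝ) → ℝ}
    (hφ : ∀ n : ℕ, 1 ≤ n → Measurable (φ n))
    (hP : ∀ n : ℕ, 1 ≤ n → IsProbabilityMeasure (target g (lam n) (φ n)))
    (hψ : ∀ n : ℕ, 1 ≤ n → ψ n =ᵐ[refMeasure g (lam n)] φ n)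
    (hM : UnifBoundedBelow ψ) (hL : LocalLipGrowth κ ψ) {v : ℝ → ℝ} (hv : Measurable v)
    (hv0 : ∀ z, 0 ≤ v z) (hv2 : MemLp v 2 (gaussianReal 0 1))
    (hv1 : ∫ z, v z ∂(gaussianReal 0 1) = 1) (i : ℕ) {ε : ℝ} (hε : 0 < ε) :
    ∀ᶠ n in atTop, ∀ hi : i < n,
      |∫ ξ, Real.exp (-ψ n (scaledState (lam n) ξ)) *
          (alg.acceptScaled g (lam n) (ψ n) (σ n) ξ * v (ξ ⟨i, hi⟩).2) ∂(productLaw g n) -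
        ∫ ξ, cutExp (alg.totalRatio g (fun j => σ n / lam n j) ξ) ∂(productLaw g n)| ≤ ε := by
  classical
  obtain ⟨M, hM⟩ := hM
  obtain ⟨δ, C, p, s, s', s'', -, hδ, -, -, hs, hs', -, hL⟩ := hL
  set V2 := ∫ z, v z ^ 2 ∂(gaussianReal 0 1)
  -- The comparison bound contains 1 + 2 + 1 square roots of quantities that will each be at most e,
  -- and one such quantity without a root.
  obtain ⟨e, he, hee⟩ := exists_pos_mul_sqrt_add_le (Real.exp (-M) * √V2) hε
  set m := ∫ q, q.1 ^ 2 ∂(pairMeasure g)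
  have hm0 : 0 ≤ m := integral_nonneg fun q => sq_nonneg _
  obtain ⟨D, hD, hDb⟩ := hg.exists_integral_sNorm_proposal_sub_le alg H.exponent_nonneg hs
  obtain ⟨D', hD', hDb'⟩ := hg.exists_integral_sNorm_proposal_sub_le alg H.exponent_nonneg hs'
  have hsum : Summable fun j : ℕ => ((j : ℝ) + 1) ^ (2 * (s - κ)) :=
    summable_succ_rpow (by linarith)
  have hsum' : Summable fun j : ℕ => ((j : ℝ) + 1) ^ (2 * (s' - κ)) :=
    summable_succ_rpow (by linarith)
  set A₀ := √(Cp ^ 2 * m * ∑' j : ℕ, ((j : ℝ) + 1) ^ (2 * (s - κ)))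
  have hA₀ : 0 ≤ A₀ := Real.sqrt_nonneg _
  obtain ⟨η, hη, hηb⟩ := exists_integral_min_le s s' hδ (A₀ + √D) he
  have hCp := H.upper_pos
  -- The tail of the state beyond N₀ then has squared norm of mean at most η², uniformly in n; the
  -- +1 keeps the denominator positive when the second moment m is not known to be.
  obtain ⟨N₀, hN₀⟩ := exists_sum_fin_tail_le hsum' (ε := η ^ 2 / (Cp ^ 2 * m + 1)) (by positivity)
  -- The coordinate i must belong to the retained block. N does not depend on n, so the share of
  -- this block in the log ratio vanishes as n → ∞.
  set N := max N₀ (i + 1)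
  obtain ⟨B, hB, hBb⟩ := hg.exists_integral_abs_partialRatio_le alg
  have lim1 : Tendsto (fun n : ℕ => l / Cm * (n : ℝ) ^ (κ - ρ / 2)) atTop (𝓝 0) :=
    Scaling.tendsto_bound _ hρ
  have lim2 : Tendsto (fun n : ℕ => (N : ℝ) * (B * (l / Cm * (n : ℝ) ^ (κ - ρ / 2)) ^ alg.order))
      atTop (𝓝 0) := by
    have := ((lim1.pow alg.order).const_mul B).const_mul (N : ℝ)
    simpa [alg.order_pos.ne'] using this
  have lim3 : Tendsto (fun n : ℕ => σ n ^ 2 * (n : ℝ) ^ (2 * κ)) atTop (𝓝 0) := by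
    have h1 : Tendsto (fun n : ℕ => (l * (n : ℝ) ^ (κ - ρ / 2)) ^ 2) atTop (𝓝 0) := by
      simpa using (Scaling.tendsto_bound l hρ).pow 2
    refine h1.congr' ?_
    filter_upwards [eventually_ge_atTop 1] with n hn
    have hn0 : (0 : ℝ) < n := by exact_mod_cast hn
    rw [(H.step_sq n hn).2, mul_pow, ← Real.rpow_two (_ ^ _), ← Real.rpow_mul hn0.le, mul_assoc,
      ← Real.rpow_add hn0]
    ring_nf
  have lim4 : Tendsto (fun n : ℕ => √(D' * (σ n ^ 2 * (n : ℝ) ^ (2 * κ)))) atTop (𝓝 0) := by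
    simpa using (lim3.const_mul D').sqrt
  filter_upwards [eventually_ge_atTop 1, hM, hL, lim1.eventually (ge_mem_nhds zero_lt_one),
    lim2.eventually (ge_mem_nhds he), lim3.eventually (ge_mem_nhds zero_lt_one),
    lim4.eventually (ge_mem_nhds hη)] with n hn hMn hLn l1 l2 l3 l4 hi
  have := hg.isProbabilityMeasure_productLaw n
  have hcont := continuous_of_sNorm_lipschitz hδ hLn.1
  have hψm := hcont.measurable
  have hσ := (H.step_sq n hn).1
  have hl := H.lam_pos n
  have hh0 := H.ratio_pos hn
  have hh1 := H.ratio_le hn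
  set S : Finset (Fin n) := Finset.univ.filter fun j => (j : ℕ) < N
  have hcard : (S.card : ℝ) ≤ N := by
    have : S.card ≤ (Finset.range N).card :=
      Finset.card_le_card_of_injOn (fun j => (j : ℕ)) (fun j hj => by simpa [S] using hj)
        (fun a _ b _ hab => Fin.ext hab)
    rw [Finset.card_range] at this
    exact_mod_cast this
  have hiS : (⟨i, hi⟩ : Fin n) ∈ S := by simp [S, N]
  obtain ⟨pr1, pr2⟩ := hBb n (fun j => σ n / lam n j) _ S hh0 hh1 l1
  have main := hg.abs_integral_weighted_sub_le alg (lam := lam n) (σ := σ n) hψm hMn hv hv0 hv2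
    ⟨i, hi⟩ S hiS (by
      rw [hg.integral_exp_neg_eq_one hl (hφ n hn) (hψ n hn) (hP n hn) hv, hv1]) pr1
  have mx := measurable_scaledState (lam n)
  have my := hg.measurable_scaledProposal alg (lam n) (σ n)
  have mS := measurable_restrictTo S
  have hu := fun j => (H.bounds n j).2
  have mom (r : Finset (Fin n)) :
      Integrable (fun ξ => sNorm s (scaledState (lam n) (restrictTo r ξ))) (productLaw g n) ∧
      ∫ ξ, sNorm s (scaledState (lam n) (restrictTo r ξ)) ∂(productLaw g n) ≤ A₀ := by
    obtain ⟨q1, q2⟩ := hg.integral_sNorm_scaledState_le hl hu s r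
    refine ⟨q1, q2.trans (Real.sqrt_le_sqrt (mul_le_mul_of_nonneg_left ?_ (by positivity)))⟩
    refine (Finset.sum_le_sum fun j _ => ?_).trans
      (sum_fin_le_tsum hsum (fun j => by positivity) n)
    split_ifs
    · exact le_rfl
    · positivity
  have huniv (ξ : Fin n → ℝ × ℝ) : restrictTo Finset.univ ξ = ξ := by ext1 j; simp [restrictTo]
  obtain ⟨x1, x2⟩ := mom Finset.univ
  simp only [huniv] at x1 x2
  obtain ⟨t1, t2⟩ := mom S
  have hle1 (j) := (hh1 j).trans l1
  obtain ⟨y1, y2⟩ := hDb n (lam n) (σ n) hl hσ hle1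
  obtain ⟨z1, z2⟩ := hDb' n (lam n) (σ n) hl hσ hle1
  have y3 : √(D * (σ n ^ 2 * (n : ℝ) ^ (2 * κ))) ≤ √D :=
    Real.sqrt_le_sqrt (mul_le_of_le_one_right hD l3)
  have ytri (ξ : Fin n → ℝ × ℝ) : sNorm s (alg.scaledProposal g (lam n) (σ n) ξ) ≤
      sNorm s (scaledState (lam n) ξ) +
        sNorm s (alg.scaledProposal g (lam n) (σ n) ξ - scaledState (lam n) ξ) := by
    have := sNorm_add_le s (scaledState (lam n) ξ)
      (alg.scaledProposal g (lam n) (σ n) ξ - scaledState (lam n) ξ)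
    rwa [add_sub_cancel] at this
  have w1 : Integrable (fun ξ => sNorm s (alg.scaledProposal g (lam n) (σ n) ξ))
      (productLaw g n) :=
    (x1.add y1).mono' ((continuous_sNorm s).measurable.comp my).aestronglyMeasurable
      (ae_of_all _ fun ξ => by
        rw [Real.norm_of_nonneg (sNorm_nonneg _ _)]; exact ytri ξ)
  have w2 : ∫ ξ, sNorm s (alg.scaledProposal g (lam n) (σ n) ξ) ∂(productLaw g n) ≤ A₀ + √D := by
    refine (integral_mono w1 (x1.add y1) ytri).trans ?_
    rw [integral_add' x1 y1]
    linarith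
  have hD2 := Real.sqrt_nonneg D
  have d1 := hηb n (ψ n) hψm hLn.1 (productLaw g n) this (scaledState (lam n))
    (alg.scaledProposal g (lam n) (σ n)) mx my x1 w1 z1 (by linarith) w2 (z2.trans l4)
  have hdiff (ξ : Fin n → ℝ × ℝ) := scaledState_sub_restrictTo (lam n) S ξ
  obtain ⟨v1, v2⟩ := hg.integral_sNorm_scaledState_le hl hu s' Sᶜ
  simp only [← hdiff] at v1 v2
  have v3 : ∫ ξ, sNorm s' (scaledState (lam n) ξ - scaledState (lam n) (restrictTo S ξ))
      ∂(productLaw g n) ≤ η := by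
    refine v2.trans (Real.sqrt_le_iff.2 ⟨hη.le, ?_⟩)
    have e1 : ∑ j : Fin n, (if j ∈ Sᶜ then ((j : ℕ) + 1 : ℝ) ^ (2 * (s' - κ)) else 0) ≤
        η ^ 2 / (Cp ^ 2 * m + 1) := by
      refine le_trans (le_of_eq ?_) (hN₀ N (le_max_left _ _) n)
      refine Finset.sum_congr rfl fun j _ => ?_
      simp only [S, Finset.mem_compl, Finset.mem_filter, Finset.mem_univ, true_and]
      split_ifs <;> rfl
    calc _ ≤ Cp ^ 2 * m * (η ^ 2 / (Cp ^ 2 * m + 1)) := by gcongr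
      _ ≤ η ^ 2 := by
        rw [mul_div_assoc', div_le_iff₀ (by positivity)]
        nlinarith [sq_nonneg η]
  have d2 := hηb n (ψ n) hψm hLn.1 (productLaw g n) this
    (fun ξ => scaledState (lam n) (restrictTo S ξ)) (scaledState (lam n)) (mx.comp mS) mx t1 x1 v1
    (by linarith) (by linarith) v3
  have d3 : ∫ ξ, |alg.partialRatio g (fun j => σ n / lam n j) S ξ| ∂(productLaw g n) ≤ e := by
    refine (pr2.trans (mul_le_mul_of_nonneg_right hcard ?_)).trans l2
    have : 0 ≤ l / Cm * (n : ℝ) ^ (κ - ρ / 2) := (hh0 ⟨i, hi⟩).le.trans (hh1 _)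
    positivity
  refine main.trans (le_trans ?_ hee)
  have s1 := Real.sqrt_le_sqrt d1
  have s2 := Real.sqrt_le_sqrt d2
  have s3 := Real.sqrt_le_sqrt d3
  have hK : 0 ≤ √V2 := Real.sqrt_nonneg _
  rw [mul_assoc]
  refine add_le_add (mul_le_mul_of_nonneg_left ?_ (Real.exp_pos _).le) d3
  rw [mul_comm]
  exact mul_le_mul_of_nonneg_left (by linarith) hK

/-! ### Asymptotics of the sums of step sizes -/

theorem Algorithm.index_mul_order (alg : Algorithm) : alg.index * alg.order = 1 := by
  cases alg <;> norm_num [index, order]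

theorem Algorithm.index_pos (alg : Algorithm) : 0 < alg.index := by
  cases alg <;> norm_num [index]

theorem Algorithm.scaleSum_eq (alg : Algorithm) (κ : ℝ) {n : ℕ} (lam : Fin n → ℝ) :
    alg.scaleSum κ lam =
      (n : ℝ) ^ (-(2 * alg.order * κ + 1)) * ∑ i, (lam i ^ (2 * alg.order))⁻¹ := by
  cases alg <;> norm_num [scaleSum, order]

/-- With τ = 1/L the quotient K/τ is KL; by the convention for division by zero this also covers L =
0. -/
theorem Algorithm.limitAccept_eq (alg : Algorithm) (g : ℝ → ℝ) (L l : ℝ) :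
    alg.limitAccept g (1 / L) l =
      2 * cdf (gaussianReal 0 1) (-(l ^ alg.order * √(alg.K g * L) / 2)) := by
  cases alg <;> simp only [limitAccept, order, div_div_eq_mul_div, div_one, pow_one] <;>
    congr 2 <;> ring

/-- Pairing each index with its reflection: the two bases add up to n + 1, so at least one of them
is at least n/2. -/
theorem sum_fin_succ_rpow_ge {p : ℝ} (hp : 0 ≤ p) (n : ℕ) :
    (n : ℝ) / 2 * ((n : ℝ) / 2) ^ p ≤ ∑ i : Fin n, ((i : ℕ) + 1 : ℝ) ^ p := by
  have e : ∑ i : Fin n, ((i.rev : ℕ) + 1 : ℝ) ^ p = ∑ i : Fin n, ((i : ℕ) + 1 : ℝ) ^ p :=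
    Equiv.sum_comp Fin.revPerm fun i : Fin n => ((i : ℕ) + 1 : ℝ) ^ p
  have h : ∑ _i : Fin n, ((n : ℝ) / 2) ^ p ≤
      ∑ i : Fin n, (((i.rev : ℕ) + 1 : ℝ) ^ p + ((i : ℕ) + 1 : ℝ) ^ p) := by
    refine Finset.sum_le_sum fun i _ => ?_
    have h0 : (0 : ℝ) ≤ (n : ℝ) / 2 := by positivity
    have p1 : (0 : ℝ) ≤ ((i.rev : ℕ) + 1 : ℝ) ^ p := by positivity
    have p2 : (0 : ℝ) ≤ ((i : ℕ) + 1 : ℝ) ^ p := by positivity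
    have hs : ((i.rev : ℕ) : ℝ) + ((i : ℕ) + 1 : ℝ) = n := by
      have : (i.rev : ℕ) + (i + 1) = n := by rw [Fin.val_rev]; omega
      exact_mod_cast this
    rcases le_total ((n : ℝ) / 2) ((i : ℕ) + 1) with h1 | h1
    · linarith [Real.rpow_le_rpow h0 h1 hp]
    · have h2 : (n : ℝ) / 2 ≤ (i.rev : ℕ) + 1 := by linarith
      linarith [Real.rpow_le_rpow h0 h2 hp]
  rw [Finset.sum_add_distrib, e] at h
  simp only [Finset.sum_const, Finset.card_univ, Fintype.card_fin, nsmul_eq_mul] at h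
  linarith

namespace Scaling

variable {κ Cm Cp l ρ : ℝ} {lam : (n : ℕ) → Fin n → ℝ} {σ : ℕ → ℝ}

/-- The identity behind the critical exponent: since order times index is 1, the power of n left
over is m(2κ + I - ρ), and its sign decides the regime. -/
theorem sum_ratio_eq (H : Scaling κ Cm Cp l ρ lam σ) (alg : Algorithm) {n : ℕ} (hn : 1 ≤ n) :
    ∑ i, (σ n / lam n i) ^ (2 * alg.order) = l ^ (2 * alg.order) *
      (n : ℝ) ^ (alg.order * (2 * κ + alg.index - ρ)) * alg.scaleSum κ (lam n) := by
  have hn0 : (0 : ℝ) < n := by exact_mod_cast hn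
  have e1 : ((n : ℝ) ^ (-ρ / 2)) ^ (2 * alg.order) = (n : ℝ) ^ (-ρ * alg.order) := by
    rw [← Real.rpow_natCast, ← Real.rpow_mul hn0.le]
    push_cast
    ring_nf
  have e2 : (n : ℝ) ^ (alg.order * (2 * κ + alg.index - ρ)) *
      (n : ℝ) ^ (-(2 * alg.order * κ + 1)) = (n : ℝ) ^ (-ρ * alg.order) := by
    rw [← Real.rpow_add hn0]
    congr 1
    have := alg.index_mul_order
    linear_combination this
  rw [alg.scaleSum_eq, mul_assoc, ← mul_assoc ((n : ℝ) ^ _), e2, Finset.mul_sum, Finset.mul_sum]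
  refine Finset.sum_congr rfl fun i _ => ?_
  rw [div_pow, H.step_eq hn, mul_pow, e1]
  ring

theorem scaleSum_nonneg (H : Scaling κ Cm Cp l ρ lam σ) (alg : Algorithm) (n : ℕ) :
    0 ≤ alg.scaleSum κ (lam n) := by
  rw [alg.scaleSum_eq]
  exact mul_nonneg (by positivity) (Finset.sum_nonneg fun i _ =>
    inv_nonneg.2 (pow_nonneg (H.lam_pos n i).le _))

/-- Outside the critical limit statements no convergence of the normalized sums is assumed; these
bounds, which follow from the size of the scales alone, take its place. -/
theorem exists_scaleSum_bounds (H : Scaling κ Cm Cp l ρ lam σ) (alg : Algorithm) :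
    ∃ c > 0, ∃ C, 0 ≤ C ∧ ∀ n : ℕ, 1 ≤ n →
      c ≤ alg.scaleSum κ (lam n) ∧ alg.scaleSum κ (lam n) ≤ C := by
  set k := 2 * alg.order
  have hCm := H.lower_pos
  have hCp := H.upper_pos
  have hκ := H.exponent_nonneg
  have epow (c : ℝ) (n : ℕ) (i : Fin n) : ((c * ((i : ℕ) + 1 : ℝ) ^ (-κ)) ^ k)⁻¹ =
      (c ^ k)⁻¹ * ((i : ℕ) + 1 : ℝ) ^ (k * κ) := by
    have hi0 : (0 : ℝ) < (i : ℕ) + 1 := by positivity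
    rw [mul_pow, mul_inv, ← Real.rpow_natCast (_ ^ (-κ)), ← Real.rpow_mul hi0.le,
      ← Real.rpow_neg hi0.le]
    ring_nf
  refine ⟨(Cp ^ k)⁻¹ * ((1 / 2) * (1 / 2) ^ (k * κ)), by positivity, (Cm ^ k)⁻¹, by positivity,
    fun n hn => ?_⟩
  have hn0 : (0 : ℝ) < n := by exact_mod_cast hn
  have en : (n : ℝ) ^ (-(2 * alg.order * κ + 1)) * ((n : ℝ) * (n : ℝ) ^ (k * κ)) = 1 := by
    rw [mul_comm (n : ℝ), ← Real.rpow_add_one hn0.ne', ← Real.rpow_add hn0]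
    simp only [k]
    push_cast
    rw [show -(2 * (alg.order : ℝ) * κ + 1) + (2 * alg.order * κ + 1) = 0 by ring,
      Real.rpow_zero]
  rw [alg.scaleSum_eq]
  constructor
  · have h1 : (Cp ^ k)⁻¹ * ((n : ℝ) / 2 * ((n : ℝ) / 2) ^ (k * κ)) ≤ ∑ i, (lam n i ^ k)⁻¹ := by
      refine (mul_le_mul_of_nonneg_left (sum_fin_succ_rpow_ge (by positivity) n)
        (by positivity)).trans ?_
      rw [Finset.mul_sum]
      refine Finset.sum_le_sum fun i _ => ?_
      rw [← epow]
      exact inv_anti₀ (pow_pos (H.lam_pos n i) _)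
        (pow_le_pow_left₀ (H.lam_pos n i).le (H.bounds n i).2 _)
    refine le_trans (le_of_eq ?_) (mul_le_mul_of_nonneg_left h1 (by positivity))
    rw [div_eq_mul_one_div (n : ℝ) 2, Real.mul_rpow hn0.le (by norm_num)]
    linear_combination (-((Cp ^ k)⁻¹ * ((1 / 2) * (1 / 2) ^ (k * κ)))) * en
  · have h1 : ∑ i, (lam n i ^ k)⁻¹ ≤ (Cm ^ k)⁻¹ * ((n : ℝ) * (n : ℝ) ^ (k * κ)) := by
      calc _ ≤ ∑ _i : Fin n, (Cm ^ k)⁻¹ * (n : ℝ) ^ (k * κ) := by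
            refine Finset.sum_le_sum fun i _ => ?_
            have hi0 : (0 : ℝ) < (i : ℕ) + 1 := by positivity
            have hi : ((i : ℕ) + 1 : ℝ) ≤ n := by exact_mod_cast i.2
            refine (inv_anti₀ (by positivity)
              (pow_le_pow_left₀ (by positivity) (H.bounds n i).1 k)).trans ?_
            rw [epow]
            exact mul_le_mul_of_nonneg_left (Real.rpow_le_rpow hi0.le hi (by positivity))
              (by positivity)
        _ = _ := by
            simp only [Finset.sum_const, Finset.card_univ, Fintype.card_fin, nsmul_eq_mul]
            ring
    refine (mul_le_mul_of_nonneg_left h1 (by positivity)).trans (le_of_eq ?_)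
    linear_combination (Cm ^ k)⁻¹ * en

/-- Two-sided bounds for the sum that governs the size of the log acceptance ratio. -/
theorem exists_sum_ratio_bounds (H : Scaling κ Cm Cp l ρ lam σ) (alg : Algorithm) :
    ∃ c > 0, ∃ C, 0 ≤ C ∧ ∀ n : ℕ, 1 ≤ n →
      c * (n : ℝ) ^ (alg.order * (2 * κ + alg.index - ρ)) ≤
        ∑ i, (σ n / lam n i) ^ (2 * alg.order) ∧
      ∑ i, (σ n / lam n i) ^ (2 * alg.order) ≤
        C * (n : ℝ) ^ (alg.order * (2 * κ + alg.index - ρ)) := by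
  obtain ⟨c, hc, C, hC, hb⟩ := H.exists_scaleSum_bounds alg
  have hl := H.length_pos
  refine ⟨l ^ (2 * alg.order) * c, by positivity, l ^ (2 * alg.order) * C, by positivity,
    fun n hn => ?_⟩
  obtain ⟨h1, h2⟩ := hb n hn
  rw [H.sum_ratio_eq alg hn]
  constructor
  · calc _ = l ^ (2 * alg.order) * (n : ℝ) ^ (alg.order * (2 * κ + alg.index - ρ)) * c := by ring
      _ ≤ _ := by gcongr
  · calc _ ≤ l ^ (2 * alg.order) * (n : ℝ) ^ (alg.order * (2 * κ + alg.index - ρ)) * C := by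
          gcongr
      _ = _ := by ring

theorem eventually_ratio (H : Scaling κ Cm Cp l ρ lam σ) (h : 2 * κ < ρ) {δ : ℝ} (hδ : 0 < δ) :
    ∀ᶠ n in atTop, ∀ i, 0 < σ n / lam n i ∧ σ n / lam n i < δ := by
  filter_upwards [eventually_ge_atTop 1,
    (tendsto_bound (l / Cm) h).eventually (gt_mem_nhds hδ)] with n hn hb i
  exact ⟨H.ratio_pos hn i, (H.ratio_le hn i).trans_lt hb⟩

end Scaling

/-! ### The product case -/

theorem Regular.tendsto_productAccept {g : ℝ → ℝ} (hg : Regular g) (alg : Algorithm)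
    {κ Cm Cp l ρ : ℝ} {lam : (n : ℕ) → Fin n → ℝ} {σ : ℕ → ℝ} (H : Scaling κ Cm Cp l ρ lam σ)
    {L : ℝ} (hL : Tendsto (fun n : ℕ => alg.scaleSum κ (lam n)) atTop (𝓝 L))
    (hρ : ρ = 2 * κ + alg.index) :
    Tendsto (fun n => ∫ ξ, cutExp (alg.totalRatio g (fun j => σ n / lam n j) ξ)
      ∂(productLaw g n)) atTop (𝓝 (alg.limitAccept g (1 / L) l)) := by
  have hI := alg.index_pos
  have hL0 : 0 ≤ L := ge_of_tendsto' hL fun n => H.scaleSum_nonneg alg n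
  have hK := hg.K_pos alg
  have hl := H.length_pos
  have hS : Tendsto (fun n => ∑ i, (σ n / lam n i) ^ (2 * alg.order)) atTop
      (𝓝 (l ^ (2 * alg.order) * L)) := by
    refine (hL.const_mul (l ^ (2 * alg.order))).congr' ?_
    filter_upwards [eventually_ge_atTop 1] with n hn
    rw [H.sum_ratio_eq alg hn, hρ, sub_self, mul_zero, Real.rpow_zero, mul_one]
  have hs : alg.K g * (l ^ (2 * alg.order) * L) = (l ^ alg.order * √(alg.K g * L)) ^ 2 := by
    rw [mul_pow, Real.sq_sqrt (by positivity)]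
    ring
  have h := hg.tendsto_integral_totalRatio alg (h := fun n j => σ n / lam n j)
    (Scaling.tendsto_bound (l / Cm) (by linarith : 2 * κ < ρ)) (by
      filter_upwards [eventually_ge_atTop 1] with n hn i
      exact ⟨H.ratio_pos hn i, H.ratio_le hn i⟩) hS hs
  rwa [integral_cutExp_gaussianReal (by positivity), ← alg.limitAccept_eq] at h

theorem Regular.integral_cutExp_mem {g : ℝ → ℝ} (hg : Regular g) (alg : Algorithm) {n : ℕ}
    (h : Fin n → ℝ) : Integrable (fun ξ => cutExp (alg.totalRatio g h ξ)) (productLaw g n) ∧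
      ∫ ξ, cutExp (alg.totalRatio g h ξ) ∂(productLaw g n) ≤ 1 := by
  have := hg.isProbabilityMeasure_productLaw n
  have hi : Integrable (fun ξ => cutExp (alg.totalRatio g h ξ)) (productLaw g n) :=
    (integrable_const (1 : ℝ)).mono'
      (continuous_cutExp.measurable.comp (hg.measurable_totalRatio alg h)).aestronglyMeasurable
      (ae_of_all _ fun ξ => by
        rw [Real.norm_of_nonneg (cutExp_nonneg _)]; exact cutExp_le_one _)
  exact ⟨hi, by simpa using integral_mono hi (integrable_const (1 : ℝ)) fun ξ => cutExp_le_one _⟩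

/-- The mean size of the log acceptance ratio, for small steps. -/
theorem Regular.exists_integral_abs_totalRatio_le {g : ℝ → ℝ} (hg : Regular g) (alg : Algorithm)
    {κ Cm Cp l ρ : ℝ} {lam : (n : ℕ) → Fin n → ℝ} {σ : ℕ → ℝ} (H : Scaling κ Cm Cp l ρ lam σ)
    (hρ : 2 * κ < ρ) :
    ∃ B, 0 ≤ B ∧ ∀ᶠ n : ℕ in atTop,
      Integrable (alg.totalRatio g fun j => σ n / lam n j) (productLaw g n) ∧
      ∫ ξ, |alg.totalRatio g (fun j => σ n / lam n j) ξ| ∂(productLaw g n) ≤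
        √(B * (n : ℝ) ^ (alg.order * (2 * κ + alg.index - ρ)) +
          (B * (n : ℝ) ^ (alg.order * (2 * κ + alg.index - ρ))) ^ 2) := by
  obtain ⟨B, hB, hb⟩ := hg.exists_integral_totalRatio_sq_le alg
  obtain ⟨c, -, C, hC, hs⟩ := H.exists_sum_ratio_bounds alg
  refine ⟨B * C, by positivity, ?_⟩
  filter_upwards [eventually_ge_atTop 1, H.eventually_ratio hρ zero_lt_one] with n hn hr
  have := hg.isProbabilityMeasure_productLaw n
  have hL := hg.memLp_totalRatio alg (fun i => (hr i).1.le) fun i => (hr i).2.le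
  refine ⟨hL.integrable (by norm_num), (integral_abs_le_sqrt hL).trans (Real.sqrt_le_sqrt ?_)⟩
  refine (hb n _ (fun i => (hr i).1) fun i => (hr i).2.le).trans ?_
  have h1 := mul_le_mul_of_nonneg_left (hs n hn).2 hB
  rw [← mul_assoc] at h1
  have h0 : 0 ≤ B * ∑ i, (σ n / lam n i) ^ (2 * alg.order) :=
    mul_nonneg hB (Finset.sum_nonneg fun i _ => by
      have := (hr i).1
      positivity)
  gcongr

/-- From min(1, e^R) ≥ 1 - |R| and E|R| → 0. -/
theorem Regular.tendsto_productAccept_one {g : ℝ → ℝ} (hg : Regular g) (alg : Algorithm)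
    {κ Cm Cp l ρ : ℝ} {lam : (n : ℕ) → Fin n → ℝ} {σ : ℕ → ℝ} (H : Scaling κ Cm Cp l ρ lam σ)
    (hρ : 2 * κ + alg.index < ρ) :
    Tendsto (fun n => ∫ ξ, cutExp (alg.totalRatio g (fun j => σ n / lam n j) ξ)
      ∂(productLaw g n)) atTop (𝓝 1) := by
  have hI := alg.index_pos
  have hm : (0 : ℝ) < alg.order := by exact_mod_cast alg.order_pos
  obtain ⟨B, -, hb⟩ := hg.exists_integral_abs_totalRatio_le alg H (by linarith)
  have h0 : Tendsto (fun n : ℕ => (n : ℝ) ^ (alg.order * (2 * κ + alg.index - ρ))) atTop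
      (𝓝 0) := by
    have hy : 0 < alg.order * (ρ - 2 * κ - alg.index) := mul_pos hm (by linarith)
    refine ((tendsto_rpow_neg_atTop hy).comp tendsto_natCast_atTop_atTop).congr fun n => ?_
    simp only [Function.comp]
    ring_nf
  have h1 : Tendsto (fun n : ℕ => 1 - √(B * (n : ℝ) ^ (alg.order * (2 * κ + alg.index - ρ)) +
      (B * (n : ℝ) ^ (alg.order * (2 * κ + alg.index - ρ))) ^ 2)) atTop (𝓝 1) := by
    simpa using ((h0.const_mul B).add ((h0.const_mul B).pow 2)).sqrt.const_sub 1
  refine tendsto_of_tendsto_of_tendsto_of_le_of_le' h1 tendsto_const_nhds ?_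
    (Eventually.of_forall fun n => (hg.integral_cutExp_mem alg _).2)
  filter_upwards [hb] with n hn
  have := hg.isProbabilityMeasure_productLaw n
  have h2 := integral_mono ((integrable_const (1 : ℝ)).sub hn.1.abs)
    (hg.integral_cutExp_mem alg fun j => σ n / lam n j).1 fun ξ => one_sub_le_cutExp _
  rw [integral_sub' (integrable_const _) hn.1.abs] at h2
  simp only [integral_const, probReal_univ, one_smul] at h2
  have := hn.2
  linarith

/-- The convex function e^{-|t|} lies above its tangent at |t| = u. Taking expectations with u ≥
E|R| gives the lower bound e^{-u}, even when E|R| is large. -/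
theorem exp_neg_mul_le_cutExp (t u : ℝ) : Real.exp (-u) * (1 + u - |t|) ≤ cutExp t := by
  have h1 : Real.exp (-u) * (1 + u - |t|) ≤ Real.exp (-|t|) := by
    have : Real.exp (-|t|) = Real.exp (-u) * Real.exp (u - |t|) := by
      rw [← Real.exp_add]; ring_nf
    rw [this]
    exact mul_le_mul_of_nonneg_left (by linarith [Real.add_one_le_exp (u - |t|)])
      (Real.exp_pos _).le
  refine h1.trans (le_min (Real.exp_le_one_iff.2 (by simp)) (Real.exp_le_exp.2 (neg_abs_le t)))

theorem Regular.eventually_productAccept_ge {g : ℝ → ℝ} (hg : Regular g) (alg : Algorithm)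
    {κ Cm Cp l ρ : ℝ} {lam : (n : ℕ) → Fin n → ℝ} {σ : ℕ → ℝ} (H : Scaling κ Cm Cp l ρ lam σ)
    (hρ : 2 * κ + alg.index ≤ ρ) :
    ∃ c > 0, ∀ᶠ n : ℕ in atTop,
      c ≤ ∫ ξ, cutExp (alg.totalRatio g (fun j => σ n / lam n j) ξ) ∂(productLaw g n) := by
  have hI := alg.index_pos
  obtain ⟨B, hB, hb⟩ := hg.exists_integral_abs_totalRatio_le alg H (by linarith)
  refine ⟨Real.exp (-√(B + B ^ 2)), Real.exp_pos _, ?_⟩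
  filter_upwards [hb, eventually_ge_atTop 1] with n hn hn1
  have := hg.isProbabilityMeasure_productLaw n
  have h0 : (n : ℝ) ^ (alg.order * (2 * κ + alg.index - ρ)) ≤ 1 :=
    Real.rpow_le_one_of_one_le_of_nonpos (by exact_mod_cast hn1)
      (mul_nonpos_of_nonneg_of_nonpos (Nat.cast_nonneg _) (by linarith))
  have h3 : B * (n : ℝ) ^ (alg.order * (2 * κ + alg.index - ρ)) ≤ B := mul_le_of_le_one_right hB h0
  have h4 : 0 ≤ B * (n : ℝ) ^ (alg.order * (2 * κ + alg.index - ρ)) := by positivity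
  have h5 := hn.2.trans (Real.sqrt_le_sqrt (add_le_add h3 (pow_le_pow_left₀ h4 h3 2)))
  set u := √(B + B ^ 2)
  have h2 := integral_mono
    (((integrable_const (1 + u)).sub hn.1.abs).const_mul (Real.exp (-u)))
    (hg.integral_cutExp_mem alg fun j => σ n / lam n j).1 fun ξ => exp_neg_mul_le_cutExp _ u
  rw [integral_const_mul, integral_sub' (integrable_const _) hn.1.abs] at h2
  simp only [integral_const, probReal_univ, one_smul] at h2
  refine le_trans ?_ h2
  refine le_mul_of_one_le_right (Real.exp_pos _).le ?_
  linarith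

theorem tendsto_rpow_mul_exp_neg_rpow {c θ : ℝ} (hc : 0 < c) (hθ : 0 < θ) (p : ℝ) :
    Tendsto (fun n : ℕ => (n : ℝ) ^ p * Real.exp (-(c * (n : ℝ) ^ θ))) atTop (𝓝 0) := by
  have h := (tendsto_rpow_mul_exp_neg_mul_atTop_nhds_zero (p / θ) c hc).comp
    ((tendsto_rpow_atTop hθ).comp tendsto_natCast_atTop_atTop)
  refine h.congr fun n => ?_
  simp only [Function.comp]
  rw [← Real.rpow_mul n.cast_nonneg, mul_div_cancel₀ _ hθ.ne', neg_mul]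

theorem Regular.tendsto_rpow_mul_integral_exp_half {g : ℝ → ℝ} (hg : Regular g)
    (alg : Algorithm) {κ Cm Cp l ρ : ℝ} {lam : (n : ℕ) → Fin n → ℝ} {σ : ℕ → ℝ}
    (H : Scaling κ Cm Cp l ρ lam σ) (h1 : 2 * κ < ρ) (h2 : ρ < 2 * κ + alg.index) (p : ℝ) :
    Tendsto (fun n : ℕ => (n : ℝ) ^ p *
      ∫ ξ, Real.exp (alg.totalRatio g (fun j => σ n / lam n j) ξ / 2) ∂(productLaw g n)) atTop
      (𝓝 0) := by
  obtain ⟨c, hc, δ, hδ, hb⟩ := hg.integral_exp_half_totalRatio_le alg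
  obtain ⟨c', hc', C, -, hs⟩ := H.exists_sum_ratio_bounds alg
  have hm : (0 : ℝ) < alg.order := by exact_mod_cast alg.order_pos
  refine squeeze_zero' (Eventually.of_forall fun n => mul_nonneg (by positivity)
    (integral_nonneg fun ξ => (Real.exp_pos _).le)) ?_ (tendsto_rpow_mul_exp_neg_rpow
      (mul_pos hc hc') (mul_pos hm (by linarith : 0 < 2 * κ + alg.index - ρ)) p)
  filter_upwards [eventually_ge_atTop 1, H.eventually_ratio h1 hδ] with n hn hr
  refine mul_le_mul_of_nonneg_left ((hb n _ (fun i => (hr i).1) fun i => (hr i).2).trans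
    (Real.exp_le_exp.2 (neg_le_neg ?_))) (by positivity)
  rw [mul_assoc]
  exact mul_le_mul_of_nonneg_left (hs n hn).1 hc.le

/-! ### The mean acceptance probability -/

theorem Regular.meanAccept_mem {g : ℝ → ℝ} (hg : Regular g) (alg : Algorithm) {n : ℕ}
    {lam : Fin n → ℝ} (hl : ∀ i, 0 < lam i) {σ : ℝ} (hσ : 0 < σ) {φ : (Fin n → ℝ) → ℝ}
    (hP : IsProbabilityMeasure (target g lam φ)) :
    0 ≤ meanAccept alg g lam φ σ ∧ meanAccept alg g lam φ σ ≤ 1 := by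
  have := isProbabilityMeasure_stdGauss n
  have hm (v : (Fin n → ℝ) × (Fin n → ℝ)) :=
    hg.accept_mem alg hl hσ φ v.1 (proposal alg g lam σ v.1 v.2)
  refine ⟨integral_nonneg fun v => (hm v).1, (le_abs_self _).trans ?_⟩
  have := norm_integral_le_of_norm_le_const (μ := (target g lam φ).prod (stdGauss n)) (C := 1)
    (ae_of_all _ fun v => by rw [Real.norm_of_nonneg (hm v).1]; exact (hm v).2)
  simpa [meanAccept] using this

/-- The bound by e^{(r+a-b)/2} leaves the symmetric factor e^{-(a+b)/2}, so a lower bound on the two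
values suffices and no upper bound is required. -/
theorem exp_neg_mul_cutExp_le {M a b : ℝ} (ha : M ≤ a) (hb : M ≤ b) (r : ℝ) :
    Real.exp (-a) * cutExp (r + a - b) ≤ Real.exp (-M) * Real.exp (r / 2) := by
  refine (mul_le_mul_of_nonneg_left (cutExp_le_exp_half _) (Real.exp_pos _).le).trans ?_
  rw [← Real.exp_add, ← Real.exp_add]
  exact Real.exp_le_exp.2 (by linarith)

theorem mul_cutExp_le_cutExp_add {d s : ℝ} (hd : 0 ≤ d) (hs : -d ≤ s) (r : ℝ) :
    Real.exp (-d) * cutExp r ≤ cutExp (r + s) := by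
  refine le_min ?_ ?_
  · exact mul_le_one₀ (Real.exp_le_one_iff.2 (by linarith)) (cutExp_nonneg r) (cutExp_le_one r)
  · rw [add_comm, Real.exp_add]
    exact mul_le_mul (Real.exp_le_exp.2 hs) (min_le_right _ _) (cutExp_nonneg r)
      (Real.exp_pos _).le

theorem Regular.meanAccept_le {g : ℝ → ℝ} (hg : Regular g) (alg : Algorithm) {n : ℕ}
    {lam : Fin n → ℝ} (hl : ∀ i, 0 < lam i) {σ : ℝ} (hσ : 0 < σ) {φ : (Fin n → ℝ) → ℝ}
    (hφ : Measurable φ) {M : ℝ} (hM : ∀ᵐ x ∂(refMeasure g lam), M ≤ φ x) :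
    meanAccept alg g lam φ σ ≤ Real.exp (-M) *
      ∫ ξ, Real.exp (alg.totalRatio g (fun j => σ / lam j) ξ / 2) ∂(productLaw g n) := by
  rw [hg.meanAccept_eq alg hl hσ hφ (ae_eq_refl φ), ← integral_const_mul]
  refine integral_mono_of_nonneg
    (ae_of_all _ fun ξ => mul_nonneg (Real.exp_pos _).le (cutExp_nonneg _))
    ((hg.integrable_exp_half_totalRatio alg fun i => (div_pos hσ (hl i)).ne').const_mul _) ?_
  filter_upwards [hg.ae_scaledProposal alg hl hσ hM] with ξ hξ
  exact exp_neg_mul_cutExp_le hξ.1 hξ.2 _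

/-- The density of the target loses at most e^{-M}, and the change of φ in one step at most e^{-2M}.
-/
theorem Regular.meanAccept_ge {g : ℝ → ℝ} (hg : Regular g) (alg : Algorithm) {n : ℕ}
    {lam : Fin n → ℝ} (hl : ∀ i, 0 < lam i) {σ : ℝ} (hσ : 0 < σ) {φ : (Fin n → ℝ) → ℝ}
    (hφ : Measurable φ) {M : ℝ} (hM0 : 0 ≤ M) (hM : ∀ᵐ x ∂(refMeasure g lam), |φ x| ≤ M) :
    Real.exp (-(3 * M)) *
      ∫ ξ, cutExp (alg.totalRatio g (fun j => σ / lam j) ξ) ∂(productLaw g n) ≤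
      meanAccept alg g lam φ σ := by
  have := hg.isProbabilityMeasure_productLaw n
  have hae := hg.ae_scaledProposal alg hl hσ hM
  have mx := measurable_scaledState lam
  have my := hg.measurable_scaledProposal alg lam σ
  have mR := hg.measurable_totalRatio alg fun j => σ / lam j
  have mc := continuous_cutExp.measurable
  rw [hg.meanAccept_eq alg hl hσ hφ (ae_eq_refl φ), ← integral_const_mul]
  unfold Algorithm.acceptScaled
  refine integral_mono_ae ((hg.integral_cutExp_mem alg _).1.const_mul _)
    ((integrable_const (Real.exp M)).mono' (Measurable.aestronglyMeasurable (by fun_prop)) ?_) ?_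
  · filter_upwards [hae] with ξ hξ
    rw [Real.norm_of_nonneg (mul_nonneg (Real.exp_pos _).le (cutExp_nonneg _))]
    exact (mul_le_of_le_one_right (Real.exp_pos _).le (cutExp_le_one _)).trans
      (Real.exp_le_exp.2 (by linarith [abs_le.1 hξ.1]))
  · filter_upwards [hae] with ξ hξ
    have h1 := abs_le.1 hξ.1
    have h2 := abs_le.1 hξ.2
    have h3 := mul_cutExp_le_cutExp_add (d := 2 * M) (by linarith)
      (s := φ (scaledState lam ξ) - φ (alg.scaledProposal g lam σ ξ)) (by linarith)
      (alg.totalRatio g (fun j => σ / lam j) ξ)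
    have h4 : Real.exp (-M) ≤ Real.exp (-φ (scaledState lam ξ)) :=
      Real.exp_le_exp.2 (by linarith)
    have h5 : Real.exp (-(3 * M)) = Real.exp (-M) * Real.exp (-(2 * M)) := by
      rw [← Real.exp_add]; ring_nf
    rw [h5, mul_assoc, add_sub_assoc]
    exact mul_le_mul h4 h3 (mul_nonneg (Real.exp_pos _).le (cutExp_nonneg _)) (Real.exp_pos _).le

section Limits

variable {g : ℝ → ℝ} {κ Cm Cp l ρ : ℝ} {lam : (n : ℕ) → Fin n → ℝ} {σ : ℕ → ℝ}
  {φ ψ : (n : ℕ) → (Fin n → ℝ) → ℝ}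

theorem eventually_ae_le (hψ : ∀ n : ℕ, 1 ≤ n → ψ n =ᵐ[refMeasure g (lam n)] φ n)
    (hM : UnifBoundedBelow ψ) :
    ∃ M : ℝ, ∀ᶠ n in atTop, ∀ᵐ x ∂(refMeasure g (lam n)), M ≤ φ n x := by
  obtain ⟨M, hM⟩ := hM
  refine ⟨M, ?_⟩
  filter_upwards [hM, eventually_ge_atTop 1] with n h1 hn
  filter_upwards [hψ n hn] with x hx
  exact hx ▸ h1 x

theorem UnifBounded.below (h : UnifBounded ψ) : UnifBoundedBelow ψ := by
  obtain ⟨M, -, h⟩ := h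
  exact ⟨-M, h.mono fun n hn x => (abs_le.1 (hn x)).1⟩

theorem Regular.tendsto_rpow_mul_meanAccept (hg : Regular g) (alg : Algorithm)
    (H : Scaling κ Cm Cp l ρ lam σ) (h1 : 2 * κ < ρ) (h2 : ρ < 2 * κ + alg.index)
    (hφ : ∀ n : ℕ, 1 ≤ n → Measurable (φ n))
    (hψ : ∀ n : ℕ, 1 ≤ n → ψ n =ᵐ[refMeasure g (lam n)] φ n)
    (hP : ∀ n : ℕ, 1 ≤ n → IsProbabilityMeasure (target g (lam n) (φ n)))
    (hM : UnifBoundedBelow ψ) (p : ℝ) :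
    Tendsto (fun n : ℕ => (n : ℝ) ^ p * meanAccept alg g (lam n) (φ n) (σ n)) atTop (𝓝 0) := by
  obtain ⟨M, hM⟩ := eventually_ae_le hψ hM
  have h := (hg.tendsto_rpow_mul_integral_exp_half alg H h1 h2 p).const_mul (Real.exp (-M))
  rw [mul_zero] at h
  refine squeeze_zero' ?_ ?_ h
  · filter_upwards [eventually_ge_atTop 1] with n hn
    exact mul_nonneg (by positivity)
      (hg.meanAccept_mem alg (H.lam_pos n) (H.step_sq n hn).1 (hP n hn)).1
  · filter_upwards [eventually_ge_atTop 1, hM] with n hn hMn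
    rw [mul_left_comm]
    exact mul_le_mul_of_nonneg_left
      (hg.meanAccept_le alg (H.lam_pos n) (H.step_sq n hn).1 (hφ n hn) hMn) (by positivity)

theorem Regular.liminf_meanAccept_pos (hg : Regular g) (alg : Algorithm)
    (H : Scaling κ Cm Cp l ρ lam σ) (hρ : 2 * κ + alg.index ≤ ρ)
    (hφ : ∀ n : ℕ, 1 ≤ n → Measurable (φ n))
    (hψ : ∀ n : ℕ, 1 ≤ n → ψ n =ᵐ[refMeasure g (lam n)] φ n)
    (hP : ∀ n : ℕ, 1 ≤ n → IsProbabilityMeasure (target g (lam n) (φ n)))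
    (hM : UnifBounded ψ) :
    0 < liminf (fun n : ℕ => meanAccept alg g (lam n) (φ n) (σ n)) atTop := by
  obtain ⟨M, hM0, hM⟩ := hM
  obtain ⟨c, hc, hb⟩ := hg.eventually_productAccept_ge alg H hρ
  -- The upper bound 1 is needed for the real-valued liminf to be meaningful.
  have hub : IsBoundedUnder (· ≤ ·) atTop
      (fun n : ℕ => meanAccept alg g (lam n) (φ n) (σ n)) := by
    refine isBoundedUnder_of_eventually_le (a := 1) ?_
    filter_upwards [eventually_ge_atTop 1] with n hn
    exact (hg.meanAccept_mem alg (H.lam_pos n) (H.step_sq n hn).1 (hP n hn)).2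
  refine lt_of_lt_of_le (mul_pos (Real.exp_pos (-(3 * M))) hc)
    (le_liminf_of_le hub.isCoboundedUnder_ge ?_)
  filter_upwards [eventually_ge_atTop 1, hM, hb] with n hn hMn hbn
  have hae : ∀ᵐ x ∂(refMeasure g (lam n)), |φ n x| ≤ M := by
    filter_upwards [hψ n hn] with x hx
    exact hx ▸ hMn x
  exact (mul_le_mul_of_nonneg_left hbn (Real.exp_pos _).le).trans
    (hg.meanAccept_ge alg (H.lam_pos n) (H.step_sq n hn).1 (hφ n hn) hM0.le hae)

theorem Regular.tendsto_meanAccept_sub (hg : Regular g) (alg : Algorithm)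
    (H : Scaling κ Cm Cp l ρ lam σ) (hρ : 2 * κ < ρ)
    (hφ : ∀ n : ℕ, 1 ≤ n → Measurable (φ n))
    (hψ : ∀ n : ℕ, 1 ≤ n → ψ n =ᵐ[refMeasure g (lam n)] φ n)
    (hP : ∀ n : ℕ, 1 ≤ n → IsProbabilityMeasure (target g (lam n) (φ n)))
    (hM : UnifBoundedBelow ψ) (hL : LocalLipGrowth κ ψ) :
    Tendsto (fun n => meanAccept alg g (lam n) (φ n) (σ n) -
      ∫ ξ, cutExp (alg.totalRatio g (fun j => σ n / lam n j) ξ) ∂(productLaw g n)) atTop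
      (𝓝 0) := by
  rw [Metric.tendsto_nhds]
  intro ε hε
  -- The weight V = 1 involves no coordinate, so the choice of coordinate 0 is arbitrary.
  filter_upwards [hg.eventually_abs_integral_weighted_sub_le alg H hρ hφ hP hψ hM hL
    (v := fun _ => 1) measurable_const (fun _ => zero_le_one) (memLp_const 1) (by simp) 0
    (half_pos hε), eventually_ge_atTop 1] with n h hn
  rw [hg.meanAccept_eq alg (H.lam_pos n) (H.step_sq n hn).1 (hφ n hn) (hψ n hn),
    Real.dist_eq, sub_zero]
  have h1 := h hn
  simp only [mul_one] at h1
  linarith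

theorem Regular.tendsto_meanAccept (hg : Regular g) (alg : Algorithm)
    (H : Scaling κ Cm Cp l ρ lam σ) (hρ : 2 * κ < ρ)
    (hφ : ∀ n : ℕ, 1 ≤ n → Measurable (φ n))
    (hψ : ∀ n : ℕ, 1 ≤ n → ψ n =ᵐ[refMeasure g (lam n)] φ n)
    (hP : ∀ n : ℕ, 1 ≤ n → IsProbabilityMeasure (target g (lam n) (φ n)))
    (hM : UnifBoundedBelow ψ) (hL : LocalLipGrowth κ ψ) {a : ℝ}
    (ha : Tendsto (fun n => ∫ ξ, cutExp (alg.totalRatio g (fun j => σ n / lam n j) ξ)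
      ∂(productLaw g n)) atTop (𝓝 a)) :
    Tendsto (fun n => meanAccept alg g (lam n) (φ n) (σ n)) atTop (𝓝 a) := by
  simpa using (hg.tendsto_meanAccept_sub alg H hρ hφ hψ hP hM hL).add ha

/-! ### The mean squared jump -/

theorem abs_sq_sub_sq_le {d z σ h a : ℝ} (hσ : 0 < σ) (h0 : 0 ≤ h) (h1 : h ≤ 1) (ha : 0 ≤ a)
    (hd : |d - σ * z| ≤ σ * (h * a)) :
    |d ^ 2 - σ ^ 2 * z ^ 2| ≤ σ ^ 2 * h * (|z| + a) ^ 2 := by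
  have e : d ^ 2 - σ ^ 2 * z ^ 2 = (d - σ * z) * ((d - σ * z) + 2 * (σ * z)) := by ring
  have h2 : |(d - σ * z) + 2 * (σ * z)| ≤ σ * (a + 2 * |z|) := by
    refine (abs_add_le _ _).trans ?_
    rw [abs_mul, abs_mul, abs_two, abs_of_pos hσ]
    have : σ * (h * a) ≤ σ * a :=
      mul_le_mul_of_nonneg_left (mul_le_of_le_one_left ha h1) hσ.le
    linarith
  rw [e, abs_mul]
  calc _ ≤ σ * (h * a) * (σ * (a + 2 * |z|)) :=
        mul_le_mul hd h2 (abs_nonneg _) (by positivity)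
    _ = σ ^ 2 * h * (a * (a + 2 * |z|)) := by ring
    _ ≤ _ := by
        refine mul_le_mul_of_nonneg_left ?_ (by positivity)
        nlinarith [sq_nonneg |z|]

/-- A bound for the squared jump in units of the step size. -/
def jumpWeight (g : ℝ → ℝ) (q : ℝ × ℝ) : ℝ := (|q.2| + |deriv g q.1|) ^ 2

theorem jumpWeight_nonneg (g : ℝ → ℝ) (q : ℝ × ℝ) : 0 ≤ jumpWeight g q := sq_nonneg _

theorem Regular.measurable_jumpWeight (hg : Regular g) : Measurable (jumpWeight g) := by
  have := hg.continuous_deriv.measurable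
  unfold jumpWeight
  fun_prop

theorem Regular.memLp_jumpWeight (hg : Regular g) : MemLp (jumpWeight g) 2 (pairMeasure g) := by
  have hp : PolyDom growthWeight (jumpWeight g) :=
    (polyDom_snd.abs.add one_le_growthWeight hg.polyDom_deriv_fst.abs).pow one_le_growthWeight 2
  exact (memLp_two_iff_integrable_sq hg.measurable_jumpWeight.aestronglyMeasurable).2
    (hg.integrable_of_polyDom (hp.pow one_le_growthWeight 2)
      (hg.measurable_jumpWeight.pow_const 2))

theorem abs_sqDist_sub_le (alg : Algorithm) (g : ℝ → ℝ) {n : ℕ} {lam : Fin n → ℝ} {σ : ℝ}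
    (hσ : 0 < σ) (i : Fin n) (hl : 0 < lam i) (h1 : σ / lam i ≤ 1) (ξ : Fin n → ℝ × ℝ) :
    |(alg.scaledProposal g lam σ ξ i - scaledState lam ξ i) ^ 2 - σ ^ 2 * (ξ i).2 ^ 2| ≤
      σ ^ 2 * (σ / lam i) * jumpWeight g (ξ i) :=
  abs_sq_sub_sq_le hσ (by positivity) h1 (abs_nonneg _)
    (alg.abs_scaledProposal_sub_le g hσ i hl ξ)

theorem sqDist_le (alg : Algorithm) (g : ℝ → ℝ) {n : ℕ} {lam : Fin n → ℝ} {σ : ℝ}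
    (hσ : 0 < σ) (i : Fin n) (hl : 0 < lam i) (h1 : σ / lam i ≤ 1) (ξ : Fin n → ℝ × ℝ) :
    (alg.scaledProposal g lam σ ξ i - scaledState lam ξ i) ^ 2 ≤
      2 * σ ^ 2 * jumpWeight g (ξ i) := by
  have h2 := (abs_le.1 (abs_sqDist_sub_le alg g hσ i hl h1 ξ)).2
  have h3 : (ξ i).2 ^ 2 ≤ jumpWeight g (ξ i) := by
    rw [← sq_abs (ξ i).2]
    exact pow_le_pow_left₀ (abs_nonneg _) (by linarith [abs_nonneg (deriv g (ξ i).1)]) 2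
  have h4 : σ ^ 2 * (σ / lam i) * jumpWeight g (ξ i) ≤ σ ^ 2 * jumpWeight g (ξ i) :=
    mul_le_mul_of_nonneg_right (mul_le_of_le_one_right (sq_nonneg _) h1) (jumpWeight_nonneg _ _)
  have h5 := mul_le_mul_of_nonneg_left h3 (sq_nonneg σ)
  linarith

/-- The mean squared jump in one step, compared with the mean acceptance probability. -/
theorem Regular.meanSqJump_bounds (hg : Regular g) (alg : Algorithm) {n : ℕ} {lam : Fin n → ℝ}
    {σ : ℝ} (hσ : 0 < σ) (hl : ∀ i, 0 < lam i) {φ ψ : (Fin n → ℝ) → ℝ} (hφ : Measurable φ)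
    (hψ : Measurable ψ) (he : ψ =ᵐ[refMeasure g lam] φ) {M : ℝ} (hM : ∀ x, M ≤ ψ x)
    (i : Fin n) (h1 : σ / lam i ≤ 1) :
    Integrable (sqJump alg g lam φ σ i) (stepLaw g lam φ) ∧
    |meanSqJump alg g lam φ σ i - σ ^ 2 * ∫ ξ, Real.exp (-ψ (scaledState lam ξ)) *
        (alg.acceptScaled g lam ψ σ ξ * (ξ i).2 ^ 2) ∂(productLaw g n)| ≤
      σ ^ 2 * (σ / lam i * (Real.exp (-M) * ∫ q, jumpWeight g q ∂(pairMeasure g))) ∧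
    0 ≤ meanSqJump alg g lam φ σ i ∧
    meanSqJump alg g lam φ σ i ≤ 2 * σ ^ 2 * (Real.exp (-M) *
      (√(Real.exp M * meanAccept alg g lam φ σ) *
        √(∫ q, jumpWeight g q ^ 2 ∂(pairMeasure g)))) := by
  have hP := hg.isProbabilityMeasure_productLaw n
  have := hg.isProbabilityMeasure_pairMeasure
  have mx := measurable_scaledState lam
  have my := hg.measurable_scaledProposal alg lam σ
  have mG := hg.measurable_jumpWeight
  have mR := hg.measurable_totalRatio alg fun j => σ / lam j
  have mc := continuous_cutExp.measurable
  set P := productLaw g n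
  set b := Real.exp (-M)
  let w : (Fin n → ℝ × ℝ) → ℝ := fun ξ => Real.exp (-ψ (scaledState lam ξ))
  let a : (Fin n → ℝ × ℝ) → ℝ := alg.acceptScaled g lam ψ σ
  let d : (Fin n → ℝ × ℝ) → ℝ := fun ξ =>
    (alg.scaledProposal g lam σ ξ i - scaledState lam ξ i) ^ 2
  have mw : Measurable w := by fun_prop
  have ma : Measurable a := by
    simp only [a]
    unfold Algorithm.acceptScaled
    fun_prop
  have md : Measurable d := by fun_prop
  have w0 (ξ) : 0 ≤ w ξ := (Real.exp_pos _).le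
  have wb (ξ) : w ξ ≤ b := Real.exp_le_exp.2 (neg_le_neg (hM _))
  have a0 (ξ) : 0 ≤ a ξ := cutExp_nonneg _
  have a1 (ξ) : a ξ ≤ 1 := cutExp_le_one _
  have wa0 (ξ) : 0 ≤ w ξ * a ξ := mul_nonneg (w0 ξ) (a0 ξ)
  have wab (ξ) : w ξ * a ξ ≤ b := (mul_le_of_le_one_right (w0 ξ) (a1 ξ)).trans (wb ξ)
  have hGL : MemLp (fun ξ => jumpWeight g (ξ i)) 2 P :=
    hg.memLp_jumpWeight.comp_measurePreserving (hg.measurePreserving_eval i)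
  have hGi : Integrable (fun ξ => jumpWeight g (ξ i)) P := hGL.integrable (by norm_num)
  have hd0 (ξ) : 0 ≤ d ξ := sq_nonneg _
  have hd (ξ) : d ξ ≤ 2 * σ ^ 2 * jumpWeight g (ξ i) := sqDist_le alg g hσ i (hl i) h1 ξ
  have hdi : Integrable d P := (hGi.const_mul (2 * σ ^ 2)).mono' md.aestronglyMeasurable
    (ae_of_all _ fun ξ => by rw [Real.norm_of_nonneg (hd0 ξ)]; exact hd ξ)
  have hbd {F : (Fin n → ℝ × ℝ) → ℝ} (hF : Integrable F P) :
      Integrable (fun ξ => w ξ * (a ξ * F ξ)) P := by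
    have := hF.bdd_mul (c := b) (mw.mul ma).aestronglyMeasurable (ae_of_all _ fun ξ => by
      rw [Pi.mul_apply, Real.norm_of_nonneg (wa0 ξ)]; exact wab ξ)
    simpa only [Pi.mul_apply, mul_assoc] using this
  obtain ⟨hI, hE⟩ := hg.meanSqJump_eq alg hl hσ hφ he i (hdi.mul_bdd (c := b)
    mw.aestronglyMeasurable (ae_of_all _ fun ξ => by
      rw [Real.norm_of_nonneg (w0 ξ)]; exact wb ξ))
  have hE' : meanSqJump alg g lam φ σ i = ∫ ξ, w ξ * (a ξ * d ξ) ∂P := hE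
  have hz : Integrable (fun ξ : Fin n → ℝ × ℝ => (ξ i).2 ^ 2) P :=
    (hg.measurePreserving_eval_snd i).integrable_comp_of_integrable
      (g := fun z : ℝ => z ^ 2) (integrable_pow_gaussianReal 2)
  have hcomp : ∫ ξ, w ξ * (a ξ * jumpWeight g (ξ i)) ∂P ≤
      b * (√(Real.exp M * meanAccept alg g lam φ σ) *
        √(∫ q, jumpWeight g q ^ 2 ∂(pairMeasure g))) := by
    have hbM : b * Real.exp M = 1 := by rw [← Real.exp_add]; simp
    -- The factor e^M scales the weighted acceptance probability into [0, 1], as the Cauchy–Schwarz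
    -- bound requires; its root mean is then the mean acceptance probability up to e^M.
    have h := integral_mul_le_sqrt (P := P) (T := fun ξ => Real.exp M * (w ξ * a ξ))
      (V := fun ξ => jumpWeight g (ξ i)) (by fun_prop)
      (fun ξ => mul_nonneg (Real.exp_pos _).le (wa0 ξ)) (fun ξ => by
        rw [← hbM, mul_comm]
        exact mul_le_mul_of_nonneg_right (wab ξ) (Real.exp_pos _).le)
      (fun ξ => jumpWeight_nonneg _ _) hGL
    rw [hg.integral_eval i (F := fun q => jumpWeight g q ^ 2) (mG.pow_const 2),
      integral_const_mul] at h
    rw [hg.meanAccept_eq alg hl hσ hφ he]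
    refine le_trans (le_of_eq ?_) (mul_le_mul_of_nonneg_left h (Real.exp_pos _).le)
    rw [← integral_const_mul]
    refine integral_congr_ae (ae_of_all _ fun ξ => ?_)
    linear_combination (-(w ξ * (a ξ * jumpWeight g (ξ i)))) * hbM
  refine ⟨hI, ?_, ?_, ?_⟩
  · rw [hE', ← integral_const_mul, ← integral_sub (hbd hdi) ((hbd hz).const_mul _)]
    rw [← hg.integral_eval i mG, ← integral_const_mul, ← integral_const_mul, ← integral_const_mul]
    refine abs_integral_le_integral_abs.trans (integral_mono
      ((hbd hdi).sub ((hbd hz).const_mul _)).abs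
      (((hGi.const_mul _).const_mul _).const_mul _) fun ξ => ?_)
    have hk := abs_sqDist_sub_le alg g hσ i (hl i) h1 ξ
    have e : w ξ * (a ξ * d ξ) - σ ^ 2 * (w ξ * (a ξ * (ξ i).2 ^ 2)) =
        w ξ * a ξ * (d ξ - σ ^ 2 * (ξ i).2 ^ 2) := by ring
    change |w ξ * (a ξ * d ξ) - σ ^ 2 * (w ξ * (a ξ * (ξ i).2 ^ 2))| ≤ _
    rw [e, abs_mul, abs_of_nonneg (wa0 ξ)]
    calc _ ≤ b * (σ ^ 2 * (σ / lam i) * jumpWeight g (ξ i)) :=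
          mul_le_mul (wab ξ) hk (abs_nonneg _) (Real.exp_pos _).le
      _ = _ := by ring
  · rw [hE']
    exact integral_nonneg fun ξ => mul_nonneg (w0 ξ) (mul_nonneg (a0 ξ) (hd0 ξ))
  · rw [hE']
    refine le_trans (integral_mono (hbd hdi) ((hbd hGi).const_mul (2 * σ ^ 2)) fun ξ => ?_) ?_
    · calc w ξ * (a ξ * d ξ) ≤ w ξ * (a ξ * (2 * σ ^ 2 * jumpWeight g (ξ i))) :=
            mul_le_mul_of_nonneg_left (mul_le_mul_of_nonneg_left (hd ξ) (a0 ξ)) (w0 ξ)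
        _ = _ := by ring
    · rw [integral_const_mul]
      exact mul_le_mul_of_nonneg_left hcomp (by positivity)

end Limits

section JumpLimits

variable {g : ℝ → ℝ} {κ Cm Cp l ρ : ℝ} {lam : (n : ℕ) → Fin n → ℝ} {σ : ℕ → ℝ}
  {φ ψ : (n : ℕ) → (Fin n → ℝ) → ℝ}

theorem LocalLipGrowth.eventually_measurable (hL : LocalLipGrowth κ ψ) :
    ∀ᶠ n in atTop, Measurable (ψ n) := by
  obtain ⟨δ, C, p, s, s', s'', -, hδ, -, -, -, -, -, hL⟩ := hL
  filter_upwards [hL] with n hn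
  exact (continuous_of_sNorm_lipschitz hδ hn.1).measurable

theorem memLp_sq_gaussianReal : MemLp (fun z : ℝ => z ^ 2) 2 (gaussianReal 0 1) := by
  refine (memLp_two_iff_integrable_sq (by fun_prop)).2 ?_
  simpa only [← pow_mul] using integrable_pow_gaussianReal (2 * 2)

/-- The weighted comparison with V = z_i², which has mean 1: the jump of a single coordinate is
asymptotically uncorrelated with acceptance. The drift only adds an error proportional to the
relative step of that coordinate. -/
theorem Regular.tendsto_meanSqJump_div_sub (hg : Regular g) (alg : Algorithm)
    (H : Scaling κ Cm Cp l ρ lam σ) (hρ : 2 * κ < ρ)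
    (hφ : ∀ n : ℕ, 1 ≤ n → Measurable (φ n))
    (hψ : ∀ n : ℕ, 1 ≤ n → ψ n =ᵐ[refMeasure g (lam n)] φ n)
    (hP : ∀ n : ℕ, 1 ≤ n → IsProbabilityMeasure (target g (lam n) (φ n)))
    (hM : UnifBoundedBelow ψ) (hL : LocalLipGrowth κ ψ) (i : ℕ) :
    Tendsto (fun n => meanSqJump alg g (lam n) (φ n) (σ n) i / σ n ^ 2 -
      ∫ ξ, cutExp (alg.totalRatio g (fun j => σ n / lam n j) ξ) ∂(productLaw g n)) atTop
      (𝓝 0) := by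
  obtain ⟨M, hMb⟩ := id hM
  rw [Metric.tendsto_nhds]
  intro ε hε
  set K := Real.exp (-M) * ∫ q, jumpWeight g q ∂(pairMeasure g)
  have hK : 0 ≤ K :=
    mul_nonneg (Real.exp_pos _).le (integral_nonneg fun q => jumpWeight_nonneg g q)
  filter_upwards [hg.eventually_abs_integral_weighted_sub_le alg H hρ hφ hP hψ hM hL
    (v := fun z => z ^ 2) (by fun_prop) (fun z => sq_nonneg z) memLp_sq_gaussianReal
    integral_sq_gaussianReal i (half_pos hε), eventually_gt_atTop i, hMb,
    hL.eventually_measurable, H.eventually_ratio hρ zero_lt_one,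
    H.eventually_ratio hρ (δ := ε / (2 * (K + 1))) (by positivity)] with n h hi hMn hm hr1 hr2
  have hn : 1 ≤ n := by omega
  have hσ := (H.step_sq n hn).1
  have hσ2 : 0 < σ n ^ 2 := by positivity
  have h1 := h hi
  have h2 := (hg.meanSqJump_bounds alg hσ (H.lam_pos n) (hφ n hn) hm (hψ n hn) hMn ⟨i, hi⟩
    (hr1 _).2.le).2.1
  set S := meanSqJump alg g (lam n) (φ n) (σ n) i
  have hr := hr2 ⟨i, hi⟩
  set A := ∫ ξ, Real.exp (-ψ n (scaledState (lam n) ξ)) *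
    (alg.acceptScaled g (lam n) (ψ n) (σ n) ξ * (ξ ⟨i, hi⟩).2 ^ 2) ∂(productLaw g n)
  have h3 : |S / σ n ^ 2 - A| ≤ σ n / lam n ⟨i, hi⟩ * K := by
    have e : S / σ n ^ 2 - A = (S - σ n ^ 2 * A) / σ n ^ 2 := by field_simp
    rw [e, abs_div, abs_of_pos hσ2, div_le_iff₀ hσ2]
    exact h2.trans (le_of_eq (by ring))
  have h4 : σ n / lam n ⟨i, hi⟩ * K < ε / 2 := by
    calc _ ≤ σ n / lam n ⟨i, hi⟩ * (K + 1) :=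
          mul_le_mul_of_nonneg_left (by linarith) hr.1.le
      _ < ε / (2 * (K + 1)) * (K + 1) := mul_lt_mul_of_pos_right hr.2 (by positivity)
      _ = ε / 2 := by field_simp
  rw [Real.dist_eq, sub_zero]
  have h5 := abs_sub_le (S / σ n ^ 2) A
    (∫ ξ, cutExp (alg.totalRatio g (fun j => σ n / lam n j) ξ) ∂(productLaw g n))
  linarith

/-- A fixed coordinate has a scale bounded below, so ρ > 0 is enough here, in contrast to the
uniform bound over all coordinates. Integrability of the jump therefore needs no condition ρ > 2κ.
-/
theorem Scaling.eventually_ratio_le_one (H : Scaling κ Cm Cp l ρ lam σ) (hρ : 0 < ρ) (i : ℕ) :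
    ∀ᶠ n in atTop, ∀ hi : i < n, σ n / lam n ⟨i, hi⟩ ≤ 1 := by
  have hc : 0 < Cm * ((i : ℝ) + 1) ^ (-κ) := mul_pos H.lower_pos (by positivity)
  have h0 : Tendsto (fun n : ℕ => l * (n : ℝ) ^ ((0 : ℝ) - ρ / 2)) atTop (𝓝 0) :=
    Scaling.tendsto_bound l (by linarith)
  filter_upwards [eventually_ge_atTop 1, h0.eventually (ge_mem_nhds hc)] with n hn h hi
  rw [div_le_one (H.lam_pos n _), H.step_eq hn]
  refine le_trans (le_trans (le_of_eq ?_) h) (H.bounds n ⟨i, hi⟩).1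
  rw [zero_sub, neg_div]

theorem Regular.eventually_integrable_sqJump (hg : Regular g) (alg : Algorithm)
    (H : Scaling κ Cm Cp l ρ lam σ) (hρ : 0 < ρ)
    (hφ : ∀ n : ℕ, 1 ≤ n → Measurable (φ n))
    (hψ : ∀ n : ℕ, 1 ≤ n → ψ n =ᵐ[refMeasure g (lam n)] φ n)
    (hM : UnifBoundedBelow ψ) (hL : LocalLipGrowth κ ψ) (i : ℕ) :
    ∀ᶠ n : ℕ in atTop,
      Integrable (sqJump alg g (lam n) (φ n) (σ n) i) (stepLaw g (lam n) (φ n)) := by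
  obtain ⟨M, hMb⟩ := hM
  filter_upwards [eventually_gt_atTop i, hMb, hL.eventually_measurable,
    H.eventually_ratio_le_one hρ i] with n hi hMn hm hr
  have hn : 1 ≤ n := by omega
  exact (hg.meanSqJump_bounds alg (H.step_sq n hn).1 (H.lam_pos n) (hφ n hn) hm (hψ n hn) hMn
    ⟨i, hi⟩ (hr hi)).1

theorem Regular.meanSqJump_isLittleO (hg : Regular g) (alg : Algorithm)
    (H : Scaling κ Cm Cp l ρ lam σ) (hρ : 2 * κ < ρ)
    (hφ : ∀ n : ℕ, 1 ≤ n → Measurable (φ n))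
    (hψ : ∀ n : ℕ, 1 ≤ n → ψ n =ᵐ[refMeasure g (lam n)] φ n)
    (hP : ∀ n : ℕ, 1 ≤ n → IsProbabilityMeasure (target g (lam n) (φ n)))
    (hM : UnifBoundedBelow ψ) (hL : LocalLipGrowth κ ψ) {a : ℝ}
    (ha : Tendsto (fun n => ∫ ξ, cutExp (alg.totalRatio g (fun j => σ n / lam n j) ξ)
      ∂(productLaw g n)) atTop (𝓝 a)) (i : ℕ) :
    (fun n : ℕ => meanSqJump alg g (lam n) (φ n) (σ n) i - l ^ 2 * a * (n : ℝ) ^ (-ρ))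
      =o[atTop] fun n : ℕ => (n : ℝ) ^ (-ρ) := by
  have h := (hg.tendsto_meanSqJump_div_sub alg H hρ hφ hψ hP hM hL i).add ha
  have h1 : Tendsto (fun n => l ^ 2 * (meanSqJump alg g (lam n) (φ n) (σ n) i / σ n ^ 2 - a))
      atTop (𝓝 0) := by
    simpa using (h.sub_const a).const_mul (l ^ 2)
  have h2 := ((isLittleO_one_iff ℝ).2 h1).mul_isBigO
    (isBigO_refl (fun n : ℕ => (n : ℝ) ^ (-ρ)) atTop)
  simp only [one_mul] at h2
  refine h2.congr' ?_ EventuallyEq.rfl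
  filter_upwards [eventually_ge_atTop 1] with n hn
  obtain ⟨h3, h4⟩ := H.step_sq n hn
  have h5 : σ n ^ 2 ≠ 0 := by positivity
  have h6 : meanSqJump alg g (lam n) (φ n) (σ n) i / σ n ^ 2 * (l ^ 2 * (n : ℝ) ^ (-ρ)) =
      meanSqJump alg g (lam n) (φ n) (σ n) i := by
    rw [← h4, div_mul_cancel₀ _ h5]
  linear_combination h6

theorem Regular.meanSqJump_isBigO (hg : Regular g) (alg : Algorithm)
    (H : Scaling κ Cm Cp l ρ lam σ) (hρ : 2 * κ < ρ) (hρ' : ρ < 2 * κ + alg.index)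
    (hφ : ∀ n : ℕ, 1 ≤ n → Measurable (φ n))
    (hψ : ∀ n : ℕ, 1 ≤ n → ψ n =ᵐ[refMeasure g (lam n)] φ n)
    (hP : ∀ n : ℕ, 1 ≤ n → IsProbabilityMeasure (target g (lam n) (φ n)))
    (hM : UnifBoundedBelow ψ) (hL : LocalLipGrowth κ ψ) (i : ℕ) (p : ℝ) :
    (fun n : ℕ => meanSqJump alg g (lam n) (φ n) (σ n) i) =O[atTop]
      fun n : ℕ => (n : ℝ) ^ (-p) := by
  -- The exponent is doubled because the jump is bounded by the square root of the mean acceptance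
  -- probability.
  have hacc := hg.tendsto_rpow_mul_meanAccept alg H hρ hρ' hφ hψ hP hM (2 * p)
  obtain ⟨M, hMb⟩ := hM
  have hρ0 : 0 < ρ := by linarith [H.exponent_nonneg]
  set K := 2 * l ^ 2 * (Real.exp (-M) *
    (√(Real.exp M) * √(∫ q, jumpWeight g q ^ 2 ∂(pairMeasure g))))
  have hK : 0 ≤ K := by positivity
  refine IsBigO.of_bound K ?_
  filter_upwards [eventually_gt_atTop i, hMb, hL.eventually_measurable,
    H.eventually_ratio hρ zero_lt_one, hacc.eventually (ge_mem_nhds zero_lt_one)]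
    with n hi hMn hm hr1 ha
  have hn : 1 ≤ n := by omega
  have hn0 : (0 : ℝ) < n := by exact_mod_cast hn
  obtain ⟨hσ, hσ2⟩ := H.step_sq n hn
  obtain ⟨-, -, h0, h1⟩ := hg.meanSqJump_bounds alg hσ (H.lam_pos n) (hφ n hn) hm (hψ n hn) hMn
    ⟨i, hi⟩ (hr1 _).2.le
  have hl : σ n ^ 2 ≤ l ^ 2 := by
    rw [hσ2]
    exact mul_le_of_le_one_right (sq_nonneg _)
      (Real.rpow_le_one_of_one_le_of_nonpos (by exact_mod_cast hn) (by linarith))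
  have hsq : √(meanAccept alg g (lam n) (φ n) (σ n)) ≤ (n : ℝ) ^ (-p) := by
    refine Real.sqrt_le_iff.2 ⟨by positivity, ?_⟩
    have e : ((n : ℝ) ^ (-p)) ^ 2 = ((n : ℝ) ^ (2 * p))⁻¹ := by
      rw [← Real.rpow_two, ← Real.rpow_mul hn0.le, ← Real.rpow_neg hn0.le]
      ring_nf
    rw [e, ← one_div, le_div_iff₀ (by positivity), mul_comm]
    exact ha
  rw [Real.norm_of_nonneg h0, Real.norm_of_nonneg (by positivity)]
  rw [Real.sqrt_mul (Real.exp_pos _).le] at h1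
  refine h1.trans ?_
  calc _ ≤ 2 * l ^ 2 * (Real.exp (-M) * (√(Real.exp M) * (n : ℝ) ^ (-p) *
        √(∫ q, jumpWeight g q ^ 2 ∂(pairMeasure g)))) := by gcongr
    _ = _ := by ring

end JumpLimits

/-! ### The trivial change of measure -/

theorem Regular.isProbabilityMeasure_target_zero {g : ℝ → ℝ} (hg : Regular g) {n : ℕ}
    {lam : Fin n → ℝ} (hl : ∀ i, 0 < lam i) :
    IsProbabilityMeasure (target g lam fun _ => 0) := by
  have := hg.isProbabilityMeasure_productLaw n
  have := isProbabilityMeasure_stdGauss n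
  have h := congrArg (Measure.map Prod.fst) (hg.map_productLaw hl)
  rw [Measure.map_map measurable_fst ((measurable_scaledState lam).prodMk measurable_noise),
    Measure.map_fst_prod, measure_univ, one_smul] at h
  have h0 : target g lam (fun _ => 0) = refMeasure g lam := by simp [target]
  rw [h0, ← h]
  exact Measure.isProbabilityMeasure_map (measurable_scaledState lam).aemeasurable

/-- The zero function satisfies all conditions, so the product case is an instance of the general
one; κ - 1 is any exponent below κ - 1/2. -/
theorem localLipGrowth_zero (κ : ℝ) : LocalLipGrowth κ fun _ _ => 0 :=
  ⟨fun _ _ => 0, 1, 1, κ - 1, κ - 1, κ - 1, fun _ _ _ _ => le_rfl,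
    fun _ => ⟨0, fun _ _ _ _ => le_rfl⟩, one_pos, one_pos, by linarith, by linarith, by linarith,
    Eventually.of_forall fun n => ⟨fun x y => by simp, fun x => by
      have := Real.rpow_nonneg (sNorm_nonneg (κ - 1) x) 1
      simp only [abs_zero, one_mul]
      linarith⟩⟩

theorem unifBoundedBelow_zero : UnifBoundedBelow fun _ _ => 0 :=
  ⟨0, Eventually.of_forall fun _ _ => le_rfl⟩

end

end LocalMH

theorem corollary1
    (g : ℝ → ℝ) (hg : Regular g)
    (κ Cm Cp : ℝ) (hκ : 0 ≤ κ) (hCm : 0 < Cm) (hCp : 0 < Cp)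
    (lam : (n : ℕ) → Fin n → ℝ)
    (hlam : ∀ (n : ℕ) (i : Fin n),
      Cm * ((i : ℕ) + 1 : ℝ) ^ (-κ) ≤ lam n i ∧ lam n i ≤ Cp * ((i : ℕ) + 1 : ℝ) ^ (-κ))
    (alg : Algorithm)
    (l ρ : ℝ) (hl : 0 < l) (hρ : 0 < ρ)
    (σ : ℕ → ℝ) (hσ : ∀ n : ℕ, 1 ≤ n → 0 < σ n ∧ σ n ^ 2 = l ^ 2 * (n : ℝ) ^ (-ρ)) :
    0 < alg.K g ∧
    -- the product case
    ((∀ L : ℝ, Tendsto (fun n : ℕ => alg.scaleSum κ (lam n)) atTop (𝓝 L) →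
        ρ = 2 * κ + alg.index →
        Tendsto (fun n : ℕ => meanAccept alg g (lam n) (fun _ => 0) (σ n)) atTop
          (𝓝 (alg.limitAccept g (1 / L) l))) ∧
      (2 * κ + alg.index < ρ →
        Tendsto (fun n : ℕ => meanAccept alg g (lam n) (fun _ => 0) (σ n)) atTop (𝓝 1)) ∧
      (2 * κ < ρ → ρ < 2 * κ + alg.index → ∀ p : ℝ, 0 ≤ p →
        Tendsto (fun n : ℕ => (n : ℝ) ^ p * meanAccept alg g (lam n) (fun _ => 0) (σ n)) atTop
          (𝓝 0))) ∧
    -- changes of measure; `ψ n` is a version of `φ n`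
    (∀ φ ψ : (n : ℕ) → (Fin n → ℝ) → ℝ,
      (∀ n : ℕ, 1 ≤ n → Measurable (φ n)) →
      (∀ n : ℕ, 1 ≤ n → IsProbabilityMeasure (target g (lam n) (φ n))) →
      (∀ n : ℕ, 1 ≤ n → ψ n =ᵐ[refMeasure g (lam n)] φ n) →
      -- bounded changes of measure
      (UnifBounded ψ →
        (2 * κ + alg.index ≤ ρ →
          0 < liminf (fun n : ℕ => meanAccept alg g (lam n) (φ n) (σ n)) atTop) ∧
        (2 * κ < ρ → ρ < 2 * κ + alg.index → ∀ p : ℝ, 0 ≤ p →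
          Tendsto (fun n : ℕ => (n : ℝ) ^ p * meanAccept alg g (lam n) (φ n) (σ n)) atTop
            (𝓝 0))) ∧
      (UnifBoundedBelow ψ → LocalLipGrowth κ ψ →
        -- average acceptance probability
        ((∀ L : ℝ, Tendsto (fun n : ℕ => alg.scaleSum κ (lam n)) atTop (𝓝 L) →
            ρ = 2 * κ + alg.index →
            Tendsto (fun n : ℕ => meanAccept alg g (lam n) (φ n) (σ n)) atTop
              (𝓝 (alg.limitAccept g (1 / L) l))) ∧
          (2 * κ + alg.index < ρ →
            Tendsto (fun n : ℕ => meanAccept alg g (lam n) (φ n) (σ n)) atTop (𝓝 1)) ∧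
          (2 * κ < ρ → ρ < 2 * κ + alg.index → ∀ p : ℝ, 0 ≤ p →
            Tendsto (fun n : ℕ => (n : ℝ) ^ p * meanAccept alg g (lam n) (φ n) (σ n)) atTop
              (𝓝 0))) ∧
        -- mean squared-jump-distance of an arbitrary fixed coordinate `i`
        (∀ i : ℕ,
          (∀ᶠ n : ℕ in atTop,
            Integrable (sqJump alg g (lam n) (φ n) (σ n) i) (stepLaw g (lam n) (φ n))) ∧
          (∀ L : ℝ, Tendsto (fun n : ℕ => alg.scaleSum κ (lam n)) atTop (𝓝 L) →
            ρ = 2 * κ + alg.index →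
            (fun n : ℕ => meanSqJump alg g (lam n) (φ n) (σ n) i -
                l ^ 2 * alg.limitAccept g (1 / L) l * (n : ℝ) ^ (-(2 * κ) - alg.index))
              =o[atTop] fun n : ℕ => (n : ℝ) ^ (-(2 * κ) - alg.index)) ∧
          (2 * κ + alg.index < ρ →
            (fun n : ℕ => meanSqJump alg g (lam n) (φ n) (σ n) i - l ^ 2 * (n : ℝ) ^ (-ρ))
              =o[atTop] fun n : ℕ => (n : ℝ) ^ (-ρ)) ∧
          (2 * κ < ρ → ρ < 2 * κ + alg.index → ∀ p : ℝ, 0 ≤ p →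
            (fun n : ℕ => meanSqJump alg g (lam n) (φ n) (σ n) i)
              =O[atTop] fun n : ℕ => (n : ℝ) ^ (-p))))) := by
  have H : Scaling κ Cm Cp l ρ lam σ := ⟨hκ, hCm, hCp, hlam, hl, hσ⟩
  have hI := alg.index_pos
  have hexp : ρ = 2 * κ + alg.index → -(2 * κ) - alg.index = -ρ := fun h => by linarith
  have accept (φ ψ : (n : ℕ) → (Fin n → ℝ) → ℝ) (hφ : ∀ n : ℕ, 1 ≤ n → Measurable (φ n))
      (hP : ∀ n : ℕ, 1 ≤ n → IsProbabilityMeasure (target g (lam n) (φ n)))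
      (hψ : ∀ n : ℕ, 1 ≤ n → ψ n =ᵐ[refMeasure g (lam n)] φ n)
      (hM : UnifBoundedBelow ψ) (hL : LocalLipGrowth κ ψ) :
      (∀ L : ℝ, Tendsto (fun n : ℕ => alg.scaleSum κ (lam n)) atTop (𝓝 L) →
        ρ = 2 * κ + alg.index →
        Tendsto (fun n : ℕ => meanAccept alg g (lam n) (φ n) (σ n)) atTop
          (𝓝 (alg.limitAccept g (1 / L) l))) ∧
      (2 * κ + alg.index < ρ →
        Tendsto (fun n : ℕ => meanAccept alg g (lam n) (φ n) (σ n)) atTop (𝓝 1)) ∧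
      (2 * κ < ρ → ρ < 2 * κ + alg.index → ∀ p : ℝ, 0 ≤ p →
        Tendsto (fun n : ℕ => (n : ℝ) ^ p * meanAccept alg g (lam n) (φ n) (σ n)) atTop
          (𝓝 0)) :=
    ⟨fun L hlim h => hg.tendsto_meanAccept alg H (by linarith) hφ hψ hP hM hL
        (hg.tendsto_productAccept alg H hlim h),
      fun h => hg.tendsto_meanAccept alg H (by linarith) hφ hψ hP hM hL
        (hg.tendsto_productAccept_one alg H h),
      fun h1 h2 p _ => hg.tendsto_rpow_mul_meanAccept alg H h1 h2 hφ hψ hP hM p⟩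
  refine ⟨hg.K_pos alg, ?_, fun φ ψ hφ hP hψ => ⟨fun hB => ⟨fun h => ?_, fun h1 h2 p _ => ?_⟩,
    fun hM hL => ⟨accept φ ψ hφ hP hψ hM hL, fun i => ?_⟩⟩⟩
  · exact accept (fun _ _ => 0) (fun _ _ => 0) (fun _ _ => measurable_const)
      (fun n _ => hg.isProbabilityMeasure_target_zero (H.lam_pos n))
      (fun _ _ => EventuallyEq.rfl) unifBoundedBelow_zero (localLipGrowth_zero κ)
  · exact hg.liminf_meanAccept_pos alg H h hφ hψ hP hB
  · exact hg.tendsto_rpow_mul_meanAccept alg H h1 h2 hφ hψ hP hB.below p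
  · refine ⟨hg.eventually_integrable_sqJump alg H hρ hφ hψ hM hL i, fun L hlim h => ?_,
      fun h => ?_, fun h1 h2 p _ => hg.meanSqJump_isBigO alg H h1 h2 hφ hψ hP hM hL i p⟩
    · rw [hexp h]
      exact hg.meanSqJump_isLittleO alg H (by linarith) hφ hψ hP hM hL
        (hg.tendsto_productAccept alg H hlim h) i
    · simpa using hg.meanSqJump_isLittleO alg H (by linarith) hφ hψ hP hM hL
        (hg.tendsto_productAccept_one alg H h) i
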